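/- Let $d\in\{2,3\}$ and $\kappa>0$. There is a constant $C_r>0$, depending only on $d$ and $\kappa$, with the following property. Let $\Omega\subset\mathbb R^d$ be a bounded open polyhedral domain, and let $\mathcal T_h$ be a conforming triangulation of $\Omega$ into finitely many closed simplices $K$ such that $h_K\le\kappa\rho_K$ for all $K\in\mathcal T_h$, where $h_K$ is the diameter of $K$ and $\rho_K$ is the diameter of the largest ball inscribed in $K$. Let $V_h$ be the space of continuous functions on $\Omega$ that are affine on each $K\in\mathcal T_h$, let $V_h^0$ be the subspace of those that vanish on $\partial\Omega$, and put $W_h=(V_h)^d$. Let $f\in L^2(\Omega)$, let $u\in H^1_0(\Omega)$ be the weak solution of $-\Delta u=f$ in $\Omega$, $u=0$ on $\partial\Omega$, i.e. $(\nabla u,\nabla v)=(f,v)$ for all $v\in H_0^1(\Omega)$, and let $u_h\in V_h^0$ be the finite element solution, i.e. $(\nabla u_h,\nabla v_h)=(f,v_h)$ for all $v_h\in V_h^0$, where $(\cdot,\cdot)$ is the $L^2(\Omega)$ inner product. Let $G:V_h\to W_h$ be any gradient recovery operator (no property of $G$ is needed; in particular, no saturation assumption), and write $G(\nabla u_h)\in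 W_h$ for the recovered gradient of $u_h$. Then $$\|\nabla u-\nabla u_h\|_{L^2(\Omega)}^2\le C_r\sum_{K\in\mathcal T_h}\Bigl(\|G(\nabla u_h)-\nabla u_h\|_{L^2(K)}^2+h_K^2\,\|f+\nabla\cdot G(\nabla u_h)\|_{L^2(K)}^2\Bigr).$$ -/

import Mathlib

open MeasureTheory Set Filter Topology
open scoped Gradient ContDiff

namespace FEM

noncomputable section

/-! ### Sobolev spaces on an open subset of `ℝ^d` -/

/-- `φ ∈ C_c^∞(Ω)`. -/
def IsTestFunction {d : ℕ} (Ω : Set (EuclideanSpace ℝ (Fin d)))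
    (φ : EuclideanSpace ℝ (Fin d) → ℝ) : Prop :=
  ContDiff ℝ ∞ φ ∧ HasCompactSupport φ ∧ tsupport φ ⊆ Ω

/-- `g` is the weak gradient of `u` on `Ω`. -/
def IsWeakGradient {d : ℕ} (Ω : Set (EuclideanSpace ℝ (Fin d)))
    (u : EuclideanSpace ℝ (Fin d) → ℝ)
    (g : EuclideanSpace ℝ (Fin d) → EuclideanSpace ℝ (Fin d)) : Prop :=
  ∀ φ, IsTestFunction Ω φ → ∫ x in Ω, u x • ∇ φ x = -∫ x in Ω, φ x • g x

/-- `u ∈ H¹(Ω)`, with weak gradient `g`. -/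
def MemH1 {d : ℕ} (Ω : Set (EuclideanSpace ℝ (Fin d)))
    (u : EuclideanSpace ℝ (Fin d) → ℝ)
    (g : EuclideanSpace ℝ (Fin d) → EuclideanSpace ℝ (Fin d)) : Prop :=
  MemLp u 2 (volume.restrict Ω) ∧ MemLp g 2 (volume.restrict Ω) ∧ IsWeakGradient Ω u g

/-- `u ∈ H¹₀(Ω)`, with weak gradient `g`: the function `u ∈ H¹(Ω)` is a limit in the `H¹` norm of
functions in `C_c^∞(Ω)`. -/
def MemH10 {d : ℕ} (Ω : Set (EuclideanSpace ℝ (Fin d)))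
    (u : EuclideanSpace ℝ (Fin d) → ℝ)
    (g : EuclideanSpace ℝ (Fin d) → EuclideanSpace ℝ (Fin d)) : Prop :=
  MemH1 Ω u g ∧
    ∃ φ : ℕ → EuclideanSpace ℝ (Fin d) → ℝ, (∀ n, IsTestFunction Ω (φ n)) ∧
      Tendsto (fun n => eLpNorm (fun x => φ n x - u x) 2 (volume.restrict Ω)) atTop (𝓝 0) ∧
      Tendsto (fun n => eLpNorm (fun x => ∇ (φ n) x - g x) 2 (volume.restrict Ω)) atTop (𝓝 0)

/-- `u`, with weak gradient `Du`, is the weak solution of `-Δu = f` in `Ω`, `u = 0` on `∂Ω`. -/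
def IsWeakSolution {d : ℕ} (Ω : Set (EuclideanSpace ℝ (Fin d)))
    (f u : EuclideanSpace ℝ (Fin d) → ℝ)
    (Du : EuclideanSpace ℝ (Fin d) → EuclideanSpace ℝ (Fin d)) : Prop :=
  MemH10 Ω u Du ∧
    ∀ v Dv, MemH10 Ω v Dv → ∫ x in Ω, inner ℝ (Du x) (Dv x) = ∫ x in Ω, f x * v x

/-! ### Conforming triangulations -/

/-- A conforming simplicial triangulation of the polyhedral set `Ω ⊆ ℝ^d`. The elements are the
`d`-dimensional simplices of a finite geometric simplicial complex (two simplices meet in a common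
face, or not at all), every face belongs to an element, the closed elements cover the closure
of `Ω`, and the boundary of `Ω` is a union of `(d-1)`-dimensional faces. -/
structure Triangulation {d : ℕ} (Ω : Set (EuclideanSpace ℝ (Fin d)))
    extends Geometry.SimplicialComplex ℝ (EuclideanSpace ℝ (Fin d)) where
  finite_faces : faces.Finite
  pure : ∀ s ∈ faces, ∃ t ∈ faces, s ⊆ t ∧ t.card = d + 1
  covers : ⋃ s ∈ faces, convexHull ℝ (s : Set (EuclideanSpace ℝ (Fin d))) = closure Ω
  boundary : ∀ x ∈ frontier Ω, ∃ s ∈ faces, s.card = d ∧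
    x ∈ convexHull ℝ (s : Set (EuclideanSpace ℝ (Fin d))) ∧
    convexHull ℝ (s : Set (EuclideanSpace ℝ (Fin d))) ⊆ frontier Ω

/-- The elements `K`, each given by its set of `d + 1` vertices. -/
def Triangulation.elements {d : ℕ} {Ω : Set (EuclideanSpace ℝ (Fin d))} (T : Triangulation Ω) :
    Finset (Finset (EuclideanSpace ℝ (Fin d))) :=
  T.finite_faces.toFinset.filter (fun s => s.card = d + 1)

/-- The closed simplex with vertex set `K`. -/
abbrev body {d : ℕ} (K : Finset (EuclideanSpace ℝ (Fin d))) : Set (EuclideanSpace ℝ (Fin d)) :=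
  convexHull ℝ (K : Set (EuclideanSpace ℝ (Fin d)))

/-- `h_K`, the diameter of the element. -/
def elementDiam {d : ℕ} (K : Finset (EuclideanSpace ℝ (Fin d))) : ℝ :=
  Metric.diam (body K)

/-- `ρ_K`, the diameter of the largest ball inscribed in the element. -/
def inscribedDiam {d : ℕ} (K : Finset (EuclideanSpace ℝ (Fin d))) : ℝ :=
  sSup {t : ℝ | ∃ (x : EuclideanSpace ℝ (Fin d)) (r : ℝ),
    0 ≤ r ∧ t = 2 * r ∧ Metric.closedBall x r ⊆ body K}

/-- Shape regularity: `h_K ≤ κ ρ_K` for all elements `K`. -/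
def Triangulation.IsRegular {d : ℕ} {Ω : Set (EuclideanSpace ℝ (Fin d))} (T : Triangulation Ω)
    (κ : ℝ) : Prop :=
  ∀ K ∈ T.elements, elementDiam K ≤ κ * inscribedDiam K

/-! ### The finite element spaces and the discrete problem -/

/-- `V_h`: continuous functions on `Ω` whose restriction to each element is affine. Only the values
on `Ω` matter. (For piecewise affine functions, being continuous on `Ω` is the same as being
in `H¹(Ω)`.) -/
def P1Space {d : ℕ} {Ω : Set (EuclideanSpace ℝ (Fin d))} (T : Triangulation Ω) :
    Set (EuclideanSpace ℝ (Fin d) → ℝ) :=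
  {v | ContinuousOn v Ω ∧ ∀ K ∈ T.elements,
    ∃ a : EuclideanSpace ℝ (Fin d) →ᵃ[ℝ] ℝ, EqOn v a (body K ∩ Ω)}

/-- `V_h⁰`: the functions in `V_h` that vanish on `∂Ω`. -/
def P1Space0 {d : ℕ} {Ω : Set (EuclideanSpace ℝ (Fin d))} (T : Triangulation Ω) :
    Set (EuclideanSpace ℝ (Fin d) → ℝ) :=
  {v | v ∈ P1Space T ∧ ∀ x ∈ frontier Ω, Tendsto v (𝓝[Ω] x) (𝓝 0)}

/-- `W_h = (V_h)^d`, the space of recovered gradients. -/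
def RecoverySpace {d : ℕ} {Ω : Set (EuclideanSpace ℝ (Fin d))} (T : Triangulation Ω) :
    Set (EuclideanSpace ℝ (Fin d) → EuclideanSpace ℝ (Fin d)) :=
  {σ | ∀ i, (fun x => σ x i) ∈ P1Space T}

/-- `u_h` is the finite element solution: `u_h ∈ V_h⁰` and `(∇u_h, ∇v_h) = (f, v_h)` for all
`v_h ∈ V_h⁰`. The gradients are the classical ones, which exist in the interior of each element. -/
def IsDiscreteSolution {d : ℕ} {Ω : Set (EuclideanSpace ℝ (Fin d))} (T : Triangulation Ω)
    (f uh : EuclideanSpace ℝ (Fin d) → ℝ) : Prop :=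
  uh ∈ P1Space0 T ∧
    ∀ vh ∈ P1Space0 T, ∫ x in Ω, inner ℝ (∇ uh x) (∇ vh x) = ∫ x in Ω, f x * vh x

/-! ### The estimator -/

/-- The divergence of a vector field, computed from its classical derivatives. -/
def divergence {d : ℕ} (σ : EuclideanSpace ℝ (Fin d) → EuclideanSpace ℝ (Fin d))
    (x : EuclideanSpace ℝ (Fin d)) : ℝ :=
  ∑ i, fderiv ℝ (fun y => σ y i) x (EuclideanSpace.single i 1)

/-- `η_K² = ‖σ - ∇u_h‖²_{0,K} + h_K² ‖f + ∇·σ‖²_{0,K}`, where `σ` is the recovered gradient. -/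
def estimatorSq {d : ℕ} (f uh : EuclideanSpace ℝ (Fin d) → ℝ)
    (σ : EuclideanSpace ℝ (Fin d) → EuclideanSpace ℝ (Fin d))
    (K : Finset (EuclideanSpace ℝ (Fin d))) : ℝ :=
  (∫ x in body K, ‖σ x - ∇ uh x‖ ^ 2) +
    elementDiam K ^ 2 * ∫ x in body K, (f x + divergence σ x) ^ 2

end

end FEM

/-! Put e = u - u_h, an element of H¹₀(Ω). Testing the discrete problem with u_h itself gives (∇u_h,
∇e) = 0, so the squared error equals the residual R(e) = (f, e) - (∇u_h, ∇e). By Galerkin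
orthogonality R(e) = R(w) for w = e - v with any v ∈ V_h⁰. The recovered gradient σ is continuous
and piecewise affine, so Green's formula holds on all of Ω without jump terms, and R(w) = (f + div
σ, w) + (σ - ∇u_h, ∇w). Young's inequality on each element, with weight h_K, bounds this by the
estimator plus a small multiple of Σ (h_K⁻²‖w‖² + ‖∇w‖²). If v can be chosen so that this last sum
is at most C‖∇e‖², it is absorbed on the left (`residual_le`, `error_le`).

The core is therefore a quasi-interpolation operator into V_h⁰ (`exists_quasiInterpolant`). Each
vertex z gets one nodal value b that approximates e in L² on every element of the star of z. It
comes from a Poincaré inequality on a single element if z ∈ Ω. If z ∈ ∂Ω, then b = 0 and a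
Friedrichs inequality is used on an element with a facet on ∂Ω. The bound is carried to the other
elements across common facets (`setIntegral_sq_sub_const_le_of_adjacent`). This requires that the
star be facet-connected at interior vertices, and that each facet-component contain a boundary facet
at boundary vertices; both follow from a general position argument (`component_mem_nhds`). Shape
regularity bounds the number of steps.

Quasi-interpolation is carried out for smooth functions only: e is approximated by test functions
and the final inequality passes to the limit. That u_h belongs to H¹₀(Ω) is itself proved, by soft
thresholding and mollification (`IsPiecewiseAffine.memH10`). No regularity of ∂Ω enters beyond its
being a union of faces, so slits are allowed. -/

open scoped NNReal

namespace FEM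

/-- `d`-dimensional Euclidean space. -/
abbrev Euc (d : ℕ) := EuclideanSpace ℝ (Fin d)

/-- `K` is the vertex set of a nondegenerate `d`-simplex. -/
def IsSimplex {d : ℕ} (K : Finset (Euc d)) : Prop :=
  AffineIndependent ℝ ((↑) : K → Euc d) ∧ K.card = d + 1

/-! ### Barycentric coordinates and null sets of simplices. -/

section Barycentric

variable {d : ℕ} {K : Finset (Euc d)}

/-- The vertices of a simplex as an affine basis. -/
noncomputable def IsSimplex.basis (h : IsSimplex K) : AffineBasis K ℝ (Euc d) where
  toFun := (↑)
  ind' := h.1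
  tot' := by
    rw [h.1.affineSpan_eq_top_iff_card_eq_finrank_add_one]
    simp [h.2]

@[simp] lemma IsSimplex.basis_apply (h : IsSimplex K) (v : K) : h.basis v = v := rfl

open Classical in
/-- The barycentric coordinate of the vertex `z` in the simplex `K`. -/
noncomputable def bary (K : Finset (Euc d)) (z : Euc d) : Euc d →ᵃ[ℝ] ℝ :=
  if h : IsSimplex K ∧ z ∈ K then h.1.basis.coord ⟨z, h.2⟩ else AffineMap.const ℝ _ 0

lemma bary_eq (h : IsSimplex K) (v : K) : bary K v = h.basis.coord v := by
  rw [bary, dif_pos ⟨h, v.2⟩]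

lemma bary_self (h : IsSimplex K) {z : Euc d} (hz : z ∈ K) : bary K z z = 1 := by
  rw [bary_eq h ⟨z, hz⟩]
  exact h.basis.coord_apply_eq ⟨z, hz⟩

lemma bary_ne (h : IsSimplex K) {z v : Euc d} (hz : z ∈ K) (hv : v ∈ K) (hzv : z ≠ v) :
    bary K z v = 0 := by
  rw [bary_eq h ⟨z, hz⟩]
  exact h.basis.coord_apply_ne (i := ⟨z, hz⟩) (j := ⟨v, hv⟩) (by simpa using hzv)

lemma sum_bary (h : IsSimplex K) (x : Euc d) : ∑ z ∈ K, bary K z x = 1 := by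
  rw [← Finset.sum_coe_sort, ← h.basis.sum_coord_apply_eq_one x]
  exact Finset.sum_congr rfl fun v _ => by rw [bary_eq h]

lemma sum_bary_smul (h : IsSimplex K) (x : Euc d) : ∑ z ∈ K, bary K z x • z = x := by
  rw [← Finset.sum_coe_sort]
  conv_rhs => rw [← h.basis.linear_combination_coord_eq_self x]
  exact Finset.sum_congr rfl fun v _ => by rw [bary_eq h]; rfl

lemma mem_body_iff (h : IsSimplex K) {x : Euc d} : x ∈ body K ↔ ∀ z ∈ K, 0 ≤ bary K z x := by
  have := h.basis.convexHull_eq_nonneg_coord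
  have hr : range h.basis = (K : Set (Euc d)) := Subtype.range_coe
  rw [hr] at this
  rw [body, this]
  constructor
  · intro hx z hz
    rw [bary_eq h ⟨z, hz⟩]
    exact hx _
  · intro hx v
    rw [← bary_eq h]
    exact hx v v.2

lemma mem_interior_body_iff (h : IsSimplex K) {x : Euc d} :
    x ∈ interior (body K) ↔ ∀ z ∈ K, 0 < bary K z x := by
  have := h.basis.interior_convexHull
  have hr : range h.basis = (K : Set (Euc d)) := Subtype.range_coe
  rw [hr] at this
  rw [body, this]
  constructor
  · intro hx z hz
    rw [bary_eq h ⟨z, hz⟩]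
    exact hx _
  · intro hx v
    rw [← bary_eq h]
    exact hx v v.2

lemma eqOn_convexHull_of_eqOn {F : Type*} [AddCommGroup F] [Module ℝ F] {a b : Euc d →ᵃ[ℝ] F}
    {s : Set (Euc d)} (h : EqOn a b s) : EqOn a b (convexHull ℝ s) := by
  have hc : Convex ℝ {x | a x = b x} := by
    intro x hx y hy p q _ _ hpq
    simp only [mem_ofPred_eq] at *
    rw [Convex.combo_affine_apply hpq, Convex.combo_affine_apply hpq, hx, hy]
  exact convexHull_min h hc

lemma affineMap_eq_sum_bary (h : IsSimplex K) (a : Euc d →ᵃ[ℝ] ℝ) (x : Euc d) :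
    a x = ∑ z ∈ K, bary K z x * a z := by
  have h1 := sum_bary h x
  have h2 := sum_bary_smul h x
  have : a x = a.linear x + a 0 := by rw [a.decomp']; simp
  rw [this]
  conv_lhs => rw [← h2, map_sum, ← one_mul (a 0), ← h1, Finset.sum_mul, ← Finset.sum_add_distrib]
  refine Finset.sum_congr rfl fun z _ => ?_
  have : a z = a.linear z + a 0 := by rw [a.decomp']; simp
  rw [this, map_smul, smul_eq_mul]
  ring

lemma affineMap_ext_simplex (h : IsSimplex K) {a b : Euc d →ᵃ[ℝ] ℝ} (hab : ∀ z ∈ K, a z = b z) :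
    a = b := by
  ext x
  rw [affineMap_eq_sum_bary h a, affineMap_eq_sum_bary h b]
  exact Finset.sum_congr rfl fun z hz => by rw [hab z hz]

lemma bary_eq_zero_of_mem_convexHull (h : IsSimplex K) {t : Set (Euc d)}
    (ht : t ⊆ (K : Set (Euc d))) {z : Euc d} (hz : z ∈ K) (hzt : z ∉ t) {x : Euc d}
    (hx : x ∈ convexHull ℝ t) : bary K z x = 0 := by
  have : EqOn (bary K z) (AffineMap.const ℝ (Euc d) (0 : ℝ)) t := fun v hv => by
    simpa using bary_ne h hz (ht hv) (by rintro rfl; exact hzt hv)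
  simpa using eqOn_convexHull_of_eqOn this hx

/-- The vertices with positive coordinate span the carrier of `x`, the smallest face of `K` that
contains it. -/
lemma mem_convexHull_support (h : IsSimplex K) {x : Euc d} (hx : x ∈ body K) :
    x ∈ convexHull ℝ ((K.filter fun z => 0 < bary K z x : Finset (Euc d)) : Set (Euc d)) := by
  rw [Finset.convexHull_eq]
  refine ⟨fun z => bary K z x, fun z hz => (Finset.mem_filter.1 hz).2.le, ?_, ?_⟩
  · rw [← sum_bary h x]
    refine Finset.sum_subset (Finset.filter_subset _ _) fun z hz hz' => ?_
    refine le_antisymm ?_ ((mem_body_iff h).1 hx z hz)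
    simpa [hz] using hz'
  · rw [Finset.centerMass_eq_of_sum_1]
    · conv_rhs => rw [← sum_bary_smul h x]
      refine Finset.sum_subset (Finset.filter_subset _ _) fun z hz hz' => ?_
      have : bary K z x = 0 := by
        refine le_antisymm ?_ ((mem_body_iff h).1 hx z hz)
        simpa [hz] using hz'
      simp [this]
    · rw [← sum_bary h x]
      refine Finset.sum_subset (Finset.filter_subset _ _) fun z hz hz' => ?_
      refine le_antisymm ?_ ((mem_body_iff h).1 hx z hz)
      simpa [hz] using hz'

lemma bary_mem_Icc (h : IsSimplex K) {x : Euc d} (hx : x ∈ body K) {z : Euc d} (hz : z ∈ K) :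
    bary K z x ∈ Icc (0 : ℝ) 1 := by
  refine ⟨(mem_body_iff h).1 hx z hz, ?_⟩
  rw [← sum_bary h x]
  exact Finset.single_le_sum (f := fun z => bary K z x)
    (fun w hw => (mem_body_iff h).1 hx w hw) hz

lemma isCompact_convexHull_finset (s : Finset (Euc d)) :
    IsCompact (convexHull ℝ (s : Set (Euc d))) :=
  s.finite_toSet.isCompact_convexHull ℝ

lemma IsSimplex.nonempty (h : IsSimplex K) : K.Nonempty := by
  rw [← Finset.card_pos, h.2]; omega

lemma IsSimplex.interior_nonempty (h : IsSimplex K) : (interior (body K)).Nonempty := by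
  refine ⟨∑ v ∈ K, ((K.card : ℝ)⁻¹) • v, ?_⟩
  rw [body]
  have hK : (0 : ℝ) < K.card := by exact_mod_cast Finset.card_pos.2 h.nonempty
  rw [mem_interior_body_iff h]
  intro z hz
  have : bary K z (∑ v ∈ K, ((K.card : ℝ)⁻¹) • v) = ∑ v ∈ K, (K.card : ℝ)⁻¹ * bary K z v := by
    have hs : ∑ v ∈ K, (K.card : ℝ)⁻¹ = 1 := by
      rw [Finset.sum_const, nsmul_eq_mul, mul_inv_cancel₀ hK.ne']
    rw [← Finset.affineCombination_eq_linear_combination K _ _ hs, Finset.map_affineCombination _ _ _ hs,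
      Finset.affineCombination_eq_linear_combination K _ _ hs]
    simp
  rw [this]
  refine Finset.sum_pos' (fun v hv => ?_) ⟨z, hz, ?_⟩
  · have := (bary_mem_Icc h (subset_convexHull ℝ _ (Finset.mem_coe.2 hv)) hz).1
    positivity
  · rw [bary_self h hz]; positivity

lemma IsSimplex.closure_interior (h : IsSimplex K) : closure (interior (body K)) = body K := by
  rw [(convex_convexHull ℝ _).closure_interior_eq_closure_of_nonempty_interior h.interior_nonempty]
  exact (isCompact_convexHull_finset K).isClosed.closure_eq

lemma volume_body_diff_interior (K : Finset (Euc d)) :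
    volume (body K \ interior (body K)) = 0 := by
  refine measure_mono_null ?_ ((convex_convexHull ℝ (K : Set (Euc d))).addHaar_frontier volume)
  exact sdiff_subset_sdiff_left subset_closure

lemma ae_mem_interior_body (K : Finset (Euc d)) :
    ∀ᵐ x, x ∈ body K → x ∈ interior (body K) := by
  have := measure_eq_zero_iff_ae_notMem.1 (volume_body_diff_interior K)
  filter_upwards [this] with x hx hxK
  by_contra hn
  exact hx ⟨hxK, hn⟩

/-- A face with at most `d` vertices spans a proper affine subspace. -/
lemma volume_affineSpan_eq_zero {s : Finset (Euc d)} (hs : s.card ≤ d) :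
    volume (affineSpan ℝ (s : Set (Euc d)) : Set (Euc d)) = 0 := by
  refine Measure.addHaar_affineSubspace _ _ fun htop => ?_
  have h1 : vectorSpan ℝ (s : Set (Euc d)) = ⊤ := by
    rw [← direction_affineSpan, htop, AffineSubspace.direction_top]
  rcases s.eq_empty_or_nonempty with rfl | hne
  · simp at htop
  · have := finrank_vectorSpan_image_finset_le ℝ (id : Euc d → Euc d) s (n := s.card - 1)
      (by have := hne.card_pos; omega)
    rw [Finset.image_id, h1, finrank_top] at this
    simp at this
    have := hne.card_pos
    omega

end Barycentric

/-! ### Poincaré inequalities by integration along affine contractions. -/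

section Homotopy

variable {d : ℕ}

lemma integrableOn_of_continuous {f : Euc d → ℝ} {K : Set (Euc d)} (hf : Continuous f)
    (hK : IsCompact K) : IntegrableOn f K :=
  hf.continuousOn.integrableOn_compact hK

lemma det_mul_setIntegral_comp_eq {K : Set (Euc d)} (hK : MeasurableSet K)
    (T : Euc d →ᵃ[ℝ] Euc d) (hT : LinearMap.det T.linear ≠ 0) (g : Euc d → ℝ) :
    |LinearMap.det T.linear| * ∫ x in K, g (T x) = ∫ x in T '' K, g x := by
  have hd : ∀ x ∈ K, HasFDerivWithinAt T (LinearMap.toContinuousLinearMap T.linear) K x := by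
    intro x _
    have h1 := (LinearMap.toContinuousLinearMap T.linear).hasFDerivWithinAt (x := x) (s := K)
    have h2 := h1.add_const (T 0)
    refine h2.congr_of_eventuallyEq (Eventually.of_forall fun y => ?_) ?_
    · have := congrFun T.decomp y; simpa using this
    · have := congrFun T.decomp x; simpa using this
  have hinj : Function.Injective T := by
    rw [← AffineMap.linear_injective_iff]
    have := (LinearMap.isUnit_iff_ker_eq_bot T.linear).1
      ((LinearMap.isUnit_iff_isUnit_det _).2 (isUnit_iff_ne_zero.2 hT))
    exact LinearMap.ker_eq_bot.1 this
  rw [integral_image_eq_integral_abs_det_fderiv_smul volume hK hd hinj.injOn]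
  simp only [smul_eq_mul]
  rw [integral_const_mul]
  simp [ContinuousLinearMap.det]

/-- The determinant stays on the left so that degenerate maps, such as the endpoint of a collapse,
are covered. -/
lemma det_mul_setIntegral_comp_le {K : Set (Euc d)} (hK : IsCompact K)
    (T : Euc d →ᵃ[ℝ] Euc d) (hTK : MapsTo T K K) {g : Euc d → ℝ} (hg : Continuous g)
    (hg0 : ∀ x, 0 ≤ g x) :
    |LinearMap.det T.linear| * ∫ x in K, g (T x) ≤ ∫ x in K, g x := by
  by_cases hT : LinearMap.det T.linear = 0
  · rw [hT]; simpa using integral_nonneg hg0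
  rw [det_mul_setIntegral_comp_eq hK.measurableSet T hT]
  exact setIntegral_mono_set (hg.continuousOn.integrableOn_compact hK)
    (Eventually.of_forall hg0) hTK.image_subset.eventuallyLE

lemma sq_intervalIntegral_le {h : ℝ → ℝ} (hh : Continuous h) :
    (∫ t in (0 : ℝ)..1, h t) ^ 2 ≤ ∫ t in (0 : ℝ)..1, h t ^ 2 := by
  set m := ∫ t in (0 : ℝ)..1, h t with hm
  have h0 : 0 ≤ ∫ t in (0 : ℝ)..1, (h t - m) ^ 2 :=
    intervalIntegral.integral_nonneg (by norm_num) fun t _ => sq_nonneg _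
  have h1 : ∫ t in (0 : ℝ)..1, (h t - m) ^ 2 = (∫ t in (0 : ℝ)..1, h t ^ 2) - m ^ 2 := by
    have : ∀ t, (h t - m) ^ 2 = h t ^ 2 - (2 * m * h t - m ^ 2) := fun t => by ring
    simp_rw [this]
    rw [intervalIntegral.integral_sub, intervalIntegral.integral_sub,
      intervalIntegral.integral_const_mul, ← hm]
    · simp; ring
    all_goals exact Continuous.intervalIntegrable (by fun_prop) _ _
  linarith

/-- Moving from `x` to `q x` along the path `t ↦ t² x + (1 - t²) q x`. -/
noncomputable def pathMap (q : Euc d →ᵃ[ℝ] Euc d) (t : ℝ) : Euc d →ᵃ[ℝ] Euc d :=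
  t ^ 2 • AffineMap.id ℝ (Euc d) + (1 - t ^ 2) • q

lemma pathMap_apply (q : Euc d →ᵃ[ℝ] Euc d) (t : ℝ) (x : Euc d) :
    pathMap q t x = t ^ 2 • x + (1 - t ^ 2) • q x := rfl

/-- Parametrizing by t² gives the path velocity a factor 2t, hence the weight 4t² after squaring. It
compensates the Jacobian of a collapse onto a hyperplane, which degenerates exactly like t². -/
lemma sq_sub_comp_le {w : Euc d → ℝ} (hw : ContDiff ℝ 1 w) (q : Euc d →ᵃ[ℝ] Euc d) (x : Euc d)
    {D : ℝ} (hD : ‖q x - x‖ ≤ D) :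
    (w x - w (q x)) ^ 2 ≤
      D ^ 2 * ∫ t in (0 : ℝ)..1, 4 * t ^ 2 * ‖fderiv ℝ w (pathMap q t x)‖ ^ 2 := by
  have hpath : ∀ t : ℝ, pathMap q t x = q x + t ^ 2 • (x - q x) := fun t => by
    rw [pathMap_apply]; module
  have hc : Continuous (fderiv ℝ w) := hw.continuous_fderiv one_ne_zero
  have hder : ∀ t : ℝ, HasDerivAt (fun t : ℝ => w (q x + t ^ 2 • (x - q x)))
      (fderiv ℝ w (q x + t ^ 2 • (x - q x)) ((2 * t) • (x - q x))) t := by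
    intro t
    have h1 : HasDerivAt (fun t : ℝ => q x + t ^ 2 • (x - q x)) ((2 * t) • (x - q x)) t := by
      have := ((hasDerivAt_pow 2 t).smul_const (x - q x)).const_add (q x)
      simpa using this
    exact ((hw.differentiable one_ne_zero _).hasFDerivAt.comp_hasDerivAt t h1)
  have hint : w x - w (q x) = ∫ t in (0 : ℝ)..1,
      fderiv ℝ w (q x + t ^ 2 • (x - q x)) ((2 * t) • (x - q x)) := by
    rw [intervalIntegral.integral_eq_sub_of_hasDerivAt (fun t _ => hder t)]
    · simp
    · exact Continuous.intervalIntegrable (by fun_prop) _ _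
  rw [hint, ← intervalIntegral.integral_const_mul]
  refine (sq_intervalIntegral_le (by fun_prop)).trans ?_
  refine intervalIntegral.integral_mono_on (by norm_num)
    (Continuous.intervalIntegrable (by fun_prop) _ _) ?_ fun t ht => ?_
  · simp_rw [hpath]
    exact Continuous.intervalIntegrable (by fun_prop) _ _
  · rw [hpath, ← sq_abs, ← Real.norm_eq_abs]
    have hle : ‖fderiv ℝ w (q x + t ^ 2 • (x - q x)) ((2 * t) • (x - q x))‖
        ≤ ‖fderiv ℝ w (q x + t ^ 2 • (x - q x))‖ * (2 * t * D) := by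
      refine (ContinuousLinearMap.le_opNorm _ _).trans ?_
      refine mul_le_mul_of_nonneg_left ?_ (norm_nonneg _)
      rw [norm_smul, norm_sub_rev, Real.norm_eq_abs, abs_of_nonneg (by linarith [ht.1])]
      exact mul_le_mul_of_nonneg_left hD (by linarith [ht.1])
    refine (pow_le_pow_left₀ (norm_nonneg _) hle 2).trans (le_of_eq (by ring))

/-- A Poincaré type inequality along an affine retraction `q` of a convex set. -/
lemma setIntegral_sq_sub_comp_le {w : Euc d → ℝ} (hw : ContDiff ℝ 1 w) {K : Set (Euc d)}
    (hK : IsCompact K) (hKc : Convex ℝ K) (q : Euc d →ᵃ[ℝ] Euc d) (hq : MapsTo q K K) {D c : ℝ}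
    (hD : ∀ x ∈ K, ‖q x - x‖ ≤ D) (hc : 0 < c)
    (hdet : ∀ t ∈ Icc (0 : ℝ) 1, c * t ^ 2 ≤ |LinearMap.det (pathMap q t).linear|) :
    ∫ x in K, (w x - w (q x)) ^ 2 ≤ 4 / c * D ^ 2 * ∫ x in K, ‖fderiv ℝ w x‖ ^ 2 := by
  have hfd : Continuous (fderiv ℝ w) := hw.continuous_fderiv one_ne_zero
  have hqc : Continuous q := q.continuous_of_finiteDimensional
  have hwc : Continuous w := hw.continuous
  have hjoint : Continuous fun p : Euc d × ℝ =>
      4 * p.2 ^ 2 * ‖fderiv ℝ w (pathMap q p.2 p.1)‖ ^ 2 := by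
    simp_rw [pathMap_apply]
    fun_prop
  set E := ∫ x in K, ‖fderiv ℝ w x‖ ^ 2 with hE
  have hswap : ∫ x in K, ∫ t in (0 : ℝ)..1, 4 * t ^ 2 * ‖fderiv ℝ w (pathMap q t x)‖ ^ 2 =
      ∫ t in (0 : ℝ)..1, ∫ x in K, 4 * t ^ 2 * ‖fderiv ℝ w (pathMap q t x)‖ ^ 2 := by
    simp_rw [intervalIntegral.integral_of_le (zero_le_one' ℝ)]
    refine integral_integral_swap ?_
    rw [Measure.prod_restrict]
    refine (hjoint.continuousOn.integrableOn_compact (hK.prod isCompact_Icc)).mono_set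
      (prod_mono_right Ioc_subset_Icc_self)
  have hinner : Continuous fun x : Euc d =>
      ∫ t in (0 : ℝ)..1, 4 * t ^ 2 * ‖fderiv ℝ w (pathMap q t x)‖ ^ 2 :=
    intervalIntegral.continuous_parametric_intervalIntegral_of_continuous' hjoint 0 1
  calc ∫ x in K, (w x - w (q x)) ^ 2
      ≤ ∫ x in K, D ^ 2 * ∫ t in (0 : ℝ)..1, 4 * t ^ 2 * ‖fderiv ℝ w (pathMap q t x)‖ ^ 2 := by
        refine setIntegral_mono_on ?_ ?_ hK.measurableSet fun x hx => sq_sub_comp_le hw q x (hD x hx)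
        · exact integrableOn_of_continuous (by fun_prop) hK
        · exact (hinner.const_mul _).continuousOn.integrableOn_compact hK
    _ = D ^ 2 * ∫ t in (0 : ℝ)..1, ∫ x in K, 4 * t ^ 2 * ‖fderiv ℝ w (pathMap q t x)‖ ^ 2 := by
        rw [integral_const_mul, hswap]
    _ ≤ D ^ 2 * ∫ t in (0 : ℝ)..1, 4 / c * E := by
        refine mul_le_mul_of_nonneg_left ?_ (sq_nonneg _)
        refine intervalIntegral.integral_mono_on (by norm_num) ?_ (by simp) fun t ht => ?_
        · refine Continuous.intervalIntegrable ?_ _ _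
          exact continuous_parametric_integral_of_continuous (by
            exact hjoint.comp continuous_swap) hK
        · rw [integral_const_mul]
          have h1 := det_mul_setIntegral_comp_le hK (pathMap q t) (fun x hx => by
            rw [pathMap_apply]
            exact hKc hx (hq hx) (sq_nonneg t) (by nlinarith [ht.1, ht.2]) (by ring))
            (g := fun x => ‖fderiv ℝ w x‖ ^ 2) (by fun_prop) (fun x => sq_nonneg _)
          -- The Jacobian bound `c * t ^ 2` cancels the weight `4 * t ^ 2`, so the inner integral is
          -- bounded uniformly in `t`.
          have h2 : c * t ^ 2 * ∫ x in K, ‖fderiv ℝ w (pathMap q t x)‖ ^ 2 ≤ E :=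
            (mul_le_mul_of_nonneg_right (hdet t ht) (integral_nonneg fun x => sq_nonneg _)).trans h1
          rw [div_mul_eq_mul_div, le_div_iff₀ hc]
          nlinarith
    _ = 4 / c * D ^ 2 * E := by simp; ring

/-- The Poincaré inequality on a convex set. -/
lemma exists_setIntegral_sq_sub_const_le {w : Euc d → ℝ} (hw : ContDiff ℝ 1 w) {K : Set (Euc d)}
    (hK : IsCompact K) (hKc : Convex ℝ K) (hvol : volume K ≠ 0) {D : ℝ}
    (hD : ∀ x ∈ K, ∀ y ∈ K, ‖x - y‖ ≤ D) :
    ∃ c : ℝ, ∫ x in K, (w x - c) ^ 2 ≤ 4 * 2 ^ d * D ^ 2 * ∫ x in K, ‖fderiv ℝ w x‖ ^ 2 := by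
  have hwc : Continuous w := hw.continuous
  set E := ∫ x in K, ‖fderiv ℝ w x‖ ^ 2 with hE
  set m : Euc d → Euc d → Euc d := fun y x => (2⁻¹ : ℝ) • x + (2⁻¹ : ℝ) • y with hm
  have hfin : volume K ≠ ⊤ := hK.measure_lt_top.ne
  -- The contraction towards `y` stops at the midpoint: all maps on the way have determinant at
  -- least 2⁻ᵈ, while a full contraction would degenerate like t²ᵈ.
  have hhalf : ∀ y ∈ K, ∫ x in K, (w x - w (m y x)) ^ 2 ≤ 2 ^ d * D ^ 2 * E := by
    intro y hy
    set q : Euc d →ᵃ[ℝ] Euc d :=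
      (2⁻¹ : ℝ) • AffineMap.id ℝ (Euc d) + AffineMap.const ℝ _ ((2⁻¹ : ℝ) • y) with hq
    have hqa : ∀ x, q x = m y x := fun x => rfl
    have h := setIntegral_sq_sub_comp_le hw hK hKc q (D := D / 2) (c := (2⁻¹ : ℝ) ^ d)
      (fun x hx => by
        rw [hqa]; exact hKc hx hy (by norm_num) (by norm_num) (by norm_num))
      (fun x hx => by
        have : q x - x = (2⁻¹ : ℝ) • (y - x) := by rw [hqa, hm]; module
        rw [this, norm_smul]
        have := hD y hy x hx
        norm_num
        linarith) (by positivity) (fun t ht => by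
        have : (pathMap q t).linear = (t ^ 2 + (1 - t ^ 2) * 2⁻¹) • LinearMap.id := by
          ext1 x
          simp [pathMap, hq]
          module
        rw [this, LinearMap.det_smul, LinearMap.det_id, mul_one, abs_pow]
        have hfr : Module.finrank ℝ (Euc d) = d := by simp
        rw [hfr]
        have h2 : (2⁻¹ : ℝ) ^ d ≤ |t ^ 2 + (1 - t ^ 2) * 2⁻¹| ^ d := by
          refine pow_le_pow_left₀ (by norm_num) (le_trans ?_ (le_abs_self _)) d
          nlinarith [sq_nonneg t]
        have h3 : t ^ 2 ≤ 1 := by nlinarith [ht.1, ht.2]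
        have h4 : (0 : ℝ) < 2⁻¹ ^ d := by positivity
        nlinarith)
    simp_rw [hqa] at h
    refine h.trans (le_of_eq ?_)
    rw [inv_pow, div_inv_eq_mul]
    ring
  set F : Euc d → ℝ := fun y => ∫ x in K, (w x - w y) ^ 2 with hF
  have hFc : Continuous F :=
    continuous_parametric_integral_of_continuous (by fun_prop) hK
  -- The constant is a value `w y` whose deviation does not exceed the average over `y ∈ K`. The
  -- average is estimated by comparing `w x` and `w y` through the midpoint.
  obtain ⟨y, hy, hle⟩ := exists_le_setAverage hvol hfin (hFc.continuousOn.integrableOn_compact hK)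
  refine ⟨w y, hle.trans ?_⟩
  have hpos : 0 < volume.real K := ENNReal.toReal_pos hvol hfin
  rw [setAverage_eq, smul_eq_mul, inv_mul_le_iff₀ hpos]
  set A : ℝ := ∫ y in K, ∫ x in K, (w x - w (m y x)) ^ 2 with hA
  have hAle : A ≤ volume.real K * (2 ^ d * D ^ 2 * E) := by
    have hA1 : A ≤ ∫ y in K, 2 ^ d * D ^ 2 * E := by
      refine setIntegral_mono_on ?_ (integrableOn_of_continuous continuous_const hK) hK.measurableSet hhalf
      refine integrableOn_of_continuous ?_ hK
      exact continuous_parametric_integral_of_continuous (by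
        simp only [hm]; fun_prop) hK
    simpa using hA1
  -- The midpoint is symmetric in its two arguments, so Fubini exchanges the two halves.
  have hA' : ∫ y in K, ∫ x in K, (w y - w (m y x)) ^ 2 = A := by
    rw [integral_integral_swap, hA]
    · simp only [hm]
      refine integral_congr_ae (Eventually.of_forall fun x => integral_congr_ae
        (Eventually.of_forall fun y => ?_))
      simp only [add_comm]
    · rw [Measure.prod_restrict]
      refine ContinuousOn.integrableOn_compact (hK.prod hK) (Continuous.continuousOn ?_)
      simp only [hm, Function.uncurry_def]
      fun_prop
  have hpt : ∀ y, F y ≤ 2 * (∫ x in K, (w x - w (m y x)) ^ 2) +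
      2 * ∫ x in K, (w y - w (m y x)) ^ 2 := by
    intro y
    rw [← integral_const_mul, ← integral_const_mul, ← integral_add]
    · refine setIntegral_mono_on ?_ ?_ hK.measurableSet fun x _ => ?_
      · exact integrableOn_of_continuous (by fun_prop) hK
      · refine integrableOn_of_continuous ?_ hK
        simp only [hm]; fun_prop
      · nlinarith [sq_nonneg ((w x - w (m y x)) + (w y - w (m y x)))]
    all_goals
      refine integrableOn_of_continuous ?_ hK
      simp only [hm]; fun_prop
  have hcont1 : Continuous fun y => ∫ x in K, (w x - w (m y x)) ^ 2 :=
    continuous_parametric_integral_of_continuous (by simp only [hm]; fun_prop) hK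
  have hcont2 : Continuous fun y => ∫ x in K, (w y - w (m y x)) ^ 2 :=
    continuous_parametric_integral_of_continuous (by simp only [hm]; fun_prop) hK
  have : ∫ y in K, F y ≤ 4 * A := by
    calc ∫ y in K, F y ≤ ∫ y in K, (2 * (∫ x in K, (w x - w (m y x)) ^ 2) +
          2 * ∫ x in K, (w y - w (m y x)) ^ 2) := by
          refine setIntegral_mono_on (hFc.continuousOn.integrableOn_compact hK) ?_
            hK.measurableSet fun y _ => hpt y
          exact integrableOn_of_continuous (by fun_prop) hK
      _ = 2 * A + 2 * A := by
          rw [integral_add, integral_const_mul, integral_const_mul, hA']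
          all_goals exact integrableOn_of_continuous (by fun_prop) hK
      _ = 4 * A := by ring
  refine this.trans ?_
  nlinarith

end Homotopy

/-! ### Collapsing a simplex onto a facet and comparing neighbouring simplices. -/

section Collapse

variable {d : ℕ} {K K' : Finset (Euc d)}

lemma isCompact_body (K : Finset (Euc d)) : IsCompact (body K) := isCompact_convexHull_finset K

lemma convex_body (K : Finset (Euc d)) : Convex ℝ (body K) := convex_convexHull ℝ _

lemma measurableSet_body (K : Finset (Euc d)) : MeasurableSet (body K) :=
  (isCompact_body K).measurableSet

lemma norm_sub_le_elementDiam {x y : Euc d} (hx : x ∈ body K) (hy : y ∈ body K) :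
    ‖x - y‖ ≤ elementDiam K := by
  rw [← dist_eq_norm]
  exact Metric.dist_le_diam_of_mem (isCompact_body K).isBounded hx hy

lemma volume_real_body_pos (h : IsSimplex K) : 0 < volume.real (body K) := by
  refine ENNReal.toReal_pos ?_ (isCompact_body K).measure_lt_top.ne
  exact (Measure.measure_pos_of_nonempty_interior volume h.interior_nonempty).ne'

/-- The affine map `x ↦ x + λ_a(x) v`. -/
noncomputable def shear (K : Finset (Euc d)) (a v : Euc d) : Euc d →ᵃ[ℝ] Euc d :=
  AffineMap.id ℝ (Euc d) + (LinearMap.toSpanSingleton ℝ (Euc d) v).toAffineMap.comp (bary K a)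

lemma shear_apply (a v x : Euc d) : shear K a v x = x + bary K a x • v := by
  simp [shear]

lemma shear_vertex (h : IsSimplex K) {a v x : Euc d} (ha : a ∈ K) (hx : x ∈ K) (hxa : a ≠ x) :
    shear K a v x = x := by
  rw [shear_apply, bary_ne h ha hx hxa, zero_smul, add_zero]

lemma shear_self (h : IsSimplex K) {a v : Euc d} (ha : a ∈ K) : shear K a v a = a + v := by
  rw [shear_apply, bary_self h ha, one_smul]

lemma collapse_mapsTo_face (h : IsSimplex K) {a z : Euc d} (ha : a ∈ K) (hz : z ∈ K)
    (haz : a ≠ z) : MapsTo (shear K a (z - a)) (body K)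
      (convexHull ℝ ((K : Set (Euc d)) \ {a})) := by
  suffices hs : (K : Set (Euc d)) ⊆ shear K a (z - a) ⁻¹' convexHull ℝ ((K : Set (Euc d)) \ {a}) from
    convexHull_min hs ((convex_convexHull ℝ _).affine_preimage _)
  intro x hx
  by_cases hxa : a = x
  · subst hxa
    rw [mem_preimage, shear_self h ha]
    refine subset_convexHull ℝ _ ⟨by simpa using hz, by simpa using haz.symm⟩
  · rw [mem_preimage, shear_vertex h ha hx hxa]
    exact subset_convexHull ℝ _ ⟨hx, by simpa using Ne.symm hxa⟩

lemma bary_linear_sub (h : IsSimplex K) {a z : Euc d} (ha : a ∈ K) (hz : z ∈ K)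
    (haz : a ≠ z) : (bary K a).linear (z - a) = -1 := by
  have := (bary K a).linearMap_vsub z a
  rw [vsub_eq_sub, vsub_eq_sub, bary_self h ha, bary_ne h ha hz haz] at this
  simpa using this

/-- Moving the vertex `a` onto `z` retracts the simplex onto the facet opposite `a`. The
intermediate maps have as linear parts transvections of determinant 1 - (1 - t²) = t², so `c = 1` is
admissible. -/
lemma setIntegral_sq_sub_collapse_le {w : Euc d → ℝ} (hw : ContDiff ℝ 1 w) (h : IsSimplex K)
    {a z : Euc d} (ha : a ∈ K) (hz : z ∈ K) (haz : a ≠ z) :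
    ∫ x in body K, (w x - w (shear K a (z - a) x)) ^ 2 ≤
      4 * elementDiam K ^ 2 * ∫ x in body K, ‖fderiv ℝ w x‖ ^ 2 := by
  have hmaps : MapsTo (shear K a (z - a)) (body K) (body K) :=
    (collapse_mapsTo_face h ha hz haz).mono_right (convexHull_mono sdiff_subset)
  have := setIntegral_sq_sub_comp_le hw (isCompact_body K) (convex_body K) (shear K a (z - a)) hmaps
    (D := elementDiam K) (c := 1) (fun x hx => norm_sub_le_elementDiam (hmaps hx) hx) one_pos
    (fun t _ => by
      have hl : (pathMap (shear K a (z - a)) t).linear =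
          LinearMap.transvection ((1 - t ^ 2) • (bary K a).linear) (z - a) := by
        ext1 x
        simp [pathMap, shear, LinearMap.transvection.apply]
        module
      rw [hl, LinearMap.transvection.det, LinearMap.smul_apply, bary_linear_sub h ha hz haz]
      refine le_trans (le_of_eq ?_) (le_abs_self _)
      simp)
  simpa using this

/-- Friedrichs inequality on a simplex for functions that vanish on a facet. -/
lemma setIntegral_sq_le_of_facet {w : Euc d → ℝ} (hw : ContDiff ℝ 1 w) (h : IsSimplex K)
    {a z : Euc d} (ha : a ∈ K) (hz : z ∈ K) (haz : a ≠ z)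
    (h0 : ∀ x ∈ convexHull ℝ ((K : Set (Euc d)) \ {a}), w x = 0) :
    ∫ x in body K, w x ^ 2 ≤ 4 * elementDiam K ^ 2 * ∫ x in body K, ‖fderiv ℝ w x‖ ^ 2 := by
  refine le_of_eq_of_le ?_ (setIntegral_sq_sub_collapse_le hw h ha hz haz)
  refine setIntegral_congr_fun (measurableSet_body K) fun x hx => ?_
  simp only [h0 _ (collapse_mapsTo_face h ha hz haz hx), sub_zero]

lemma shear_image_body (h : IsSimplex K) {a a' : Euc d} (ha : a ∈ K) (ha' : a' ∈ K')
    (herase : K.erase a = K'.erase a') :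
    shear K a (a' - a) '' body K = body K' := by
  classical
  rw [body, AffineMap.image_convexHull, body]
  congr 1
  ext y
  constructor
  · rintro ⟨x, hx, rfl⟩
    by_cases hxa : a = x
    · subst hxa
      rw [shear_self h ha]
      simpa using ha'
    · rw [shear_vertex h ha hx hxa]
      have : x ∈ K.erase a := Finset.mem_erase.2 ⟨Ne.symm hxa, hx⟩
      rw [herase] at this
      exact Finset.mem_of_mem_erase this
  · intro hy
    by_cases hya : y = a'
    · subst hya
      exact ⟨a, ha, by rw [shear_self h ha]; simp⟩
    · have : y ∈ K'.erase a' := Finset.mem_erase.2 ⟨hya, hy⟩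
      rw [← herase] at this
      have hya' := Finset.ne_of_mem_erase this
      have hyK := Finset.mem_of_mem_erase this
      exact ⟨y, hyK, shear_vertex h ha hyK hya'.symm⟩

lemma setIntegral_shear (h : IsSimplex K) (h' : IsSimplex K') {a a' : Euc d} (ha : a ∈ K)
    (ha' : a' ∈ K') (herase : K.erase a = K'.erase a') (g : Euc d → ℝ) :
    ∫ x in body K, g (shear K a (a' - a) x) =
      volume.real (body K) / volume.real (body K') * ∫ x in body K', g x := by
  set T := shear K a (a' - a)
  have himg : T '' body K = body K' := shear_image_body h ha ha' herase
  have hp := volume_real_body_pos h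
  have hp' := volume_real_body_pos h'
  have hdet : LinearMap.det T.linear ≠ 0 := by
    intro h0
    have : volume (T '' body K) = 0 := by
      have hT : (T : Euc d → Euc d) = (fun y => y + T 0) ∘ T.linear := by
        funext x; exact congrFun T.decomp x
      rw [hT, image_comp, image_add_right, measure_preimage_add_right,
        Measure.addHaar_image_linearMap, h0]
      simp
    rw [himg] at this
    rw [measureReal_def, this] at hp'
    simp at hp'
  -- The constant function 1 identifies the Jacobian as a ratio of volumes.
  have h1 := det_mul_setIntegral_comp_eq (measurableSet_body K) T hdet (fun _ => 1)
  have h2 := det_mul_setIntegral_comp_eq (measurableSet_body K) T hdet g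
  rw [himg] at h1 h2
  simp only [setIntegral_const, smul_eq_mul, mul_one] at h1
  rw [← h1, ← h2]
  have : 0 < |LinearMap.det T.linear| := abs_pos.2 hdet
  field_simp

/-- Comparison of the `L²` deviations from a constant on two simplices with a common facet. -/
lemma setIntegral_sq_sub_const_le_of_adjacent {w : Euc d → ℝ} (hw : ContDiff ℝ 1 w)
    (h : IsSimplex K) (h' : IsSimplex K') {a a' z : Euc d} (ha : a ∈ K) (ha' : a' ∈ K')
    (haK' : a ∉ K') (ha'K : a' ∉ K) (herase : K.erase a = K'.erase a') (hz : z ∈ K)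
    (hz' : z ∈ K') (c : ℝ) :
    ∫ x in body K, (w x - c) ^ 2 ≤
      2 * (volume.real (body K) / volume.real (body K')) * (∫ x in body K', (w x - c) ^ 2) +
      16 * elementDiam K ^ 2 * (∫ x in body K, ‖fderiv ℝ w x‖ ^ 2) +
      16 * (volume.real (body K) / volume.real (body K')) * elementDiam K' ^ 2 *
        ∫ x in body K', ‖fderiv ℝ w x‖ ^ 2 := by
  have haz : a ≠ z := by rintro rfl; exact haK' hz'
  have haz' : a' ≠ z := by rintro rfl; exact ha'K hz
  have hwc := hw.continuous
  set T := shear K a (a' - a) with hT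
  set p := shear K a (z - a) with hp
  set p' := shear K' a' (z - a') with hp'
  have hTc : Continuous T := T.continuous_of_finiteDimensional
  have hpc : Continuous p := p.continuous_of_finiteDimensional
  have hp'c : Continuous p' := p'.continuous_of_finiteDimensional
  have hcoord : ∀ x, bary K' a' (T x) = bary K a x := by
    intro x
    have : (bary K' a').comp T = bary K a := by
      refine affineMap_ext_simplex h fun v hv => ?_
      rw [AffineMap.comp_apply]
      by_cases hva : a = v
      · subst hva
        rw [hT, shear_self h ha, bary_self h ha]
        simpa using bary_self h' ha'
      · rw [hT, shear_vertex h ha hv hva, bary_ne h ha hv hva]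
        have hv' : v ∈ K'.erase a' := herase ▸ Finset.mem_erase.2 ⟨Ne.symm hva, hv⟩
        exact bary_ne h' ha' (Finset.mem_of_mem_erase hv') (Finset.ne_of_mem_erase hv').symm
    rw [← this]; rfl
  -- `T` carries `K` to `K'` fixing the common facet, and both collapses send the free vertex to the
  -- same `z`. Hence `x` and `T x` collapse to one point of that facet.
  have hpp : ∀ x, p' (T x) = p x := by
    intro x
    rw [hp', shear_apply, hcoord, hT, shear_apply, hp, shear_apply]
    module
  have e1 := setIntegral_sq_sub_collapse_le hw h ha hz haz
  have e2 := setIntegral_sq_sub_collapse_le hw h' ha' hz' haz'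
  have t1 := setIntegral_shear h h' ha ha' herase (fun y => (w y - c) ^ 2)
  have t2 := setIntegral_shear h h' ha ha' herase (fun y => (w y - w (p' y)) ^ 2)
  rw [← hT] at t1 t2
  rw [← hp] at e1
  rw [← hp'] at e2
  have hK := isCompact_body K
  -- Split w x - c = (w x - w (p x)) - (w (T x) - w (p' (T x))) + (w (T x) - c).
  have hmain : ∫ x in body K, (w x - c) ^ 2 ≤ 2 * (∫ x in body K, (w (T x) - c) ^ 2) +
      4 * (∫ x in body K, (w x - w (p x)) ^ 2) +
      4 * ∫ x in body K, (w (T x) - w (p' (T x))) ^ 2 := by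
    rw [← integral_const_mul, ← integral_const_mul, ← integral_const_mul, ← integral_add,
      ← integral_add]
    · refine setIntegral_mono_on ?_ ?_ hK.measurableSet fun x _ => ?_
      · exact integrableOn_of_continuous (by fun_prop) hK
      · exact integrableOn_of_continuous (by fun_prop) hK
      · rw [hpp]
        nlinarith [sq_nonneg ((w x - w (p x)) + (w (T x) - w (p x))),
          sq_nonneg ((w x - w (T x)) - (w (T x) - c))]
    all_goals exact integrableOn_of_continuous (by fun_prop) hK
  rw [t1, t2] at hmain
  have hr : 0 ≤ volume.real (body K) / volume.real (body K') := by positivity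
  have e3 := mul_le_mul_of_nonneg_left e2 hr
  nlinarith

end Collapse

/-! ### Consequences of shape regularity. -/

section ShapeRegularity

variable {d : ℕ} {K K' : Finset (Euc d)}

lemma elementDiam_nonneg (K : Finset (Euc d)) : 0 ≤ elementDiam K := Metric.diam_nonneg

lemma inscribedDiam_nonneg (K : Finset (Euc d)) : 0 ≤ inscribedDiam K := by
  refine Real.sSup_nonneg ?_
  rintro t ⟨x, r, hr, rfl, -⟩
  positivity

lemma Triangulation.IsRegular.mono {Ω : Set (Euc d)} {T : Triangulation Ω} {κ κ' : ℝ}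
    (h : T.IsRegular κ) (hκ : κ ≤ κ') : T.IsRegular κ' := fun K hK =>
  (h K hK).trans (mul_le_mul_of_nonneg_right hκ (inscribedDiam_nonneg K))

lemma IsSimplex.elementDiam_pos (h : IsSimplex K) (hd : 1 ≤ d) : 0 < elementDiam K := by
  obtain ⟨a, ha, b, hb, hab⟩ := Finset.one_lt_card.1 (by rw [h.2]; omega : 1 < K.card)
  refine lt_of_lt_of_le (norm_pos_iff.2 (sub_ne_zero.2 hab)) (norm_sub_le_elementDiam ?_ ?_)
  · exact subset_convexHull ℝ _ ha
  · exact subset_convexHull ℝ _ hb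

/-- `closedBall x r` witnesses that the simplex `K` is shape regular with constant `c`. -/
def IsInball (c : ℝ) (K : Finset (Euc d)) (x : Euc d) (r : ℝ) : Prop :=
  0 < r ∧ Metric.closedBall x r ⊆ body K ∧ elementDiam K ≤ c * r

/-- Some inscribed ball has diameter 2r above half the supremum, which costs a factor 2 but avoids
showing that the supremum is attained. -/
lemma exists_isInball (h : IsSimplex K) (hd : 1 ≤ d) {κ : ℝ} (hκ : 0 < κ)
    (hK : elementDiam K ≤ κ * inscribedDiam K) : ∃ x r, IsInball (4 * κ) K x r := by
  have h0 := h.elementDiam_pos hd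
  have hi : 0 < inscribedDiam K := by
    by_contra hn
    nlinarith
  obtain ⟨v, hv⟩ := h.nonempty
  obtain ⟨t, ⟨x, r, hr, rfl, hb⟩, ht⟩ := exists_lt_of_lt_csSup
    (s := {t : ℝ | ∃ (x : Euc d) (r : ℝ), 0 ≤ r ∧ t = 2 * r ∧ Metric.closedBall x r ⊆ body K})
    ⟨0, v, 0, le_rfl, by simp, by
      simpa using subset_convexHull ℝ (K : Set (Euc d)) hv⟩ (half_lt_self hi)
  refine ⟨x, r, by nlinarith [show inscribedDiam K / 2 < 2 * r from ht], hb, ?_⟩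
  have : inscribedDiam K / 2 < 2 * r := ht
  nlinarith

/-- Compare the values of `a` at the two ends of the diameter of the ball in direction `v`. -/
lemma abs_linear_mul_le_of_closedBall {a : Euc d →ᵃ[ℝ] ℝ} {S : Set (Euc d)} {x : Euc d} {r m M : ℝ}
    (hr : 0 < r) (hb : Metric.closedBall x r ⊆ S) (ha : ∀ y ∈ S, a y ∈ Icc m M) (v : Euc d) :
    |a.linear v| * (2 * r) ≤ (M - m) * ‖v‖ := by
  rcases eq_or_ne v 0 with rfl | hv
  · simp
  have hv' : 0 < ‖v‖ := norm_pos_iff.2 hv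
  have hmem : ∀ s : ℝ, |s| = r → x + (s / ‖v‖) • v ∈ S := fun s hs => hb (by
    rw [mem_closedBall_iff_norm, add_sub_cancel_left, norm_smul, Real.norm_eq_abs, abs_div,
      abs_norm, div_mul_cancel₀ _ hv'.ne', hs])
  have h1 := ha _ (hmem r (abs_of_pos hr))
  have h2 := ha _ (hmem (-r) (by rw [abs_neg, abs_of_pos hr]))
  have e : ∀ s : ℝ, a (x + (s / ‖v‖) • v) = a x + s / ‖v‖ * a.linear v := fun s => by
    have := a.map_vadd x ((s / ‖v‖) • v)
    rw [vadd_eq_add, vadd_eq_add, map_smul, smul_eq_mul] at this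
    rw [add_comm x, this, add_comm]
  rw [e] at h1 h2
  have h3 : |(2 * r) / ‖v‖ * a.linear v| ≤ M - m := by
    have : (2 * r) / ‖v‖ * a.linear v = (a x + r / ‖v‖ * a.linear v) -
        (a x + -r / ‖v‖ * a.linear v) := by ring
    rw [this, abs_le]
    constructor <;> linarith [h1.1, h1.2, h2.1, h2.2]
  rw [abs_mul, abs_of_pos (by positivity : 0 < 2 * r / ‖v‖)] at h3
  calc |a.linear v| * (2 * r) = (2 * r / ‖v‖ * |a.linear v|) * ‖v‖ := by field_simp
    _ ≤ (M - m) * ‖v‖ := mul_le_mul_of_nonneg_right h3 hv'.le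

/-- A barycentric coordinate has slope at most 1/(2r), yet changes by 1 along the edge. -/
lemma IsInball.two_mul_le_norm_sub (h : IsSimplex K) {c : ℝ} {x : Euc d} {r : ℝ}
    (hb : IsInball c K x r) {z z' : Euc d} (hz : z ∈ K) (hz' : z' ∈ K) (hne : z ≠ z') :
    2 * r ≤ ‖z - z'‖ := by
  have h1 := abs_linear_mul_le_of_closedBall hb.1 hb.2.1
    (fun y hy => bary_mem_Icc h hy hz) (z' - z)
  rw [bary_linear_sub h hz hz' hne] at h1
  rw [norm_sub_rev]
  simpa using h1

/-- A common edge is at least 2r long and at most `elementDiam K'`, so elements sharing an edge have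
comparable size. -/
lemma IsInball.elementDiam_le (h : IsSimplex K) {c : ℝ} (hc : 0 ≤ c) {x : Euc d} {r : ℝ}
    (hb : IsInball c K x r) {z z' : Euc d} (hz : z ∈ K) (hz' : z' ∈ K) (hne : z ≠ z')
    (hzK' : z ∈ K') (hz'K' : z' ∈ K') : elementDiam K ≤ c / 2 * elementDiam K' := by
  have h1 := hb.two_mul_le_norm_sub h hz hz' hne
  have h2 : ‖z - z'‖ ≤ elementDiam K' :=
    norm_sub_le_elementDiam (subset_convexHull ℝ _ hzK') (subset_convexHull ℝ _ hz'K')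
  have h3 := hb.2.2
  nlinarith

lemma volume_real_closedBall (x : Euc d) {r : ℝ} (hr : 0 ≤ r) :
    volume.real (Metric.closedBall x r) = r ^ d * volume.real (Metric.ball (0 : Euc d) 1) := by
  rw [measureReal_def, Measure.addHaar_closedBall _ _ hr, ENNReal.toReal_mul,
    ENNReal.toReal_ofReal (by positivity)]
  simp [measureReal_def]

lemma volume_real_unitBall_pos : 0 < volume.real (Metric.ball (0 : Euc d) 1) :=
  ENNReal.toReal_pos (Metric.measure_ball_pos volume _ one_pos).ne' measure_ball_lt_top.ne

lemma IsInball.le_volume_real {c : ℝ} {x : Euc d} {r : ℝ} (hb : IsInball c K x r) :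
    r ^ d * volume.real (Metric.ball (0 : Euc d) 1) ≤ volume.real (body K) := by
  rw [← volume_real_closedBall x hb.1.le]
  exact measureReal_mono hb.2.1 (isCompact_body K).measure_lt_top.ne

lemma volume_real_body_le (h : IsSimplex K) :
    volume.real (body K) ≤ elementDiam K ^ d * volume.real (Metric.ball (0 : Euc d) 1) := by
  obtain ⟨z, hz⟩ := h.nonempty
  rw [← volume_real_closedBall z (elementDiam_nonneg K)]
  refine measureReal_mono (fun y hy => ?_) measure_closedBall_lt_top.ne
  rw [mem_closedBall_iff_norm]
  exact norm_sub_le_elementDiam hy (subset_convexHull ℝ _ hz)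

lemma IsInball.volume_real_div_le (h : IsSimplex K) (h' : IsSimplex K') {c : ℝ} (hc : 0 ≤ c)
    {x : Euc d} {r : ℝ} (hb : IsInball c K' x r) {b : ℝ} (hb0 : 0 ≤ b)
    (hle : elementDiam K ≤ b * elementDiam K') :
    volume.real (body K) / volume.real (body K') ≤ (b * c) ^ d := by
  rw [div_le_iff₀ (volume_real_body_pos h')]
  have h1 := volume_real_body_le h
  have h2 := hb.le_volume_real
  have h3 : elementDiam K ≤ (b * c) * r := by
    have := mul_le_mul_of_nonneg_left hb.2.2 hb0
    linarith
  calc volume.real (body K) ≤ elementDiam K ^ d * volume.real (Metric.ball (0 : Euc d) 1) := h1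
    _ ≤ ((b * c) * r) ^ d * volume.real (Metric.ball (0 : Euc d) 1) := by
      gcongr
      exact elementDiam_nonneg K
    _ = (b * c) ^ d * (r ^ d * volume.real (Metric.ball (0 : Euc d) 1)) := by ring
    _ ≤ _ := by gcongr

/-- A shape regular simplex fills a fixed portion of small balls around its vertices. -/
lemma IsInball.le_volume_real_inter_ball (h : IsSimplex K) (hd : 1 ≤ d) {c : ℝ} (hc : 0 < c)
    {x : Euc d} {r : ℝ} (hb : IsInball c K x r) {z : Euc d} (hz : z ∈ K) {s : ℝ} (hs : 0 < s)
    (hsd : s ≤ elementDiam K) :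
    (s / c) ^ d * volume.real (Metric.ball (0 : Euc d) 1) ≤
      volume.real (body K ∩ Metric.closedBall z s) := by
  have h0 := h.elementDiam_pos hd
  set t := s / elementDiam K with ht
  have ht0 : 0 < t := by positivity
  have ht1 : t ≤ 1 := by rw [ht, div_le_one h0]; exact hsd
  have hzK : z ∈ body K := subset_convexHull ℝ _ hz
  -- The homothety with centre `z` and ratio `t` maps `body K` into itself and shrinks its diameter
  -- to `s`. The inscribed ball becomes one of radius `t * r ≥ s / c`.
  have hsub : Metric.closedBall (z + t • (x - z)) (t * r) ⊆ body K ∩ Metric.closedBall z s := by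
    intro y hy
    set y' := z + t⁻¹ • (y - z) with hy'
    have hyy : y = z + t • (y' - z) := by
      rw [hy', add_sub_cancel_left, smul_smul, mul_inv_cancel₀ ht0.ne', one_smul]; abel
    have hy'K : y' ∈ body K := by
      refine hb.2.1 ?_
      rw [mem_closedBall_iff_norm] at hy ⊢
      have e : y - (z + t • (x - z)) = t • (y' - x) := by rw [hyy]; module
      rw [e, norm_smul, Real.norm_eq_abs, abs_of_pos ht0] at hy
      exact le_of_mul_le_mul_left hy ht0
    constructor
    · rw [hyy]
      have := convex_body K hzK hy'K (sub_nonneg.2 ht1) ht0.le (by ring)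
      convert this using 1
      module
    · rw [mem_closedBall_iff_norm, hyy, add_sub_cancel_left, norm_smul, Real.norm_eq_abs,
        abs_of_pos ht0]
      calc t * ‖y' - z‖ ≤ t * elementDiam K := by
            gcongr; exact norm_sub_le_elementDiam hy'K hzK
        _ = s := by rw [ht]; field_simp
  have h1 : volume.real (Metric.closedBall (z + t • (x - z)) (t * r)) ≤
      volume.real (body K ∩ Metric.closedBall z s) :=
    measureReal_mono hsub ((measure_mono inter_subset_left).trans_lt (isCompact_body K).measure_lt_top).ne
  rw [volume_real_closedBall _ (by have := hb.1; positivity)] at h1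
  refine le_trans ?_ h1
  gcongr
  rw [ht, div_le_iff₀ hc, div_mul_eq_mul_div, div_mul_eq_mul_div, le_div_iff₀ h0]
  have := mul_le_mul_of_nonneg_left hb.2.2 hs.le
  linarith

end ShapeRegularity

/-! ### Conformity of the triangulation and connectedness of vertex stars. -/

namespace Triangulation

variable {d : ℕ} {Ω : Set (Euc d)} (T : Triangulation Ω) {K K' s : Finset (Euc d)}

lemma mem_elements : K ∈ T.elements ↔ K ∈ T.faces ∧ K.card = d + 1 := by
  simp [elements]

variable {T}

lemma isSimplex (hK : K ∈ T.elements) : IsSimplex K :=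
  ⟨T.indep ((T.mem_elements).1 hK).1, ((T.mem_elements).1 hK).2⟩

lemma mem_faces (hK : K ∈ T.elements) : K ∈ T.faces := ((T.mem_elements).1 hK).1

lemma exists_element_superset (hs : s ∈ T.faces) : ∃ K ∈ T.elements, s ⊆ K := by
  obtain ⟨t, ht, hst, hc⟩ := T.pure s hs
  exact ⟨t, (T.mem_elements).2 ⟨ht, hc⟩, hst⟩

lemma mem_closure_iff {x : Euc d} : x ∈ closure Ω ↔ ∃ K ∈ T.elements, x ∈ body K := by
  rw [← T.covers]
  simp only [mem_iUnion, exists_prop]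
  constructor
  · rintro ⟨s, hs, hx⟩
    obtain ⟨K, hK, hsK⟩ := exists_element_superset hs
    exact ⟨K, hK, convexHull_mono (Finset.coe_subset.2 hsK) hx⟩
  · rintro ⟨K, hK, hx⟩
    exact ⟨K, mem_faces hK, hx⟩

lemma body_subset_closure (hK : K ∈ T.elements) : body K ⊆ closure Ω := fun _ hx =>
  (mem_closure_iff (T := T)).2 ⟨K, hK, hx⟩

lemma mem_inter {s t : Finset (Euc d)} [DecidableEq (Euc d)] (hs : s ∈ T.faces) (ht : t ∈ T.faces)
    {x : Euc d} (hxs : x ∈ body s) (hxt : x ∈ body t) : x ∈ body (s ∩ t) := by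
  rw [body, Finset.coe_inter]
  exact T.inter_subset_convexHull hs ht ⟨hxs, hxt⟩

lemma inter_mem_faces {s t : Finset (Euc d)} [DecidableEq (Euc d)] (hs : s ∈ T.faces)
    {x : Euc d} (hx : x ∈ body (s ∩ t)) : s ∩ t ∈ T.faces := by
  refine T.down_closed hs Finset.inter_subset_left ?_
  have : (body (s ∩ t)).Nonempty := ⟨x, hx⟩
  rw [body, convexHull_nonempty_iff] at this
  exact_mod_cast this

/-- By conformity `x` lies in the hull of the common vertices, so the coordinate of a vertex of `K`
missing from `s` would vanish at `x`. -/
lemma subset_of_mem_interior (hK : K ∈ T.elements) (hs : s ∈ T.faces) {x : Euc d}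
    (hx : x ∈ interior (body K)) (hxs : x ∈ body s) : K ⊆ s := by
  classical
  intro z hz
  by_contra hzs
  have h1 := T.inter_subset_convexHull (mem_faces hK) hs ⟨interior_subset hx, hxs⟩
  have h2 := bary_eq_zero_of_mem_convexHull (isSimplex hK) inter_subset_left hz
    (fun h => hzs h.2) h1
  have h3 := (mem_interior_body_iff (isSimplex hK)).1 hx z hz
  linarith

lemma eq_of_mem_interior (hK : K ∈ T.elements) (hK' : K' ∈ T.elements) {x : Euc d}
    (hx : x ∈ interior (body K)) (hxs : x ∈ body K') : K = K' :=
  Finset.eq_of_subset_of_card_le (subset_of_mem_interior hK (mem_faces hK') hx hxs)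
    (by rw [(isSimplex hK).2, (isSimplex hK').2])

lemma mem_of_mem_body_face {z : Euc d} (hz : {z} ∈ T.faces) (hs : s ∈ T.faces)
    (h : z ∈ body s) : z ∈ s := by
  classical
  have := mem_inter hz hs (by simp [body]) h
  by_contra hzs
  rw [Finset.singleton_inter_of_notMem hzs] at this
  simp [body] at this

lemma singleton_mem_faces {z : Euc d} (hs : s ∈ T.faces) (hz : z ∈ s) : {z} ∈ T.faces :=
  T.down_closed hs (by simpa using hz) (by simp)

/-- The covering condition only gives `closure Ω`. An interior point of `K` on the frontier would
lie in a face with `d` vertices, too few to include those of `K`. -/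
lemma interior_body_subset (hΩ : IsOpen Ω) (hK : K ∈ T.elements) : interior (body K) ⊆ Ω := by
  intro x hx
  by_contra hn
  have hf : x ∈ frontier Ω := by
    rw [hΩ.frontier_eq]
    exact ⟨body_subset_closure hK (interior_subset hx), hn⟩
  obtain ⟨s, hs, hc, hxs, -⟩ := T.boundary x hf
  have := Finset.card_le_card (subset_of_mem_interior hK hs hx hxs)
  rw [(isSimplex hK).2] at this
  omega

lemma isCompact_closure (T : Triangulation Ω) : IsCompact (closure Ω) := by
  rw [← T.covers]
  exact T.finite_faces.isCompact_biUnion fun s _ => isCompact_convexHull_finset s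

lemma volume_frontier (T : Triangulation Ω) : volume (frontier Ω) = 0 := by
  have hsub : frontier Ω ⊆ ⋃ s ∈ {s ∈ T.faces | s.card = d},
      (affineSpan ℝ (s : Set (Euc d)) : Set (Euc d)) := by
    intro x hx
    obtain ⟨s, hs, hc, hxs, -⟩ := T.boundary x hx
    exact mem_biUnion (x := s) ⟨hs, hc⟩ (convexHull_subset_affineSpan _ hxs)
  refine measure_mono_null hsub ((measure_biUnion_null_iff ?_).2 ?_)
  · exact (T.finite_faces.subset (fun s hs => hs.1)).countable
  · intro s hs
    exact volume_affineSpan_eq_zero hs.2.le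

lemma ae_closure_imp_mem (T : Triangulation Ω) (hΩ : IsOpen Ω) : ∀ᵐ x : Euc d, x ∈ closure Ω → x ∈ Ω := by
  filter_upwards [measure_eq_zero_iff_ae_notMem.1 T.volume_frontier] with x hx hc
  by_contra hn
  exact hx (by rw [hΩ.frontier_eq]; exact ⟨hc, hn⟩)

lemma ae_exists_interior (T : Triangulation Ω) : ∀ᵐ x : Euc d, x ∈ Ω → ∃ K ∈ T.elements, x ∈ interior (body K) := by
  have : ∀ᵐ x : Euc d, ∀ K ∈ T.elements, x ∈ body K → x ∈ interior (body K) :=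
    (eventually_all_finset T.elements).2 fun K _ => ae_mem_interior_body K
  filter_upwards [this] with x hx hxΩ
  obtain ⟨K, hK, hxK⟩ := (mem_closure_iff (T := T)).1 (subset_closure hxΩ)
  exact ⟨K, hK, hx K hK hxK⟩

lemma iUnion_body_ae_eq (T : Triangulation Ω) (hΩ : IsOpen Ω) : (⋃ K ∈ T.elements, body K) =ᵐ[volume] Ω := by
  filter_upwards [T.ae_closure_imp_mem hΩ] with x hx
  refine propext ⟨fun h => hx ?_, fun h => ?_⟩
  · obtain ⟨K, hK, hxK⟩ := mem_iUnion₂.1 h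
    exact body_subset_closure hK hxK
  · obtain ⟨K, hK, hxK⟩ := (mem_closure_iff (T := T)).1 (subset_closure h)
    exact mem_iUnion₂.2 ⟨K, hK, hxK⟩

lemma aedisjoint_body (hK : K ∈ T.elements) (hK' : K' ∈ T.elements) (hne : K ≠ K') :
    AEDisjoint volume (body K) (body K') := by
  refine measure_mono_null ?_ (volume_body_diff_interior K)
  rintro x ⟨hx, hx'⟩
  exact ⟨hx, fun hi => hne (eq_of_mem_interior hK hK' hi hx')⟩

lemma restrict_body_le (hΩ : IsOpen Ω) (hK : K ∈ T.elements) :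
    volume.restrict (body K) ≤ volume.restrict Ω := by
  rw [← Measure.restrict_congr_set (T.iUnion_body_ae_eq hΩ)]
  exact Measure.restrict_mono_set _ (subset_biUnion_of_mem (u := fun K => body K) hK)

lemma integral_eq_sum (T : Triangulation Ω) (hΩ : IsOpen Ω) {g : Euc d → ℝ} (hg : IntegrableOn g Ω) :
    ∫ x in Ω, g x = ∑ K ∈ T.elements, ∫ x in body K, g x := by
  have hint : ∀ K : Finset (Euc d), interior (body K) =ᵐ[volume] body K := fun K => by
    filter_upwards [ae_mem_interior_body K] with x hx
    exact propext ⟨fun h => interior_subset h, hx⟩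
  have hΩeq : (⋃ K ∈ T.elements, interior (body K)) =ᵐ[volume] Ω := by
    filter_upwards [T.ae_exists_interior] with x hx
    refine propext ⟨fun h => ?_, fun h => ?_⟩
    · obtain ⟨K, hK, hxK⟩ := mem_iUnion₂.1 h
      exact interior_body_subset hΩ hK hxK
    · obtain ⟨K, hK, hxK⟩ := hx h
      exact mem_iUnion₂.2 ⟨K, hK, hxK⟩
  rw [← setIntegral_congr_set hΩeq, integral_biUnion_finset T.elements
    (fun K _ => isOpen_interior.measurableSet)
    (fun K hK K' hK' hne => Set.disjoint_left.2 fun x hx hx' =>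
      hne (eq_of_mem_interior hK hK' hx (interior_subset hx')))
    (fun K hK => hg.mono_set (interior_body_subset hΩ hK))]
  exact Finset.sum_congr rfl fun K _ => setIntegral_congr_set (hint K)

lemma volume_lt_top (T : Triangulation Ω) : volume Ω < ⊤ :=
  (measure_mono subset_closure).trans_lt T.isCompact_closure.measure_lt_top

/-! ### The star of a vertex -/

open Classical in
/-- The elements with vertex `z`. -/
noncomputable def star (T : Triangulation Ω) (z : Euc d) : Finset (Finset (Euc d)) :=
  T.elements.filter (z ∈ ·)

lemma mem_star {z : Euc d} : K ∈ T.star z ↔ K ∈ T.elements ∧ z ∈ K := by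
  classical
  simp [star]

open Classical in
/-- Two elements with the common vertex `z` are adjacent if they have a common facet. -/
noncomputable def starGraph (T : Triangulation Ω) (z : Euc d) : SimpleGraph (Finset (Euc d)) where
  Adj K K' := K ∈ T.star z ∧ K' ∈ T.star z ∧ (K ∩ K').card = d
  symm := ⟨fun K K' h => ⟨h.2.1, h.1, by rw [Finset.inter_comm]; exact h.2.2⟩⟩
  loopless := ⟨fun K h => by
    have h1 := h.2.2
    rw [Finset.inter_self, (isSimplex (mem_star.1 h.1).1).2] at h1
    omega⟩

lemma exists_ball_star {z : Euc d} (hz : {z} ∈ T.faces) :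
    ∃ r > 0, ∀ x ∈ Metric.ball z r, ∀ s ∈ T.faces, x ∈ body s → z ∈ s := by
  have hcl : IsClosed (⋃ s ∈ {s ∈ T.faces | z ∉ s}, body s) :=
    ((T.finite_faces.subset fun s hs => hs.1).isCompact_biUnion
      fun s _ => isCompact_body s).isClosed
  have hz' : z ∈ (⋃ s ∈ {s ∈ T.faces | z ∉ s}, body s)ᶜ := by
    simp only [mem_compl_iff, mem_iUnion, not_exists]
    rintro s ⟨hs, hzs⟩ h
    exact hzs (mem_of_mem_body_face hz hs h)
  obtain ⟨r, hr, hsub⟩ := Metric.isOpen_iff.1 hcl.isOpen_compl z hz'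
  refine ⟨r, hr, fun x hx s hs hxs => ?_⟩
  by_contra hzs
  exact hsub hx (mem_iUnion₂.2 ⟨s, ⟨hs, hzs⟩, hxs⟩)

/-- General position: if the segment meets `s`, necessarily away from `x`, then `y` lies in the
affine span of `x` and `s`. This is spanned by at most `d` points, hence null. -/
lemma ae_segment_avoids (hK : K ∈ T.elements) {x : Euc d} (hx : x ∈ interior (body K)) :
    ∀ᵐ y : Euc d, ∀ s ∈ T.faces, s.card < d → Disjoint (segment ℝ x y) (body s) := by
  classical
  have hfin : {s ∈ T.faces | s.card < d}.Finite := T.finite_faces.subset fun s hs => hs.1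
  have h0 : ∀ᵐ y : Euc d, ∀ s ∈ {s ∈ T.faces | s.card < d},
      y ∉ (affineSpan ℝ ((insert x s : Finset (Euc d)) : Set (Euc d)) : Set (Euc d)) := by
    rw [ae_ball_iff hfin.countable]
    intro s hs
    refine measure_eq_zero_iff_ae_notMem.1 (volume_affineSpan_eq_zero ?_)
    exact (Finset.card_insert_le _ _).trans hs.2
  filter_upwards [h0] with y hy s hs hsd
  rw [Set.disjoint_left]
  intro p hp hps
  refine hy s ⟨hs, hsd⟩ ?_
  rw [segment_eq_image_lineMap] at hp
  obtain ⟨t, ht, rfl⟩ := hp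
  have ht0 : t ≠ 0 := by
    rintro rfl
    rw [AffineMap.lineMap_apply_zero] at hps
    have := Finset.card_le_card (subset_of_mem_interior hK hs hx hps)
    rw [(isSimplex hK).2] at this
    omega
  have hpA : AffineMap.lineMap x y t ∈ affineSpan ℝ ((insert x s : Finset (Euc d)) : Set (Euc d)) :=
    affineSpan_mono ℝ (by simp) (convexHull_subset_affineSpan _ hps)
  have hxA : x ∈ affineSpan ℝ ((insert x s : Finset (Euc d)) : Set (Euc d)) :=
    subset_affineSpan ℝ _ (by simp)
  have := AffineMap.lineMap_mem t⁻¹ hxA hpA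
  rwa [AffineMap.lineMap_apply_module', AffineMap.lineMap_apply_module', add_sub_cancel_right,
    smul_smul, inv_mul_cancel₀ ht0, one_smul, sub_add_cancel] at this

/-- If no element in the component of `K` in the star of `z` has a facet on the boundary through
`z`, then this component covers a neighbourhood of `z`. -/
lemma component_mem_nhds (hΩ : IsOpen Ω) {z : Euc d} (hK : K ∈ T.star z)
    (hbd : ∀ K' ∈ T.star z, (T.starGraph z).Reachable K K' →
      ∀ s ⊆ K', z ∈ s → s.card = d → ¬ body s ⊆ frontier Ω) :
    ∃ r > 0, ∀ y ∈ Metric.ball z r, ∃ K' ∈ T.star z, (T.starGraph z).Reachable K K' ∧ y ∈ body K' := by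
  classical
  have hKe := (mem_star.1 hK).1
  have hzK := (mem_star.1 hK).2
  obtain ⟨r, hr, hball⟩ := exists_ball_star (singleton_mem_faces (mem_faces hKe) hzK)
  refine ⟨r, hr, ?_⟩
  set A : Set (Finset (Euc d)) := {K' | K' ∈ T.star z ∧ (T.starGraph z).Reachable K K'} with hA
  have hAfin : A.Finite := (T.star z).finite_toSet.subset fun K' h => h.1
  set U : Set (Euc d) := ⋃ K' ∈ A, body K' with hU
  have hUcl : IsClosed U := (hAfin.isCompact_biUnion fun s _ => isCompact_body s).isClosed
  suffices hsub : Metric.ball z r ⊆ U by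
    intro y hy
    obtain ⟨K', hK', hy'⟩ := mem_iUnion₂.1 (hsub hy)
    exact ⟨K', hK'.1, hK'.2, hy'⟩
  have hzcl : z ∈ closure (interior (body K)) := by
    rw [(isSimplex hKe).closure_interior]; exact subset_convexHull ℝ _ hzK
  obtain ⟨x, hxball, hx⟩ := mem_closure_iff_nhds.1 hzcl _ (Metric.ball_mem_nhds z hr)
  -- Away from the faces of codimension at least 2, the closed set `U` is also open. The carrier `F`
  -- of `p` has at least `d` vertices, so every element through `p` equals `K'` or shares a facet
  -- with it, and thus stays in the component.
  have hlocal : ∀ p ∈ Metric.ball z r, (∀ s ∈ T.faces, s.card < d → p ∉ body s) → p ∈ U →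
      p ∈ interior U := by
    intro p hp hsk hpU
    obtain ⟨K', hK', hpK'⟩ := mem_iUnion₂.1 hpU
    have hK'e := (mem_star.1 hK'.1).1
    set F := K'.filter fun v => 0 < bary K' v p with hF
    have hpF : p ∈ body F := mem_convexHull_support (isSimplex hK'e) hpK'
    have hFK' : F ⊆ K' := Finset.filter_subset _ _
    have hFf : F ∈ T.faces := by
      refine T.down_closed (mem_faces hK'e) hFK' ?_
      have : (body F).Nonempty := ⟨p, hpF⟩
      rw [body, convexHull_nonempty_iff] at this
      exact_mod_cast this
    have hcard : ∀ t ∈ T.faces, p ∈ body t → d ≤ (F ∩ t).card := by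
      intro t ht hpt
      by_contra hlt
      have hm := mem_inter hFf ht hpF hpt
      exact hsk _ (inter_mem_faces hFf hm) (not_le.1 hlt) hm
    -- A boundary facet through `p` would be a facet of `K'` through `z`, which `hbd` excludes.
    have hpΩ : p ∈ Ω := by
      by_contra hn
      have hf : p ∈ frontier Ω := by
        rw [hΩ.frontier_eq]; exact ⟨body_subset_closure hK'e hpK', hn⟩
      obtain ⟨s, hs, hsd, hps, hsf⟩ := T.boundary p hf
      have h1 := hcard s hs hps
      have h2 : F ∩ s = s := Finset.eq_of_subset_of_card_le Finset.inter_subset_right (by omega)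
      have h3 : s ⊆ K' := (Finset.inter_eq_right.1 h2).trans hFK'
      exact hbd K' hK'.1 hK'.2 s h3 (hball p hp s hs hps) hsd hsf
    have hcl : IsClosed (⋃ K'' ∈ {K'' : Finset (Euc d) | K'' ∈ T.elements ∧ p ∉ body K''}, body K'') :=
      ((T.elements.finite_toSet.subset fun s hs => hs.1).isCompact_biUnion
        fun s _ => isCompact_body s).isClosed
    rw [mem_interior]
    refine ⟨Ω ∩ (⋃ K'' ∈ {K'' : Finset (Euc d) | K'' ∈ T.elements ∧ p ∉ body K''}, body K'')ᶜ, ?_,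
      hΩ.inter hcl.isOpen_compl, hpΩ, ?_⟩
    · rintro q ⟨hqΩ, hq⟩
      obtain ⟨K'', hK'', hqK''⟩ := (mem_closure_iff (T := T)).1 (subset_closure hqΩ)
      have hpK'' : p ∈ body K'' := by
        by_contra hn
        exact hq (mem_iUnion₂.2 ⟨K'', ⟨hK'', hn⟩, hqK''⟩)
      have h1 := hcard K'' (mem_faces hK'') hpK''
      have h2 : d ≤ (K' ∩ K'').card :=
        h1.trans (Finset.card_le_card (Finset.inter_subset_inter_right hFK'))
      have hs'' : K'' ∈ T.star z := mem_star.2 ⟨hK'', hball p hp K'' (mem_faces hK'') hpK''⟩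
      refine mem_iUnion₂.2 ⟨K'', ⟨hs'', ?_⟩, hqK''⟩
      by_cases hEq : K' = K''
      · exact hEq ▸ hK'.2
      · refine hK'.2.trans (SimpleGraph.Adj.reachable ⟨hK'.1, hs'', le_antisymm ?_ h2⟩)
        by_contra hlt
        have h3 : K' ∩ K'' = K' := Finset.eq_of_subset_of_card_le Finset.inter_subset_left
          (by rw [(isSimplex hK'e).2]; omega)
        exact hEq (Finset.eq_of_subset_of_card_le (Finset.inter_eq_left.1 h3)
          (by rw [(isSimplex hK'e).2, (isSimplex hK'').2]))
    · simp only [mem_compl_iff, mem_iUnion, not_exists]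
      rintro K'' ⟨-, hn⟩ h
      exact hn h
  -- A generic segment starting at `x` is connected, and `U` is relatively open and closed in it.
  have hae : ∀ᵐ y : Euc d, y ∈ Metric.ball z r → y ∈ U := by
    filter_upwards [ae_segment_avoids hKe hx] with y hy hyb
    have hseg : segment ℝ x y ⊆ Metric.ball z r := (convex_ball z r).segment_subset hxball hyb
    have hpre : IsPreconnected (segment ℝ x y) := (convex_segment x y).isPreconnected
    have hxU : x ∈ U := mem_iUnion₂.2 ⟨K, ⟨hK, SimpleGraph.Reachable.refl _⟩, interior_subset hx⟩
    have hloc : ∀ p ∈ segment ℝ x y, p ∈ U → p ∈ interior U := fun p hp hpU =>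
      hlocal p (hseg hp) (fun s hs hsd hps => Set.disjoint_left.1 (hy s hs hsd) hp hps) hpU
    have := hpre.subset_left_of_subset_union isOpen_interior hUcl.isOpen_compl
      (disjoint_compl_right.mono_left interior_subset)
      (fun p hp => by
        by_cases hpU : p ∈ U
        · exact Or.inl (hloc p hp hpU)
        · exact Or.inr hpU) ⟨x, left_mem_segment ℝ x y, hloc x (left_mem_segment ℝ x y) hxU⟩
    exact interior_subset (this (right_mem_segment ℝ x y))
  -- `U` is closed, so a single missed point of the ball would produce a missed open set of positive
  -- measure.
  by_contra hns
  obtain ⟨y, hy, hyU⟩ := not_subset.1 hns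
  have hopen : IsOpen (Metric.ball z r ∩ Uᶜ) := Metric.isOpen_ball.inter hUcl.isOpen_compl
  have hpos := hopen.measure_pos volume ⟨y, hy, hyU⟩
  refine hpos.ne' (measure_eq_zero_iff_ae_notMem.2 ?_)
  filter_upwards [hae] with y hy h
  exact h.2 (hy h.1)

/-- No face through an interior vertex lies in the frontier, so one component fills a neighbourhood
of `z`. That neighbourhood contains interior points of every element of the star. -/
lemma reachable_of_mem (hΩ : IsOpen Ω) {z : Euc d} (hz : z ∈ Ω) (hK : K ∈ T.star z)
    (hK' : K' ∈ T.star z) : (T.starGraph z).Reachable K K' := by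
  obtain ⟨r, hr, h⟩ := component_mem_nhds hΩ hK fun L _ _ s _ hzs _ hsf => by
    have := hsf (subset_convexHull ℝ _ hzs)
    rw [hΩ.frontier_eq] at this
    exact this.2 hz
  have hK'e := (mem_star.1 hK').1
  have hzcl : z ∈ closure (interior (body K')) := by
    rw [(isSimplex hK'e).closure_interior]; exact subset_convexHull ℝ _ (mem_star.1 hK').2
  obtain ⟨x, hxball, hx⟩ := mem_closure_iff_nhds.1 hzcl _ (Metric.ball_mem_nhds z hr)
  obtain ⟨L, hL, hreach, hxL⟩ := h x hxball
  rwa [eq_of_mem_interior hK'e (mem_star.1 hL).1 hx hxL]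

/-- The star of a boundary vertex may be disconnected, so each component needs a boundary facet of
its own. A component without one would surround `z` and contain points near `z` in the relative
interior of some boundary facet. Conformity would make that facet a facet of one of its elements. -/
lemma exists_reachable_boundary_facet (hΩ : IsOpen Ω) {z : Euc d} (hz : z ∉ Ω)
    (hK : K ∈ T.star z) : ∃ K' ∈ T.star z, (T.starGraph z).Reachable K K' ∧
      ∃ s ⊆ K', z ∈ s ∧ s.card = d ∧ body s ⊆ frontier Ω := by
  classical
  by_contra hcon
  push Not at hcon
  obtain ⟨r, hr, h⟩ := component_mem_nhds hΩ hK hcon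
  have hKe := (mem_star.1 hK).1
  have hzK := (mem_star.1 hK).2
  have hzf : z ∈ frontier Ω := by
    rw [hΩ.frontier_eq]
    exact ⟨body_subset_closure hKe (subset_convexHull ℝ _ hzK), hz⟩
  obtain ⟨s, hs, hsd, hzs', hsf⟩ := T.boundary z hzf
  have hzs := mem_of_mem_body_face (singleton_mem_faces (mem_faces hKe) hzK) hs hzs'
  obtain ⟨L, hL, hsL⟩ := exists_element_superset hs
  have hLs := isSimplex hL
  obtain ⟨m, hm, hmpos⟩ : ∃ m ∈ body s, ∀ v ∈ s, 0 < bary L v m := by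
    have hn : (0 : ℝ) < s.card := by exact_mod_cast Finset.card_pos.2 ⟨z, hzs⟩
    have hsum : ∑ v ∈ s, (s.card : ℝ)⁻¹ = 1 := by
      rw [Finset.sum_const, nsmul_eq_mul, mul_inv_cancel₀ hn.ne']
    refine ⟨∑ v ∈ s, (s.card : ℝ)⁻¹ • v, ?_, fun u hu => ?_⟩
    · exact (convex_body s).sum_mem (fun _ _ => by positivity) hsum
        fun v hv => subset_convexHull ℝ _ hv
    · have : bary L u (∑ v ∈ s, ((s.card : ℝ)⁻¹) • v) =
          ∑ v ∈ s, (s.card : ℝ)⁻¹ * bary L u v := by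
        rw [← Finset.affineCombination_eq_linear_combination s _ _ hsum,
          Finset.map_affineCombination _ _ _ hsum,
          Finset.affineCombination_eq_linear_combination s _ _ hsum]
        simp
      rw [this]
      refine Finset.sum_pos' (fun v hv => ?_) ⟨u, hu, ?_⟩
      · have := (bary_mem_Icc hLs (subset_convexHull ℝ _ (Finset.mem_coe.2 (hsL hv))) (hsL hu)).1
        positivity
      · rw [bary_self hLs (hsL hu)]; positivity
  have htend : Tendsto (fun t : ℝ => (1 - t) • z + t • m) (𝓝[>] 0) (𝓝 z) := by
    have : Continuous fun t : ℝ => (1 - t) • z + t • m := by fun_prop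
    have h0 := (this.tendsto 0).mono_left (nhdsWithin_le_nhds (s := Ioi 0))
    simpa using h0
  have hev : ∀ᶠ t : ℝ in 𝓝[>] 0, t ∈ Ioo (0 : ℝ) 1 := Ioo_mem_nhdsGT one_pos
  obtain ⟨t, htb, ht⟩ := ((htend.eventually (Metric.ball_mem_nhds z hr)).and hev).exists
  set p := (1 - t) • z + t • m with hp
  obtain ⟨K', hK', hreach, hpK'⟩ := h p htb
  have hps : p ∈ body s := convex_body s (subset_convexHull ℝ _ hzs) hm (by linarith [ht.2])
    ht.1.le (by ring)
  have hpi := mem_inter hs (mem_faces (mem_star.1 hK').1) hps hpK'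
  have hsK' : s ⊆ K' := by
    intro v hv
    by_contra hvK'
    have h1 := bary_eq_zero_of_mem_convexHull hLs (t := ((s ∩ K' : Finset (Euc d)) : Set (Euc d)))
      (by intro y hy; exact hsL (Finset.mem_inter.1 hy).1) (hsL hv)
      (fun hv' => hvK' (Finset.mem_inter.1 hv').2) hpi
    rw [hp, Convex.combo_affine_apply (by ring)] at h1
    have h2 := (bary_mem_Icc hLs (subset_convexHull ℝ _ (Finset.mem_coe.2 (hsL hzs))) (hsL hv)).1
    have h3 := hmpos v hv
    have h4 : 0 < t * bary L v m := mul_pos ht.1 h3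
    have h5 : 0 ≤ (1 - t) * bary L v z := mul_nonneg (by linarith [ht.2]) h2
    simp only [smul_eq_mul] at h1
    linarith
  exact hcon K' hK' hreach s hsK' hzs hsd hsf

end Triangulation

/-! ### Propagation of L² deviations through a star, and the choice of nodal values. -/

namespace Triangulation

variable {d : ℕ} {Ω : Set (Euc d)} {T : Triangulation Ω} {K K' : Finset (Euc d)}

/-- Every element contains a ball of radius at least `h_K / c`. -/
def HasInballs (T : Triangulation Ω) (c : ℝ) : Prop :=
  ∀ K ∈ T.elements, ∃ x r, IsInball c K x r

lemma IsRegular.hasInballs {κ : ℝ} (h : T.IsRegular κ) (hκ : 0 < κ) (hd : 1 ≤ d) :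
    T.HasInballs (4 * κ) := fun K hK => exists_isInball (isSimplex hK) hd hκ (h K hK)

/-- The number of elements with a common vertex is bounded by shape regularity. -/
lemma card_star_le (hd : 1 ≤ d) {c : ℝ} (hc : 0 < c) (hT : T.HasInballs c) (z : Euc d) :
    ((T.star z).card : ℝ) ≤ c ^ d := by
  rcases (T.star z).eq_empty_or_nonempty with h0 | hne
  · rw [h0]; simp; positivity
  -- Packing argument in the ball around `z` whose radius is the smallest diameter in the star: the
  -- elements overlap in null sets only and each fills at least the fraction c⁻ᵈ of the ball.
  obtain ⟨L, hL, hmin⟩ := (T.star z).exists_min_image elementDiam hne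
  set s := elementDiam L with hs
  have hs0 : 0 < s := (isSimplex (mem_star.1 hL).1).elementDiam_pos hd
  have hv0 := volume_real_unitBall_pos (d := d)
  set v := volume.real (Metric.ball (0 : Euc d) 1) with hvd
  have hsum : ∑ K ∈ T.star z, volume.real (body K ∩ Metric.closedBall z s) ≤
      volume.real (Metric.closedBall z s) := by
    have htop : ∀ K ∈ T.star z, volume (body K ∩ Metric.closedBall z s) ≠ ⊤ := fun K _ =>
      ((measure_mono inter_subset_left).trans_lt (isCompact_body K).measure_lt_top).ne
    rw [← measureReal_biUnion_finset₀ ?_ ?_ htop]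
    · refine measureReal_mono (iUnion₂_subset fun K _ => inter_subset_right)
        measure_closedBall_lt_top.ne
    · intro K hK K' hK' hne
      exact (aedisjoint_body (mem_star.1 hK).1 (mem_star.1 hK').1 hne).mono inter_subset_left
        inter_subset_left
    · exact fun K _ => ((measurableSet_body K).inter
        Metric.isClosed_closedBall.measurableSet).nullMeasurableSet
  have hlow : ∑ K ∈ T.star z, (s / c) ^ d * v ≤
      ∑ K ∈ T.star z, volume.real (body K ∩ Metric.closedBall z s) := by
    refine Finset.sum_le_sum fun K hK => ?_
    obtain ⟨x, r, hb⟩ := hT K (mem_star.1 hK).1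
    exact hb.le_volume_real_inter_ball (isSimplex (mem_star.1 hK).1) hd hc (mem_star.1 hK).2 hs0
      (hmin K hK)
  rw [Finset.sum_const, nsmul_eq_mul] at hlow
  have h2 := hlow.trans hsum
  rw [volume_real_closedBall z hs0.le, ← hvd] at h2
  have h3 : ((T.star z).card : ℝ) * ((s / c) ^ d * v) = (T.star z).card / c ^ d * (s ^ d * v) := by
    rw [div_pow]; ring
  rw [h3] at h2
  have h4 : ((T.star z).card : ℝ) / c ^ d ≤ 1 := by
    have : 0 < s ^ d * v := by positivity
    nlinarith
  rwa [div_le_one (by positivity)] at h4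

/-- The Dirichlet energy of `w` on an element. -/
noncomputable def energy (w : Euc d → ℝ) (K : Finset (Euc d)) : ℝ :=
  ∫ x in body K, ‖fderiv ℝ w x‖ ^ 2

lemma energy_nonneg (w : Euc d → ℝ) (K : Finset (Euc d)) : 0 ≤ energy w K :=
  integral_nonneg fun _ => sq_nonneg _

/-- The energy of `w` on the star of a vertex. -/
noncomputable def starEnergy (T : Triangulation Ω) (w : Euc d → ℝ) (z : Euc d) : ℝ :=
  ∑ K ∈ T.star z, energy w K

lemma energy_le_starEnergy (w : Euc d → ℝ) {z : Euc d} (hK : K ∈ T.star z) :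
    energy w K ≤ T.starEnergy w z :=
  Finset.single_le_sum (f := energy w) (fun K _ => energy_nonneg w K) hK

lemma starEnergy_nonneg (w : Euc d → ℝ) (z : Euc d) : 0 ≤ T.starEnergy w z :=
  Finset.sum_nonneg fun K _ => energy_nonneg w K

/-- The scaled mean deviation of `w` from the constant `b`. -/
noncomputable def deviation (w : Euc d → ℝ) (b : ℝ) (K : Finset (Euc d)) : ℝ :=
  (∫ x in body K, (w x - b) ^ 2) / elementDiam K ^ 2

lemma deviation_nonneg (w : Euc d → ℝ) (b : ℝ) (K : Finset (Euc d)) : 0 ≤ deviation w b K :=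
  div_nonneg (integral_nonneg fun _ => sq_nonneg _) (sq_nonneg _)

lemma exists_erase_eq_of_card {K s : Finset (Euc d)} [DecidableEq (Euc d)] (hK : K.card = d + 1)
    (hs : s ⊆ K) (hc : s.card = d) : ∃ a ∈ K, a ∉ s ∧ K.erase a = s := by
  have h1 : (K \ s).card = 1 := by rw [Finset.card_sdiff_of_subset hs]; omega
  obtain ⟨a, ha⟩ := Finset.card_eq_one.1 h1
  have ha' : a ∈ K \ s := by rw [ha]; simp
  obtain ⟨haK, has⟩ := Finset.mem_sdiff.1 ha'
  refine ⟨a, haK, has, (Finset.eq_of_subset_of_card_le ?_ ?_).symm⟩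
  · exact fun x hx => Finset.mem_erase.2 ⟨by rintro rfl; exact has hx, hs hx⟩
  · rw [Finset.card_erase_of_mem haK]; omega

/-- The summand 1 in the first factor is slack: it makes the factor at least 1, so that its powers
increase along a walk. -/
lemma deviation_le_of_adj (hd : 2 ≤ d) {c : ℝ} (hc : 0 < c) (hT : T.HasInballs c) {w : Euc d → ℝ}
    (hw : ContDiff ℝ 1 w) (b : ℝ) {z : Euc d} (h : (T.starGraph z).Adj K K') :
    deviation w b K ≤ (1 + 2 * (c / 2 * c) ^ d * (c / 2) ^ 2) * deviation w b K' +
      (16 + 16 * (c / 2 * c) ^ d * (c / 2) ^ 2) * T.starEnergy w z := by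
  classical
  obtain ⟨hK, hK', hcard⟩ := h
  have hKs := isSimplex (mem_star.1 hK).1
  have hKs' := isSimplex (mem_star.1 hK').1
  obtain ⟨a, haK, has, hae⟩ := exists_erase_eq_of_card hKs.2 Finset.inter_subset_left
    (by convert hcard)
  obtain ⟨a', haK', has', hae'⟩ := exists_erase_eq_of_card hKs'.2 Finset.inter_subset_right
    (by convert hcard)
  -- Since `d ≥ 2`, the common facet has a second vertex, and the edge from `z` to it makes the two
  -- diameters comparable.
  obtain ⟨v, hv, hvz⟩ := Finset.exists_mem_ne (by rw [hcard]; omega : 1 < (K ∩ K').card) z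
  have hvK := (Finset.mem_inter.1 hv).1
  have hvK' := (Finset.mem_inter.1 hv).2
  obtain ⟨x, r, hb⟩ := hT K (mem_star.1 hK).1
  obtain ⟨x', r', hb'⟩ := hT K' (mem_star.1 hK').1
  have hle : elementDiam K ≤ c / 2 * elementDiam K' :=
    hb.elementDiam_le hKs hc.le hvK (mem_star.1 hK).2 hvz hvK' (mem_star.1 hK').2
  have hle' : elementDiam K' ≤ c / 2 * elementDiam K :=
    hb'.elementDiam_le hKs' hc.le hvK' (mem_star.1 hK').2 hvz hvK (mem_star.1 hK).2
  have hM := hb'.volume_real_div_le hKs hKs' hc.le (by positivity) hle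
  have hmain := setIntegral_sq_sub_const_le_of_adjacent hw hKs hKs' haK haK'
    (fun h => has (Finset.mem_inter.2 ⟨haK, h⟩)) (fun h => has' (Finset.mem_inter.2 ⟨h, haK'⟩))
    (hae.trans hae'.symm) (mem_star.1 hK).2 (mem_star.1 hK').2 b
  have h0 := hKs.elementDiam_pos (by omega)
  have h0' := hKs'.elementDiam_pos (by omega)
  have hE := energy_le_starEnergy (T := T) w hK
  have hE' := energy_le_starEnergy (T := T) w hK'
  have hEn := energy_nonneg w K
  have hEn' := energy_nonneg w K'
  have hdev' : ∫ x in body K', (w x - b) ^ 2 = deviation w b K' * elementDiam K' ^ 2 := by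
    rw [deviation, div_mul_cancel₀ _ (by positivity)]
  rw [hdev'] at hmain
  change _ ≤ _ + 16 * elementDiam K ^ 2 * energy w K + 16 * _ * _ * energy w K' at hmain
  rw [deviation, div_le_iff₀ (by positivity)]
  refine hmain.trans ?_
  set M := (c / 2 * c) ^ d
  set R := volume.real (body K) / volume.real (body K')
  have hR : 0 ≤ R := by positivity
  have hD := deviation_nonneg w b K'
  set D := deviation w b K'
  have hsq : elementDiam K' ^ 2 ≤ (c / 2) ^ 2 * elementDiam K ^ 2 := by
    rw [← mul_pow]; gcongr
  set S := T.starEnergy w z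
  have hS : 0 ≤ S := starEnergy_nonneg w z
  have hRM : R * elementDiam K' ^ 2 ≤ M * ((c / 2) ^ 2 * elementDiam K ^ 2) :=
    mul_le_mul hM hsq (by positivity) (by positivity)
  have i1 := mul_le_mul_of_nonneg_right hRM hD
  have i2 : R * elementDiam K' ^ 2 * energy w K' ≤
      M * ((c / 2) ^ 2 * elementDiam K ^ 2) * S := mul_le_mul hRM hE' hEn' (by positivity)
  have i3 : elementDiam K ^ 2 * energy w K ≤ elementDiam K ^ 2 * S := by gcongr
  have i4 : 0 ≤ D * elementDiam K ^ 2 := by positivity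
  nlinarith

lemma deviation_le_of_walk (hd : 2 ≤ d) {c : ℝ} (hc : 0 < c) (hT : T.HasInballs c) {w : Euc d → ℝ}
    (hw : ContDiff ℝ 1 w) (b : ℝ) {z : Euc d} (p : (T.starGraph z).Walk K K') :
    deviation w b K ≤ (1 + 2 * (c / 2 * c) ^ d * (c / 2) ^ 2) ^ p.length * (deviation w b K' +
      p.length * ((16 + 16 * (c / 2 * c) ^ d * (c / 2) ^ 2) * T.starEnergy w z)) := by
  induction p with
  | nil => simp
  | @cons K L K' hadj p ih =>
    have h1 := deviation_le_of_adj hd hc hT hw b hadj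
    set α := 1 + 2 * (c / 2 * c) ^ d * (c / 2) ^ 2 with hα
    have hα1 : 1 ≤ α := by rw [hα]; nlinarith [show 0 ≤ 2 * (c / 2 * c) ^ d * (c / 2) ^ 2 by positivity]
    set B := (16 + 16 * (c / 2 * c) ^ d * (c / 2) ^ 2) * T.starEnergy w z with hB
    have hB0 : 0 ≤ B := mul_nonneg (by positivity) (starEnergy_nonneg w z)
    rw [SimpleGraph.Walk.length_cons, pow_succ]
    push_cast
    have h2 : α * deviation w b L ≤ α * (α ^ p.length * (deviation w b K' + p.length * B)) := by
      gcongr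
    have h3 : 1 ≤ α ^ p.length * α := by
      rw [← pow_succ]; exact one_le_pow₀ hα1
    nlinarith

/-- A path repeats no element and, by the definition of adjacency, never leaves the star. -/
lemma exists_walk_length_lt (hK : K ∈ T.star z) (h : (T.starGraph z).Reachable K K') :
    ∃ p : (T.starGraph z).Walk K K', p.length < (T.star z).card := by
  classical
  obtain ⟨p, hp⟩ := h.exists_isPath
  refine ⟨p, ?_⟩
  have hsupp : ∀ {L L' : Finset (Euc d)} (q : (T.starGraph z).Walk L L'), L ∈ T.star z →
      ∀ v ∈ q.support, v ∈ T.star z := by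
    intro L L' q
    induction q with
    | nil => intro h v hv; simp at hv; exact hv ▸ h
    | cons hadj q ih =>
      intro h v hv
      rw [SimpleGraph.Walk.support_cons, List.mem_cons] at hv
      rcases hv with rfl | hv
      · exact h
      · exact ih hadj.2.1 v hv
  have h1 : p.support.toFinset ⊆ T.star z := fun v hv => hsupp p hK v (by simpa using hv)
  have h2 := Finset.card_le_card h1
  rw [List.toFinset_card_of_nodup hp.support_nodup, SimpleGraph.Walk.length_support] at h2
  omega

/-- The constant of the quasi-interpolation estimate. -/
noncomputable def starConst (d : ℕ) (c : ℝ) : ℝ :=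
  (1 + 2 * (c / 2 * c) ^ d * (c / 2) ^ 2) ^ ⌈c ^ d⌉₊ *
    (4 * 2 ^ d + ⌈c ^ d⌉₊ * (16 + 16 * (c / 2 * c) ^ d * (c / 2) ^ 2))

lemma starConst_nonneg (d : ℕ) {c : ℝ} (hc : 0 < c) : 0 ≤ starConst d c := by
  unfold starConst; positivity

/-- One good element per component suffices, since walks have at most ⌈cᵈ⌉ steps. The constant `4 *
2 ^ d` accommodates both the Poincaré and the Friedrichs inequality. -/
lemma deviation_le_of_reachable (hd : 2 ≤ d) {c : ℝ} (hc : 0 < c) (hT : T.HasInballs c)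
    {w : Euc d → ℝ} (hw : ContDiff ℝ 1 w) (b : ℝ) {z : Euc d} (hK : K ∈ T.star z)
    (h : (T.starGraph z).Reachable K K')
    (hdev : deviation w b K' ≤ 4 * 2 ^ d * T.starEnergy w z) :
    deviation w b K ≤ starConst d c * T.starEnergy w z := by
  obtain ⟨p, hp⟩ := exists_walk_length_lt hK h
  have hlen : p.length ≤ ⌈c ^ d⌉₊ := by
    have h1 := (card_star_le (by omega) hc hT z).trans (Nat.le_ceil _)
    have h2 : (T.star z).card ≤ ⌈c ^ d⌉₊ := by exact_mod_cast h1
    omega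
  have hS := starEnergy_nonneg (T := T) w z
  refine (deviation_le_of_walk hd hc hT hw b p).trans ?_
  unfold starConst
  set N := ⌈c ^ d⌉₊
  set β := 16 + 16 * (c / 2 * c) ^ d * (c / 2) ^ 2 with hβ
  have hβ0 : 0 ≤ β := by positivity
  have hα1 : 1 ≤ 1 + 2 * (c / 2 * c) ^ d * (c / 2) ^ 2 := by
    nlinarith [show 0 ≤ 2 * (c / 2 * c) ^ d * (c / 2) ^ 2 by positivity]
  rw [mul_assoc (_ ^ N)]
  refine mul_le_mul (pow_le_pow_right₀ hα1 hlen) ?_ ?_ (by positivity)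
  · have : (p.length : ℝ) ≤ N := by exact_mod_cast hlen
    have h3 : (p.length : ℝ) * (β * T.starEnergy w z) ≤ N * (β * T.starEnergy w z) := by gcongr
    linarith
  · have := deviation_nonneg w b K'
    positivity

/-- A nodal value at `z` with optimal approximation on the star of `z`, which is zero at vertices
on the boundary. -/
lemma exists_nodal_value (hΩ : IsOpen Ω) (hd : 2 ≤ d) {c : ℝ} (hc : 0 < c) (hT : T.HasInballs c)
    {w : Euc d → ℝ} (hw : ContDiff ℝ 1 w) (hw0 : ∀ x ∉ Ω, w x = 0) (z : Euc d) :
    ∃ b : ℝ, (z ∉ Ω → b = 0) ∧ ∀ K ∈ T.star z,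
      deviation w b K ≤ starConst d c * T.starEnergy w z := by
  classical
  have h2d : (1 : ℝ) ≤ 2 ^ d := one_le_pow₀ (by norm_num)
  by_cases hz : z ∈ Ω
  · rcases (T.star z).eq_empty_or_nonempty with h0 | ⟨L, hL⟩
    · exact ⟨0, fun _ => rfl, by simp [h0]⟩
    have hLs := isSimplex (mem_star.1 hL).1
    have hdiam := hLs.elementDiam_pos (by omega)
    obtain ⟨b, hb⟩ := exists_setIntegral_sq_sub_const_le hw (isCompact_body L) (convex_body L)
      (Measure.measure_pos_of_nonempty_interior volume hLs.interior_nonempty).ne'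
      (fun x hx y hy => norm_sub_le_elementDiam hx hy)
    refine ⟨b, fun h => absurd hz h, fun K hK => ?_⟩
    refine deviation_le_of_reachable hd hc hT hw b hK (reachable_of_mem hΩ hz hK hL) ?_
    rw [deviation, div_le_iff₀ (by positivity)]
    refine hb.trans ?_
    have := energy_le_starEnergy (T := T) w hL
    unfold energy at this
    have h3 : 0 ≤ 4 * 2 ^ d * elementDiam L ^ 2 := by positivity
    nlinarith [mul_le_mul_of_nonneg_left this h3]
  -- Here the value 0 is forced; the good element is one with a facet in the frontier, where `w`
  -- vanishes.
  · refine ⟨0, fun _ => rfl, fun K hK => ?_⟩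
    obtain ⟨L, hL, hreach, s, hsL, hzs, hsd, hsf⟩ := exists_reachable_boundary_facet hΩ hz hK
    refine deviation_le_of_reachable hd hc hT hw 0 hK hreach ?_
    have hLs := isSimplex (mem_star.1 hL).1
    have hdiam := hLs.elementDiam_pos (by omega)
    obtain ⟨a, haL, has, hae⟩ := exists_erase_eq_of_card hLs.2 hsL hsd
    have haz : a ≠ z := by rintro rfl; exact has hzs
    have h1 := setIntegral_sq_le_of_facet hw hLs haL (mem_star.1 hL).2 haz (fun x hx => by
      rw [← Finset.coe_erase, hae] at hx
      refine hw0 x fun hxΩ => ?_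
      have := hsf hx
      rw [hΩ.frontier_eq] at this
      exact this.2 hxΩ)
    rw [deviation, div_le_iff₀ (by positivity)]
    simp only [sub_zero]
    refine h1.trans ?_
    have := energy_le_starEnergy (T := T) w hL
    have hE := energy_nonneg w L
    unfold energy at this hE
    have hS := starEnergy_nonneg (T := T) w z
    have h3 : 0 ≤ elementDiam L ^ 2 := by positivity
    have h4 : T.starEnergy w z ≤ 2 ^ d * T.starEnergy w z := by nlinarith
    nlinarith [mul_le_mul_of_nonneg_left (this.trans h4) h3]

end Triangulation

/-! ### Lipschitz functions on finite closed covers. -/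

section Gluing

/-- Let `t` be the last point of [a, b] in the set that contains `a`. Beyond `t` this set is not
needed, and closedness of the others recovers `t` itself, so induction on the number of sets
applies. -/
lemma abs_sub_le_of_closed_cover_Icc {ι : Type*} (s : Finset ι) {F : ι → Set ℝ}
    (hF : ∀ i, IsClosed (F i)) {g : ℝ → ℝ} {C : ℝ}
    (hg : ∀ i ∈ s, ∀ x ∈ F i, ∀ y ∈ F i, |g x - g y| ≤ C * |x - y|) {a b : ℝ} (hab : a ≤ b)
    (hcov : Icc a b ⊆ ⋃ i ∈ s, F i) : |g b - g a| ≤ C * (b - a) := by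
  classical
  induction s using Finset.strongInduction generalizing a with
  | H s ih =>
    obtain ⟨i, hi, hai⟩ := mem_iUnion₂.1 (hcov (left_mem_Icc.2 hab))
    have hcomp : IsCompact (F i ∩ Icc a b) := isCompact_Icc.inter_left (hF i)
    have hne : (F i ∩ Icc a b).Nonempty := ⟨a, hai, left_mem_Icc.2 hab⟩
    set t := sSup (F i ∩ Icc a b) with ht
    have htm : t ∈ F i ∩ Icc a b := hcomp.sSup_mem hne
    have h1 : |g t - g a| ≤ C * (t - a) := by
      have := hg i hi t htm.1 a hai
      rwa [abs_of_nonneg (sub_nonneg.2 htm.2.1)] at this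
    rcases htm.2.2.eq_or_lt with htb | htb
    · rwa [htb] at h1
    have hcl : IsClosed (⋃ j ∈ s.erase i, F j) :=
      (s.erase i).finite_toSet.isClosed_biUnion fun j _ => hF j
    have hIoc : Ioc t b ⊆ ⋃ j ∈ s.erase i, F j := by
      intro x hx
      have hxab : x ∈ Icc a b := ⟨htm.2.1.trans hx.1.le, hx.2⟩
      obtain ⟨j, hj, hxj⟩ := mem_iUnion₂.1 (hcov hxab)
      refine mem_iUnion₂.2 ⟨j, Finset.mem_erase.2 ⟨?_, hj⟩, hxj⟩
      rintro rfl
      exact absurd (le_csSup hcomp.bddAbove ⟨hxj, hxab⟩) (not_le.2 hx.1)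
    have hIcc : Icc t b ⊆ ⋃ j ∈ s.erase i, F j := by
      rw [← closure_Ioc htb.ne]
      exact closure_minimal hIoc hcl
    have h2 := ih (s.erase i) (Finset.erase_ssubset hi)
      (fun j hj => hg j (Finset.mem_of_mem_erase hj)) htb.le hIcc
    calc |g b - g a| = |(g b - g t) + (g t - g a)| := by ring_nf
      _ ≤ |g b - g t| + |g t - g a| := abs_add_le _ _
      _ ≤ C * (b - t) + C * (t - a) := add_le_add h2 h1
      _ = C * (b - a) := by ring

/-- A function that is Lipschitz on each set of a finite closed cover of a normed space is
Lipschitz. -/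
lemma lipschitzWith_of_finite_closed_cover {E ι : Type*} [NormedAddCommGroup E] [NormedSpace ℝ E]
    (s : Finset ι) {F : ι → Set E} (hF : ∀ i, IsClosed (F i)) (hcov : ∀ x, ∃ i ∈ s, x ∈ F i)
    {f : E → ℝ} {C : ℝ≥0} (hf : ∀ i ∈ s, LipschitzOnWith C f (F i)) : LipschitzWith C f := by
  refine LipschitzWith.of_dist_le_mul fun x y => ?_
  have hline : Continuous fun t : ℝ => x + t • (y - x) := by fun_prop
  have := abs_sub_le_of_closed_cover_Icc s (F := fun i => (fun t : ℝ => x + t • (y - x)) ⁻¹' F i)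
    (fun i => (hF i).preimage hline) (g := fun t => f (x + t • (y - x))) (C := C * dist x y)
    (fun i hi p hp q hq => by
      have h1 := (hf i hi).dist_le_mul _ hp _ hq
      rw [Real.dist_eq] at h1
      refine h1.trans (le_of_eq ?_)
      rw [dist_add_left, dist_eq_norm, ← sub_smul, norm_smul, dist_comm x, dist_eq_norm,
        Real.norm_eq_abs]
      ring) (zero_le_one' ℝ) (fun t _ => by
      obtain ⟨i, hi, h⟩ := hcov (x + t • (y - x))
      exact mem_iUnion₂.2 ⟨i, hi, h⟩)
  rw [dist_comm (f x), Real.dist_eq]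
  simpa using this

end Gluing

/-! ### Continuous piecewise affine functions vanishing outside the domain. -/

namespace Triangulation

variable {d : ℕ} {Ω : Set (Euc d)} (T : Triangulation Ω) {K K' : Finset (Euc d)}

/-- A function that vanishes outside `Ω` and is Lipschitz on each element is Lipschitz. -/
lemma exists_lipschitzWith (hΩ : IsOpen Ω) {g : Euc d → ℝ} (h0 : ∀ x ∉ Ω, g x = 0)
    (h : ∀ K ∈ T.elements, ∃ C, LipschitzOnWith C g (body K)) : ∃ C, LipschitzWith C g := by
  classical
  choose! C hC using h
  set B : ℝ≥0 := ∑ K ∈ T.elements, C K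
  -- The index `none` stands for the complement of `Ω`.
  refine ⟨B, lipschitzWith_of_finite_closed_cover (insert none (T.elements.image some))
    (F := fun i => i.elim Ωᶜ body) ?_ ?_ ?_⟩
  · rintro (_ | K)
    · exact hΩ.isClosed_compl
    · exact (isCompact_body K).isClosed
  · intro x
    by_cases hx : x ∈ Ω
    · obtain ⟨K, hK, hxK⟩ := (mem_closure_iff (T := T)).1 (subset_closure hx)
      exact ⟨some K, by simp [hK], hxK⟩
    · exact ⟨none, by simp, hx⟩
  · intro i hi
    rw [Finset.mem_insert, Finset.mem_image] at hi
    rcases hi with rfl | ⟨K, hK, rfl⟩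
    · refine LipschitzOnWith.of_dist_le_mul fun x hx y hy => ?_
      rw [h0 x hx, h0 y hy]
      simp; positivity
    · exact (hC K hK).weaken (Finset.single_le_sum (f := C) (fun _ _ => zero_le) hK)

lemma exists_lipschitzWith_affine (a : Euc d →ᵃ[ℝ] ℝ) : ∃ C, LipschitzWith C a := by
  refine ⟨‖LinearMap.toContinuousLinearMap a.linear‖₊, LipschitzWith.of_dist_le_mul fun x y => ?_⟩
  have := a.linearMap_vsub x y
  rw [dist_eq_norm, dist_eq_norm]
  rw [vsub_eq_sub, vsub_eq_sub] at this
  rw [← this]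
  exact (LinearMap.toContinuousLinearMap a.linear).le_opNorm (x - y)

/-- The affine function with values `c z` at the vertices `z` of `K`. -/
noncomputable def nodalAffine (c : Euc d → ℝ) (K : Finset (Euc d)) : Euc d →ᵃ[ℝ] ℝ :=
  ∑ z ∈ K, c z • bary K z

lemma nodalAffine_apply (c : Euc d → ℝ) (K : Finset (Euc d)) (x : Euc d) :
    nodalAffine c K x = ∑ z ∈ K, c z * bary K z x := by
  have h : ∀ (s : Finset (Euc d)) (f : Euc d → Euc d →ᵃ[ℝ] ℝ),
      (∑ z ∈ s, c z • f z) x = ∑ z ∈ s, c z * f z x := by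
    intro s f
    induction s using Finset.cons_induction with
    | empty => simp
    | cons a s ha ih => rw [Finset.sum_cons, Finset.sum_cons, ← ih]; rfl
  exact h K _

lemma nodalAffine_vertex {c : Euc d → ℝ} (h : IsSimplex K) {z : Euc d} (hz : z ∈ K) :
    nodalAffine c K z = c z := by
  rw [nodalAffine_apply, Finset.sum_eq_single z]
  · rw [bary_self h hz, mul_one]
  · intro b hb hbz
    rw [bary_ne h hb hz hbz, mul_zero]
  · exact fun h => absurd hz h

open Classical in
/-- The continuous piecewise affine function with nodal values `c`. -/
noncomputable def nodal (c : Euc d → ℝ) (x : Euc d) : ℝ :=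
  if h : ∃ K ∈ T.elements, x ∈ body K then nodalAffine c h.choose x else 0

variable {T}

/-- The element chosen in `nodal` is immaterial: two elements meet in the hull of their common
vertices, where both affine functions have the same nodal values. -/
lemma nodal_eq (c : Euc d → ℝ) (hK : K ∈ T.elements) {x : Euc d} (hx : x ∈ body K) :
    T.nodal c x = nodalAffine c K x := by
  classical
  have h : ∃ K ∈ T.elements, x ∈ body K := ⟨K, hK, hx⟩
  rw [nodal, dif_pos h]
  obtain ⟨hL, hxL⟩ := h.choose_spec
  set L := h.choose
  have hm := mem_inter (mem_faces hL) (mem_faces hK) hxL hx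
  refine eqOn_convexHull_of_eqOn (fun v hv => ?_) hm
  have hv' := Finset.mem_inter.1 (Finset.mem_coe.1 hv)
  rw [nodalAffine_vertex (isSimplex hL) hv'.1, nodalAffine_vertex (isSimplex hK) hv'.2]

lemma nodal_eq_zero (hΩ : IsOpen Ω) {c : Euc d → ℝ} (hc : ∀ z ∉ Ω, c z = 0) {x : Euc d}
    (hx : x ∉ Ω) : T.nodal c x = 0 := by
  by_cases h : x ∈ closure Ω
  · have hf : x ∈ frontier Ω := by rw [hΩ.frontier_eq]; exact ⟨h, hx⟩
    obtain ⟨s, hs, -, hxs, hsf⟩ := T.boundary x hf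
    obtain ⟨L, hL, hsL⟩ := exists_element_superset hs
    rw [nodal_eq c hL (convexHull_mono (Finset.coe_subset.2 hsL) hxs)]
    have : EqOn (nodalAffine c L) (AffineMap.const ℝ (Euc d) (0 : ℝ)) (s : Set (Euc d)) := by
      intro v hv
      rw [nodalAffine_vertex (isSimplex hL) (hsL hv), AffineMap.const_apply]
      refine hc v fun hvΩ => ?_
      have := hsf (subset_convexHull ℝ _ hv)
      rw [hΩ.frontier_eq] at this
      exact this.2 hvΩ
    simpa using eqOn_convexHull_of_eqOn this hxs
  · rw [nodal, dif_neg fun hK => h ((mem_closure_iff (T := T)).2 hK)]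

variable (T) in
/-- `v` vanishes outside `Ω` and is affine on the closed elements. -/
def IsPiecewiseAffine (v : Euc d → ℝ) : Prop :=
  (∀ x ∉ Ω, v x = 0) ∧ ∀ K ∈ T.elements, ∃ a : Euc d →ᵃ[ℝ] ℝ, EqOn v a (body K)

lemma IsPiecewiseAffine.exists_lipschitzWith {v : Euc d → ℝ} (h : T.IsPiecewiseAffine v)
    (hΩ : IsOpen Ω) : ∃ C, LipschitzWith C v := by
  refine T.exists_lipschitzWith hΩ h.1 fun K hK => ?_
  obtain ⟨a, ha⟩ := h.2 K hK
  obtain ⟨C, hC⟩ := exists_lipschitzWith_affine a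
  refine ⟨C, fun x hx y hy => ?_⟩
  rw [ha hx, ha hy]
  exact hC x y

lemma isPiecewiseAffine_nodal (hΩ : IsOpen Ω) {c : Euc d → ℝ} (hc : ∀ z ∉ Ω, c z = 0) :
    T.IsPiecewiseAffine (T.nodal c) :=
  ⟨fun _ hx => nodal_eq_zero hΩ hc hx, fun K hK => ⟨nodalAffine c K, fun _ hx => nodal_eq c hK hx⟩⟩

lemma IsPiecewiseAffine.mem_P1Space0 {v : Euc d → ℝ} (h : T.IsPiecewiseAffine v)
    (hΩ : IsOpen Ω) : v ∈ P1Space0 T := by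
  obtain ⟨C, hC⟩ := h.exists_lipschitzWith hΩ
  refine ⟨⟨hC.continuous.continuousOn, fun K hK => ?_⟩, fun x hx => ?_⟩
  · obtain ⟨a, ha⟩ := h.2 K hK
    exact ⟨a, fun x hx => ha hx.1⟩
  · have h1 := (hC.continuous.tendsto x).mono_left (nhdsWithin_le_nhds (s := Ω))
    rwa [h.1 x (by rw [hΩ.frontier_eq] at hx; exact hx.2)] at h1

/-- The extension by zero of a function in `V_h⁰` is affine on the closed elements. -/
lemma isPiecewiseAffine_indicator (hΩ : IsOpen Ω) {v : Euc d → ℝ} (hv : v ∈ P1Space0 T) :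
    T.IsPiecewiseAffine (Ω.indicator v) := by
  refine ⟨fun x hx => indicator_of_notMem hx v, fun K hK => ?_⟩
  obtain ⟨a, ha⟩ := hv.1.2 K hK
  refine ⟨a, fun x hx => ?_⟩
  by_cases hxΩ : x ∈ Ω
  · rw [indicator_of_mem hxΩ]; exact ha ⟨hx, hxΩ⟩
  rw [indicator_of_notMem hxΩ]
  have hf : x ∈ frontier Ω := by
    rw [hΩ.frontier_eq]; exact ⟨body_subset_closure hK hx, hxΩ⟩
  -- The boundary condition concerns limits from inside `Ω` only, so `x` is approached through the
  -- interior of `K`, where `v` agrees with `a`.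
  have h1 : Tendsto v (𝓝[interior (body K)] x) (𝓝 0) :=
    (hv.2 x hf).mono_left (nhdsWithin_mono _ (interior_body_subset hΩ hK))
  have hac : Continuous a := a.continuous_of_finiteDimensional
  have h2 : Tendsto a (𝓝[interior (body K)] x) (𝓝 (a x)) :=
    (hac.tendsto x).mono_left nhdsWithin_le_nhds
  have hne : (𝓝[interior (body K)] x).NeBot := by
    rw [← mem_closure_iff_nhdsWithin_neBot, (isSimplex hK).closure_interior]
    exact hx
  refine tendsto_nhds_unique (h1.congr' ?_) h2
  filter_upwards [self_mem_nhdsWithin] with y hy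
  exact ha ⟨interior_subset hy, interior_body_subset hΩ hK hy⟩

end Triangulation

/-! ### The quasi-interpolation estimate. -/

namespace Triangulation

variable {d : ℕ} {Ω : Set (Euc d)} {T : Triangulation Ω} {K K' : Finset (Euc d)}

/-- Finite overlap: the energy of `K'` is counted once for each of its d + 1 vertices and each of
the at most cᵈ elements at that vertex. -/
lemma sum_sum_starEnergy_le (hd : 1 ≤ d) {c : ℝ} (hc : 0 < c) (hT : T.HasInballs c)
    (w : Euc d → ℝ) : ∑ K ∈ T.elements, ∑ z ∈ K, T.starEnergy w z ≤
      (d + 1) * c ^ d * ∑ K ∈ T.elements, energy w K := by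
  classical
  have h1 : ∀ z, T.starEnergy w z =
      ∑ K' ∈ T.elements, if z ∈ K' then energy w K' else 0 := fun z => by
    rw [starEnergy, star, Finset.sum_filter]
  have h2 : ∀ K' ∈ T.elements, ∑ K ∈ T.elements, ∑ z ∈ K, (if z ∈ K' then energy w K' else 0) ≤
      (d + 1) * c ^ d * energy w K' := by
    intro K' hK'
    have e1 : ∀ K : Finset (Euc d), ∑ z ∈ K, (if z ∈ K' then energy w K' else 0) =
        ∑ z ∈ K', (if z ∈ K then energy w K' else 0) := fun K => by
      rw [← Finset.sum_filter, ← Finset.sum_filter]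
      congr 1
      ext z
      simp [and_comm]
    simp_rw [e1]
    rw [Finset.sum_comm]
    calc ∑ z ∈ K', ∑ K ∈ T.elements, (if z ∈ K then energy w K' else 0)
        ≤ ∑ z ∈ K', c ^ d * energy w K' := by
          refine Finset.sum_le_sum fun z _ => ?_
          rw [← Finset.sum_filter, Finset.sum_const, nsmul_eq_mul]
          refine mul_le_mul_of_nonneg_right ?_ (energy_nonneg w K')
          refine (le_of_eq (congrArg (fun s : Finset (Finset (Euc d)) => (s.card : ℝ)) ?_)).trans
            (card_star_le hd hc hT z)
          ext K
          simp [mem_star]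
      _ = (d + 1) * c ^ d * energy w K' := by
          rw [Finset.sum_const, (isSimplex hK').2, nsmul_eq_mul]
          push_cast
          ring
  calc ∑ K ∈ T.elements, ∑ z ∈ K, T.starEnergy w z
      = ∑ K' ∈ T.elements, ∑ K ∈ T.elements, ∑ z ∈ K, (if z ∈ K' then energy w K' else 0) := by
        simp_rw [h1]
        rw [Finset.sum_comm]
        exact Finset.sum_congr rfl fun K _ => Finset.sum_comm
    _ ≤ ∑ K' ∈ T.elements, (d + 1) * c ^ d * energy w K' := Finset.sum_le_sum h2
    _ = _ := by rw [Finset.mul_sum]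

/-- Jensen's inequality with the barycentric coordinates as weights, which are then bounded by 1. -/
lemma sq_sub_nodalAffine_le (h : IsSimplex K) (b : Euc d → ℝ) {x : Euc d} (hx : x ∈ body K)
    (t : ℝ) : (t - nodalAffine b K x) ^ 2 ≤ ∑ z ∈ K, (t - b z) ^ 2 := by
  have h1 : t - nodalAffine b K x = ∑ z ∈ K, bary K z x • (t - b z) := by
    rw [nodalAffine_apply]
    simp only [smul_eq_mul, mul_sub, Finset.sum_sub_distrib]
    rw [← Finset.sum_mul, sum_bary h, one_mul]
    congr 1
    exact Finset.sum_congr rfl fun z _ => mul_comm _ _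
  rw [h1]
  refine ((even_two.convexOn_pow (𝕜 := ℝ)).map_sum_le
    (fun z hz => (bary_mem_Icc h hx hz).1) (sum_bary h x) (fun _ _ => mem_univ _)).trans ?_
  refine Finset.sum_le_sum fun z hz => ?_
  rw [smul_eq_mul]
  exact mul_le_of_le_one_left (sq_nonneg _) (bary_mem_Icc h hx hz).2

lemma hasFDerivAt_affine (a : Euc d →ᵃ[ℝ] ℝ) (x : Euc d) :
    HasFDerivAt a (LinearMap.toContinuousLinearMap a.linear) x := by
  have h1 := (LinearMap.toContinuousLinearMap a.linear).hasFDerivAt (x := x)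
  refine (h1.add_const (a 0)).congr_of_eventuallyEq (Eventually.of_forall fun y => ?_)
  simpa using congrFun a.decomp y

lemma eventuallyEq_affine_of_mem_interior {v : Euc d → ℝ} {a : Euc d →ᵃ[ℝ] ℝ} {S : Set (Euc d)}
    (h : EqOn v a S) {x : Euc d} (hx : x ∈ interior S) : v =ᶠ[𝓝 x] a := by
  filter_upwards [isOpen_interior.mem_nhds hx] with y hy
  exact h (interior_subset hy)

/-- The gradient of the interpolant on an element. -/
lemma sq_norm_linear_nodalAffine_le (h : IsSimplex K) {c : ℝ} {p : Euc d} {r : ℝ}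
    (hb : IsInball c K p r) (hdiam : 0 < elementDiam K) {w : Euc d → ℝ} (hw : Continuous w)
    (b : Euc d → ℝ) {B : ℝ} (hB : ∀ z ∈ K, deviation w (b z) K ≤ B) :
    volume.real (body K) * ‖LinearMap.toContinuousLinearMap (nodalAffine b K).linear‖ ^ 2 ≤
      4 * c ^ 2 * B := by
  have hV := volume_real_body_pos h
  set V := volume.real (body K) with hVdef
  set D := elementDiam K with hD
  obtain ⟨z₀, hz₀⟩ := h.nonempty
  have hB0 : 0 ≤ B := (deviation_nonneg _ _ _).trans (hB z₀ hz₀)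
  have hdev : ∀ z ∈ K, ∫ x in body K, (w x - b z) ^ 2 ≤ B * D ^ 2 := fun z hz => by
    have := hB z hz
    rwa [deviation, div_le_iff₀ (by positivity)] at this
  -- `δ` bounds the differences of nodal values: integrate (b z - b z₀)² ≤ 2 (w - b z)² + 2 (w - b
  -- z₀)² over `K`.
  set δ := √(4 * B * D ^ 2 / V) with hδ
  have hδ2 : V * δ ^ 2 = 4 * B * D ^ 2 := by
    rw [hδ, Real.sq_sqrt (by positivity)]; field_simp
  have hosc : ∀ z ∈ K, |b z - b z₀| ≤ δ := by
    intro z hz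
    refine Real.le_sqrt_of_sq_le ?_
    rw [sq_abs, le_div_iff₀ hV]
    have h1 : ∫ x in body K, (b z - b z₀) ^ 2 ≤
        2 * (∫ x in body K, (w x - b z) ^ 2) + 2 * ∫ x in body K, (w x - b z₀) ^ 2 := by
      rw [← integral_const_mul, ← integral_const_mul, ← integral_add]
      · refine setIntegral_mono_on ?_ ?_ (measurableSet_body K) fun x _ => ?_
        · exact integrableOn_of_continuous (by fun_prop) (isCompact_body K)
        · exact integrableOn_of_continuous (by fun_prop) (isCompact_body K)
        · nlinarith [sq_nonneg ((w x - b z) + (w x - b z₀))]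
      all_goals exact integrableOn_of_continuous (by fun_prop) (isCompact_body K)
    rw [setIntegral_const, smul_eq_mul] at h1
    have h2 := hdev z hz
    have h3 := hdev z₀ hz₀
    rw [← hVdef] at h1
    linarith
  have hval : ∀ y ∈ body K, nodalAffine b K y ∈ Icc (b z₀ - δ) (b z₀ + δ) := by
    have hsub : (K : Set (Euc d)) ⊆ nodalAffine b K ⁻¹' Icc (b z₀ - δ) (b z₀ + δ) := by
      intro z hz
      rw [mem_preimage, nodalAffine_vertex h hz]
      have := abs_le.1 (hosc z hz)
      constructor <;> linarith
    exact convexHull_min hsub ((convex_Icc _ _).affine_preimage _)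
  -- The interpolant takes values in an interval of length 2δ on a ball of diameter 2r.
  have hnorm : ‖LinearMap.toContinuousLinearMap (nodalAffine b K).linear‖ ≤ δ / r := by
    refine ContinuousLinearMap.opNorm_le_bound _ (div_nonneg (Real.sqrt_nonneg _) hb.1.le)
      fun v => ?_
    have h1 := abs_linear_mul_le_of_closedBall hb.1 hb.2.1 hval v
    rw [div_mul_eq_mul_div, le_div_iff₀ hb.1, Real.norm_eq_abs]
    simp only [LinearMap.coe_toContinuousLinearMap']
    nlinarith
  have hr := hb.1
  calc V * ‖LinearMap.toContinuousLinearMap (nodalAffine b K).linear‖ ^ 2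
      ≤ V * (δ / r) ^ 2 := by gcongr
    _ = 4 * B * (D / r) ^ 2 := by rw [div_pow, div_pow, ← mul_div_assoc, hδ2]; ring
    _ ≤ 4 * B * c ^ 2 := by
        gcongr
        rw [div_le_iff₀ hr]
        exact hb.2.2
    _ = 4 * c ^ 2 * B := by ring

/-- The constant of the interpolation error estimate. -/
noncomputable def interpConst (d : ℕ) (c : ℝ) : ℝ :=
  ((d + 1) * starConst d c + 2 + 8 * c ^ 2 * starConst d c) * ((d + 1) * c ^ d)

/-- The scaled `H¹` norm of `w` on an element. -/
noncomputable def localError (w : Euc d → ℝ) (K : Finset (Euc d)) : ℝ :=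
  deviation w 0 K + energy w K

lemma localError_sub_nodal_le (hd : 1 ≤ d) {c : ℝ} (hT : T.HasInballs c)
    {w : Euc d → ℝ} (hw : ContDiff ℝ 1 w) (b : Euc d → ℝ) (hK : K ∈ T.elements) {B : ℝ}
    (hB : ∀ z ∈ K, deviation w (b z) K ≤ B) :
    localError (fun x => w x - T.nodal b x) K ≤
      ((d + 1) + 8 * c ^ 2) * B + 2 * energy w K := by
  have hKs := isSimplex hK
  have hdiam := hKs.elementDiam_pos hd
  obtain ⟨p, r, hb⟩ := hT K hK
  have hcomp := isCompact_body K
  have hwc := hw.continuous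
  have hfc : Continuous (fderiv ℝ w) := hw.continuous_fderiv one_ne_zero
  have hac : Continuous (nodalAffine b K) := (nodalAffine b K).continuous_of_finiteDimensional
  have h1 : deviation (fun x => w x - T.nodal b x) 0 K ≤ (d + 1) * B := by
    rw [deviation, div_le_iff₀ (by positivity)]
    calc ∫ x in body K, (w x - T.nodal b x - 0) ^ 2
        = ∫ x in body K, (w x - nodalAffine b K x) ^ 2 := by
          refine setIntegral_congr_fun hcomp.measurableSet fun x hx => ?_
          simp only [sub_zero]
          rw [nodal_eq b hK hx]
      _ ≤ ∫ x in body K, ∑ z ∈ K, (w x - b z) ^ 2 := by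
          refine setIntegral_mono_on ?_ ?_ hcomp.measurableSet
            fun x hx => sq_sub_nodalAffine_le hKs b hx (w x)
          · exact integrableOn_of_continuous (by fun_prop) hcomp
          · exact integrableOn_of_continuous (by fun_prop) hcomp
      _ = ∑ z ∈ K, ∫ x in body K, (w x - b z) ^ 2 := by
          refine integral_finsetSum _ fun z _ => ?_
          exact integrableOn_of_continuous (by fun_prop) hcomp
      _ ≤ ∑ z ∈ K, B * elementDiam K ^ 2 := by
          refine Finset.sum_le_sum fun z hz => ?_
          have := hB z hz
          rwa [deviation, div_le_iff₀ (by positivity)] at this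
      _ = (d + 1) * B * elementDiam K ^ 2 := by
          rw [Finset.sum_const, hKs.2, nsmul_eq_mul]; push_cast; ring
  set A := LinearMap.toContinuousLinearMap (nodalAffine b K).linear with hA
  have h2 : energy (fun x => w x - T.nodal b x) K ≤ 2 * energy w K + 8 * c ^ 2 * B := by
    have hgrad := sq_norm_linear_nodalAffine_le hKs hb hdiam hwc b hB
    calc energy (fun x => w x - T.nodal b x) K
        = ∫ x in body K, ‖fderiv ℝ w x - A‖ ^ 2 := by
          refine setIntegral_congr_ae hcomp.measurableSet ?_
          filter_upwards [ae_mem_interior_body K] with x hx hxK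
          have e1 := eventuallyEq_affine_of_mem_interior
            (v := T.nodal b) (fun y hy => nodal_eq b hK hy) (hx hxK)
          have e2 := (hasFDerivAt_affine (nodalAffine b K) x).congr_of_eventuallyEq e1
          rw [(((hw.differentiable one_ne_zero) x).hasFDerivAt.fun_sub e2).fderiv]
      _ ≤ ∫ x in body K, (2 * ‖fderiv ℝ w x‖ ^ 2 + 2 * ‖A‖ ^ 2) := by
          refine setIntegral_mono_on ?_ ?_ hcomp.measurableSet fun x _ => ?_
          · exact integrableOn_of_continuous (by fun_prop) hcomp
          · exact integrableOn_of_continuous (by fun_prop) hcomp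
          · have := norm_sub_le (fderiv ℝ w x) A
            nlinarith [norm_nonneg (fderiv ℝ w x - A), sq_nonneg (‖fderiv ℝ w x‖ - ‖A‖)]
      _ = 2 * energy w K + 2 * (volume.real (body K) * ‖A‖ ^ 2) := by
          rw [integral_add, integral_const_mul, setIntegral_const, smul_eq_mul, energy]
          · ring
          all_goals exact integrableOn_of_continuous (by fun_prop) hcomp
      _ ≤ _ := by linarith
  rw [localError]
  linarith

/-- Quasi-interpolation: a smooth function vanishing outside `Ω` is approximated in `V_h⁰`, with an
error controlled by its energy. -/
lemma exists_quasiInterpolant (hΩ : IsOpen Ω) (hd : 2 ≤ d) {c : ℝ} (hc : 0 < c)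
    (hT : T.HasInballs c) {w : Euc d → ℝ} (hw : ContDiff ℝ 1 w) (hw0 : ∀ x ∉ Ω, w x = 0) :
    ∃ v, T.IsPiecewiseAffine v ∧ ∑ K ∈ T.elements, localError (fun x => w x - v x) K ≤
      interpConst d c * ∑ K ∈ T.elements, energy w K := by
  choose b hb0 hb using fun z => exists_nodal_value hΩ hd hc hT hw hw0 z
  refine ⟨T.nodal b, isPiecewiseAffine_nodal hΩ hb0, ?_⟩
  have hC := starConst_nonneg d hc
  set C := starConst d c with hCdef
  have hloc : ∀ K ∈ T.elements, localError (fun x => w x - T.nodal b x) K ≤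
      ((d + 1) * C + 2 + 8 * c ^ 2 * C) * ∑ z ∈ K, T.starEnergy w z := by
    intro K hK
    have hS : ∀ z ∈ K, T.starEnergy w z ≤ ∑ z ∈ K, T.starEnergy w z := fun z hz =>
      Finset.single_le_sum (f := fun z => T.starEnergy w z) (fun z _ => starEnergy_nonneg w z) hz
    set S := ∑ z ∈ K, T.starEnergy w z
    have h1 := localError_sub_nodal_le (by omega) hT hw b hK (B := C * S) fun z hz =>
      (hb z K (mem_star.2 ⟨hK, hz⟩)).trans (mul_le_mul_of_nonneg_left (hS z hz) hC)
    obtain ⟨z, hz⟩ := (isSimplex hK).nonempty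
    have h2 := (energy_le_starEnergy (T := T) w (mem_star.2 ⟨hK, hz⟩)).trans (hS z hz)
    refine h1.trans ?_
    linarith
  refine (Finset.sum_le_sum hloc).trans ?_
  rw [← Finset.mul_sum, interpConst, mul_assoc (_ + _ + _)]
  exact mul_le_mul_of_nonneg_left (sum_sum_starEnergy_le (by omega) hc hT w) (by positivity)

end Triangulation

/-! ### Gradients and the divergence theorem for Lipschitz functions. -/

section Gradient

variable {d : ℕ}

lemma norm_gradient (w : Euc d → ℝ) (x : Euc d) : ‖∇ w x‖ = ‖fderiv ℝ w x‖ := by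
  rw [gradient, LinearIsometryEquiv.norm_map]

lemma measurable_gradient (w : Euc d → ℝ) : Measurable (∇ w) := by
  have h1 : Measurable (fderiv ℝ w) := measurable_fderiv ℝ w
  exact (InnerProductSpace.toDual ℝ (Euc d)).symm.continuous.measurable.comp h1

lemma inner_gradient (w : Euc d → ℝ) (x v : Euc d) : inner ℝ (∇ w x) v = fderiv ℝ w x v := by
  rw [gradient, InnerProductSpace.toDual_symm_apply]

lemma gradient_apply (w : Euc d → ℝ) (x : Euc d) (i : Fin d) :
    (∇ w x) i = fderiv ℝ w x (EuclideanSpace.single i 1) := by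
  rw [← inner_gradient, EuclideanSpace.inner_single_right]
  simp

lemma inner_eq_sum_fderiv (a : Euc d) (w : Euc d → ℝ) (x : Euc d) :
    inner ℝ a (∇ w x) = ∑ i, a i * fderiv ℝ w x (EuclideanSpace.single i 1) := by
  rw [PiLp.inner_apply]
  refine Finset.sum_congr rfl fun i _ => ?_
  rw [gradient_apply]
  simp [mul_comm]

/-- Integrate by parts against the constant 1; by Rademacher's theorem the line derivative is
`fderiv` almost everywhere. -/
lemma integral_fderiv_eq_zero {g : Euc d → ℝ} {C : ℝ≥0} (hg : LipschitzWith C g)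
    (hgc : HasCompactSupport g) (v : Euc d) : ∫ x, fderiv ℝ g x v = 0 := by
  have h := LipschitzWith.integral_lineDeriv_mul_eq (μ := volume)
    (LipschitzWith.const (1 : ℝ) : LipschitzWith 0 fun _ : Euc d => (1 : ℝ)) hg hgc v
  have h0 : ∀ x : Euc d, lineDeriv ℝ (fun _ : Euc d => (1 : ℝ)) x v = 0 := fun x => by
    simp [lineDeriv]
  simp only [h0, zero_mul, integral_zero, mul_one, lineDeriv_neg, integral_neg] at h
  have h1 : ∫ x, fderiv ℝ g x v = ∫ x, lineDeriv ℝ g x v := by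
    refine integral_congr_ae ?_
    filter_upwards [hg.ae_differentiableAt] with x hx
    rw [hx.lineDeriv_eq_fderiv]
  linarith

end Gradient

/-! ### Integrability of discrete functions and Green's formula. -/

namespace Triangulation

variable {d : ℕ} {Ω : Set (Euc d)} {T : Triangulation Ω} {K K' : Finset (Euc d)}

lemma exists_bound_of_continuous (T : Triangulation Ω) {w : Euc d → ℝ} (hw : Continuous w) :
    ∃ B, ∀ x ∈ closure Ω, |w x| ≤ B :=
  T.isCompact_closure.exists_bound_of_continuousOn hw.continuousOn

lemma isFiniteMeasure_restrict (T : Triangulation Ω) : IsFiniteMeasure (volume.restrict Ω) :=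
  ⟨by rw [Measure.restrict_apply_univ]; exact T.volume_lt_top⟩

lemma memLp_of_lipschitz (T : Triangulation Ω) (hΩ : IsOpen Ω) {w : Euc d → ℝ} {C : ℝ≥0}
    (hw : LipschitzWith C w) : MemLp w 2 (volume.restrict Ω) := by
  have := T.isFiniteMeasure_restrict
  obtain ⟨B, hB⟩ := T.exists_bound_of_continuous hw.continuous
  refine MemLp.of_bound hw.continuous.aestronglyMeasurable B ?_
  filter_upwards [ae_restrict_mem hΩ.measurableSet] with x hx
  exact hB x (subset_closure hx)

lemma memLp_gradient_of_lipschitz (T : Triangulation Ω) {w : Euc d → ℝ} {C : ℝ≥0}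
    (hw : LipschitzWith C w) : MemLp (∇ w) 2 (volume.restrict Ω) := by
  have := T.isFiniteMeasure_restrict
  refine MemLp.of_bound (measurable_gradient w).aestronglyMeasurable C
    (Eventually.of_forall fun x => ?_)
  rw [norm_gradient]
  exact norm_fderiv_le_of_lipschitz ℝ hw

lemma exists_affine_eventuallyEq (hΩ : IsOpen Ω) {s : Euc d → ℝ} (hs : s ∈ P1Space T)
    (hK : K ∈ T.elements) :
    ∃ a : Euc d →ᵃ[ℝ] ℝ, EqOn s a (body K ∩ Ω) ∧ ∀ x ∈ interior (body K), s =ᶠ[𝓝 x] a := by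
  obtain ⟨a, ha⟩ := hs.2 K hK
  refine ⟨a, ha, fun x hx => eventuallyEq_affine_of_mem_interior ha ?_⟩
  rw [interior_inter, hΩ.interior_eq]
  exact ⟨hx, interior_body_subset hΩ hK hx⟩

lemma ae_differentiableAt_of_mem_P1Space (hΩ : IsOpen Ω) {s : Euc d → ℝ} (hs : s ∈ P1Space T) :
    ∀ᵐ x : Euc d, x ∈ Ω → DifferentiableAt ℝ s x := by
  filter_upwards [T.ae_exists_interior] with x hx hxΩ
  obtain ⟨K, hK, hxK⟩ := hx hxΩ
  obtain ⟨a, -, ha⟩ := exists_affine_eventuallyEq hΩ hs hK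
  exact ((hasFDerivAt_affine a x).congr_of_eventuallyEq (ha x hxK)).differentiableAt

lemma memLp_of_mem_P1Space (hΩ : IsOpen Ω) {s : Euc d → ℝ} (hs : s ∈ P1Space T) :
    MemLp s 2 (volume.restrict Ω) := by
  have := T.isFiniteMeasure_restrict
  choose! a ha using hs.2
  have hb : ∀ K, ∃ B, ∀ x ∈ body K, |a K x| ≤ B := fun K =>
    (isCompact_body K).exists_bound_of_continuousOn
      (a K).continuous_of_finiteDimensional.continuousOn
  choose B hB using hb
  refine MemLp.of_bound (hs.1.aestronglyMeasurable hΩ.measurableSet)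
    (∑ K ∈ T.elements, |B K|) ?_
  filter_upwards [ae_restrict_mem hΩ.measurableSet] with x hx
  obtain ⟨K, hK, hxK⟩ := (mem_closure_iff (T := T)).1 (subset_closure hx)
  rw [ha K hK ⟨hxK, hx⟩]
  exact ((hB K x hxK).trans (le_abs_self _)).trans
    (Finset.single_le_sum (f := fun K => |B K|) (fun _ _ => abs_nonneg _) hK)

lemma memLp_gradient_of_mem_P1Space (hΩ : IsOpen Ω) {s : Euc d → ℝ} (hs : s ∈ P1Space T) :
    MemLp (∇ s) 2 (volume.restrict Ω) := by
  have := T.isFiniteMeasure_restrict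
  have h := fun K (hK : K ∈ T.elements) => exists_affine_eventuallyEq hΩ hs hK
  choose! a _ ha using h
  refine MemLp.of_bound (measurable_gradient s).aestronglyMeasurable
    (∑ K ∈ T.elements, ‖LinearMap.toContinuousLinearMap (a K).linear‖) ?_
  filter_upwards [ae_restrict_mem hΩ.measurableSet, ae_restrict_of_ae T.ae_exists_interior]
    with x hx hx'
  obtain ⟨K, hK, hxK⟩ := hx' hx
  rw [norm_gradient,
    ((hasFDerivAt_affine (a K) x).congr_of_eventuallyEq (ha K hK x hxK)).fderiv]
  exact Finset.single_le_sum (f := fun K => ‖LinearMap.toContinuousLinearMap (a K).linear‖)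
    (fun _ _ => norm_nonneg _) hK

lemma memLp_fderiv_apply {s : Euc d → ℝ} (h : MemLp (∇ s) 2 (volume.restrict Ω)) (v : Euc d) :
    MemLp (fun x => fderiv ℝ s x v) 2 (volume.restrict Ω) := by
  have := (innerSL ℝ v).comp_memLp' h
  refine this.congr_norm ?_ ?_
  · exact (measurable_fderiv_apply_const ℝ s v).aestronglyMeasurable
  · refine Eventually.of_forall fun x => ?_
    rw [← inner_gradient, real_inner_comm]
    rfl

lemma integrable_mul_of_memLp {μ : Measure (Euc d)} {f g : Euc d → ℝ} (hf : MemLp f 2 μ)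
    (hg : MemLp g 2 μ) : Integrable (fun x => f x * g x) μ :=
  hf.integrable_mul hg

lemma exists_lipschitzOnWith_mul {S : Set (Euc d)} (hS : IsCompact S) {f g : Euc d → ℝ} {A B : ℝ≥0}
    (hf : LipschitzWith A f) (hg : LipschitzWith B g) :
    ∃ C, LipschitzOnWith C (fun x => f x * g x) S := by
  obtain ⟨a, ha⟩ := hS.exists_bound_of_continuousOn hf.continuous.continuousOn
  obtain ⟨b, hb⟩ := hS.exists_bound_of_continuousOn hg.continuous.continuousOn
  refine ⟨(|a| * B + |b| * A).toNNReal, LipschitzOnWith.of_dist_le_mul fun x hx y hy => ?_⟩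
  have h1 := hf.dist_le_mul x y
  have h2 := hg.dist_le_mul x y
  rw [Real.dist_eq] at h1 h2 ⊢
  have e : f x * g x - f y * g y = f x * (g x - g y) + g y * (f x - f y) := by ring
  rw [e]
  refine (abs_add_le _ _).trans ?_
  rw [abs_mul, abs_mul]
  have h3 : |f x| ≤ |a| := (ha x hx).trans (le_abs_self a)
  have h4 : |g y| ≤ |b| := (hb y hy).trans (le_abs_self b)
  calc |f x| * |g x - g y| + |g y| * |f x - f y|
      ≤ |a| * (B * dist x y) + |b| * (A * dist x y) := by gcongr
    _ = _ := by rw [Real.coe_toNNReal _ (by positivity)]; ring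

lemma setIntegral_eq_integral_of_eq_zero (T : Triangulation Ω) (hΩ : IsOpen Ω) {g : Euc d → ℝ}
    (hg : ∀ x ∉ closure Ω, g x = 0) : ∫ x in Ω, g x = ∫ x, g x := by
  refine setIntegral_eq_integral_of_ae_compl_eq_zero ?_
  filter_upwards [T.ae_closure_imp_mem hΩ] with x hx hxΩ
  exact hg x fun h => hxΩ (hx h)

/-- Integration by parts for a function of `V_h` and a Lipschitz function vanishing outside `Ω`. -/
lemma setIntegral_mul_fderiv_eq_neg (hΩ : IsOpen Ω) {s w : Euc d → ℝ} (hs : s ∈ P1Space T)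
    {C : ℝ≥0} (hw : LipschitzWith C w) (hw0 : ∀ x ∉ Ω, w x = 0) (v : Euc d) :
    ∫ x in Ω, s x * fderiv ℝ w x v = -∫ x in Ω, fderiv ℝ s x v * w x := by
  -- `s` need not extend continuously to the boundary, but `w` vanishes outside `Ω`, so the product
  -- extended by zero is globally Lipschitz. Hence no interface or boundary terms appear.
  set g : Euc d → ℝ := Ω.indicator fun x => s x * w x with hg
  have hg0 : ∀ x ∉ Ω, g x = 0 := fun x hx => indicator_of_notMem hx _
  obtain ⟨D, hD⟩ : ∃ D, LipschitzWith D g := by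
    refine T.exists_lipschitzWith hΩ hg0 fun K hK => ?_
    obtain ⟨a, ha⟩ := hs.2 K hK
    obtain ⟨A, hA⟩ := exists_lipschitzWith_affine a
    obtain ⟨D, hD⟩ := exists_lipschitzOnWith_mul (isCompact_body K) hA hw
    have hga : ∀ x ∈ body K, g x = a x * w x := fun x hx => by
      by_cases hxΩ : x ∈ Ω
      · rw [hg, indicator_of_mem hxΩ, ha ⟨hx, hxΩ⟩]
      · rw [hg0 x hxΩ, hw0 x hxΩ, mul_zero]
    refine ⟨D, fun x hx y hy => ?_⟩
    rw [hga x hx, hga y hy]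
    exact hD hx hy
  have hgc : HasCompactSupport g := HasCompactSupport.intro T.isCompact_closure fun x hx =>
    hg0 x fun h => hx (subset_closure h)
  have h1 := integral_fderiv_eq_zero hD hgc v
  rw [← T.setIntegral_eq_integral_of_eq_zero hΩ (fun x hx => by
    have : g =ᶠ[𝓝 x] fun _ => 0 := by
      filter_upwards [isClosed_closure.isOpen_compl.mem_nhds hx] with y hy
      exact hg0 y fun h => hy (subset_closure h)
    rw [this.fderiv_eq]
    simp)] at h1
  have hW := memLp_of_lipschitz T hΩ hw
  have hDW := memLp_fderiv_apply (T.memLp_gradient_of_lipschitz hw) v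
  have hS := memLp_of_mem_P1Space hΩ hs
  have hDS := memLp_fderiv_apply (memLp_gradient_of_mem_P1Space hΩ hs) v
  have h2 : ∫ x in Ω, fderiv ℝ g x v = ∫ x in Ω, (s x * fderiv ℝ w x v + fderiv ℝ s x v * w x) := by
    refine setIntegral_congr_ae hΩ.measurableSet ?_
    filter_upwards [ae_differentiableAt_of_mem_P1Space hΩ hs, hw.ae_differentiableAt]
      with x hx hx' hxΩ
    have : g =ᶠ[𝓝 x] fun y => s y * w y := by
      filter_upwards [hΩ.mem_nhds hxΩ] with y hy
      exact indicator_of_mem hy _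
    rw [this.fderiv_eq, fderiv_fun_mul (hx hxΩ) hx']
    simp [mul_comm]
  rw [h2, integral_add (integrable_mul_of_memLp hS hDW) (integrable_mul_of_memLp hDS hW)] at h1
  linarith

lemma memLp_of_mem_recoverySpace (hΩ : IsOpen Ω) {σ : Euc d → Euc d} (hσ : σ ∈ RecoverySpace T) :
    MemLp σ 2 (volume.restrict Ω) := by
  have h1 : MemLp (fun x => ∑ i, (σ x i) • EuclideanSpace.single i (1 : ℝ)) 2
      (volume.restrict Ω) := by
    refine memLp_finsetSum _ fun i _ => ?_
    exact (ContinuousLinearMap.toSpanSingleton ℝ (EuclideanSpace.single i (1 : ℝ))).comp_memLp'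
      (memLp_of_mem_P1Space hΩ (hσ i))
  refine h1.congr_norm ?_ ?_
  · have : σ = fun x => ∑ i, (σ x i) • EuclideanSpace.single i (1 : ℝ) := by
      funext x; ext j; simp [Finset.sum_apply, Pi.single_apply]
    rw [this]
    exact h1.1
  · refine Eventually.of_forall fun x => ?_
    congr 1
    ext j
    simp [Finset.sum_apply, Pi.single_apply]

lemma memLp_divergence (hΩ : IsOpen Ω) {σ : Euc d → Euc d} (hσ : σ ∈ RecoverySpace T) :
    MemLp (divergence σ) 2 (volume.restrict Ω) := by
  unfold divergence
  exact memLp_finsetSum _ fun i _ =>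
    memLp_fderiv_apply (memLp_gradient_of_mem_P1Space hΩ (hσ i)) _

/-- Green's formula for recovered gradients. -/
lemma setIntegral_inner_gradient_eq_neg (hΩ : IsOpen Ω) {σ : Euc d → Euc d} {w : Euc d → ℝ}
    (hσ : σ ∈ RecoverySpace T) {C : ℝ≥0} (hw : LipschitzWith C w) (hw0 : ∀ x ∉ Ω, w x = 0) :
    ∫ x in Ω, inner ℝ (σ x) (∇ w x) = -∫ x in Ω, divergence σ x * w x := by
  have hW := memLp_of_lipschitz T hΩ hw
  have hDW := fun v => memLp_fderiv_apply (T.memLp_gradient_of_lipschitz hw) v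
  simp_rw [inner_eq_sum_fderiv, divergence, Finset.sum_mul]
  rw [integral_finsetSum _ fun i _ => integrable_mul_of_memLp (memLp_of_mem_P1Space hΩ (hσ i)) (hDW _),
    integral_finsetSum _ fun i _ =>
      integrable_mul_of_memLp
        (memLp_fderiv_apply (memLp_gradient_of_mem_P1Space hΩ (hσ i)) _) hW,
    ← Finset.sum_neg_distrib]
  exact Finset.sum_congr rfl fun i _ => setIntegral_mul_fderiv_eq_neg hΩ (hσ i) hw hw0 _

end Triangulation

/-! ### Mollification and soft thresholding. -/

section Mollification

variable {d : ℕ}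

lemma tendsto_eLpNorm_sub_of_bounded {α E : Type*} [MeasurableSpace α] {μ : Measure α}
    [IsFiniteMeasure μ] [NormedAddCommGroup E] {F : ℕ → α → E} {g : α → E}
    (hF : ∀ n, AEStronglyMeasurable (F n) μ) (hg : AEStronglyMeasurable g μ) {B : ℝ}
    (hB : ∀ n, ∀ᵐ x ∂μ, ‖F n x - g x‖ ≤ B)
    (hlim : ∀ᵐ x ∂μ, Tendsto (fun n => F n x) atTop (𝓝 (g x))) :
    Tendsto (fun n => eLpNorm (fun x => F n x - g x) 2 μ) atTop (𝓝 0) := by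
  simp_rw [eLpNorm_eq_lintegral_rpow_enorm_toReal (two_ne_zero) (ENNReal.ofNat_ne_top)]
  have h1 : Tendsto (fun n => ∫⁻ x, ‖F n x - g x‖ₑ ^ (2 : ENNReal).toReal ∂μ) atTop
      (𝓝 (∫⁻ _, 0 ∂μ)) := by
    refine tendsto_lintegral_of_dominated_convergence' (fun _ => ENNReal.ofReal B ^ (2 : ENNReal).toReal)
      (fun n => ((hF n).sub hg).enorm.pow_const _) (fun n => ?_) ?_ ?_
    · filter_upwards [hB n] with x hx
      gcongr
      rw [← ofReal_norm]
      exact ENNReal.ofReal_le_ofReal hx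
    · rw [lintegral_const]
      refine ENNReal.mul_ne_top ?_ (measure_ne_top _ _)
      exact ENNReal.rpow_ne_top_of_nonneg (by simp) ENNReal.ofReal_ne_top
    · filter_upwards [hlim] with x hx
      have h2 : Tendsto (fun n => ‖F n x - g x‖ₑ) atTop (𝓝 0) := by
        have := (hx.sub_const (g x)).enorm
        simpa using this
      have h3 := h2.ennrpow_const (2 : ENNReal).toReal
      simpa using h3
  rw [lintegral_zero] at h1
  have h2 := h1.ennrpow_const (1 / (2 : ENNReal).toReal)
  simpa using h2

/-- The last clause says that mollifying an affine function at most adds a constant, so its gradient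
is reproduced exactly. -/
lemma exists_mollification {g : Euc d → ℝ} {L : ℝ≥0} (hg : LipschitzWith L g) {δ : ℝ} (hδ : 0 < δ) :
    ∃ ψ : Euc d → ℝ, ContDiff ℝ ∞ ψ ∧ LipschitzWith L ψ ∧
      (∀ x, (∀ y ∈ Metric.ball x δ, g y = 0) → ψ x = 0) ∧ (∀ x, |ψ x - g x| ≤ L * δ) ∧
      ∀ (x : Euc d) (ρ : ℝ) (a : Euc d →ᵃ[ℝ] ℝ), δ < ρ → (∀ y ∈ Metric.ball x ρ, g y = a y) →
        ∃ k : ℝ, ψ =ᶠ[𝓝 x] fun y => a y + k := by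
  set φ : ContDiffBump (0 : Euc d) := ⟨δ / 2, δ, half_pos hδ, half_lt_self hδ⟩ with hφ
  set ψ : Euc d → ℝ := convolution (φ.normed volume) g (ContinuousLinearMap.lsmul ℝ ℝ) volume
    with hψ
  have hgc := hg.continuous
  have hφc : Continuous (φ.normed volume) := φ.continuous_normed
  have hφi : Integrable (φ.normed volume) volume := φ.integrable_normed
  have hdef : ∀ x, ψ x = ∫ t, φ.normed volume t * g (x - t) := fun x => rfl
  have hint : ∀ x, Integrable (fun t => φ.normed volume t * g (x - t)) volume := fun x =>
    (by fun_prop : Continuous fun t => φ.normed volume t * g (x - t)).integrable_of_hasCompactSupport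
      (φ.hasCompactSupport_normed.mul_right)
  have hsupp : ∀ t, t ∉ Metric.ball (0 : Euc d) δ → φ.normed volume t = 0 := fun t ht => by
    have h1 : Function.support (φ.normed volume) = Metric.ball (0 : Euc d) δ := φ.support_normed_eq
    rw [← h1] at ht
    exact Function.notMem_support.1 ht
  have hone : ∫ t, φ.normed volume t = 1 := φ.integral_normed
  refine ⟨ψ, ?_, ?_, ?_, ?_, ?_⟩
  · exact φ.hasCompactSupport_normed.contDiff_convolution_left _ φ.contDiff_normed
      hgc.locallyIntegrable
  · refine LipschitzWith.of_dist_le_mul fun x y => ?_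
    rw [dist_eq_norm, hdef, hdef, ← integral_sub (hint x) (hint y)]
    have h1 : ∫ t, φ.normed volume t * (L * dist x y) = L * dist x y := by
      rw [integral_mul_const, hone, one_mul]
    rw [← h1]
    refine norm_integral_le_of_norm_le (hφi.mul_const _) (Eventually.of_forall fun t => ?_)
    rw [← mul_sub, norm_mul, Real.norm_eq_abs, abs_of_nonneg (φ.nonneg_normed t)]
    refine mul_le_mul_of_nonneg_left ?_ (φ.nonneg_normed t)
    have := hg.dist_le_mul (x - t) (y - t)
    rwa [dist_sub_right, dist_eq_norm] at this
  · intro x hx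
    rw [hdef, ← integral_zero (Euc d) ℝ]
    congr 1
    funext t
    by_cases ht : t ∈ Metric.ball (0 : Euc d) δ
    · rw [hx (x - t) (by simpa [mem_ball_iff_norm] using ht), mul_zero]
    · rw [hsupp t ht, zero_mul]
  · intro x
    rw [← Real.dist_eq]
    refine φ.dist_normed_convolution_le hgc.aestronglyMeasurable fun y hy => ?_
    refine (hg.dist_le_mul y x).trans ?_
    gcongr
    exact (Metric.mem_ball.1 hy).le
  · intro x ρ a hρ ha
    have hlc : Continuous a.linear := a.linear.continuous_of_finiteDimensional
    refine ⟨-∫ t, φ.normed volume t * a.linear t, ?_⟩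
    filter_upwards [Metric.ball_mem_nhds x (sub_pos.2 hρ)] with y hy
    have h1 : ∀ t, φ.normed volume t * g (y - t) =
        φ.normed volume t * a y - φ.normed volume t * a.linear t := by
      intro t
      by_cases ht : t ∈ Metric.ball (0 : Euc d) δ
      · rw [ha (y - t) ?_]
        · have := a.linearMap_vsub y (y - t)
          rw [vsub_eq_sub, vsub_eq_sub, sub_sub_cancel] at this
          rw [this]; ring
        · rw [mem_ball_iff_norm] at hy ht ⊢
          calc ‖y - t - x‖ = ‖(y - x) - (t - 0)‖ := by congr 1; abel
            _ ≤ ‖y - x‖ + ‖t - 0‖ := norm_sub_le _ _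
            _ < ρ := by linarith
      · rw [hsupp t ht]; ring
    rw [hdef]
    simp_rw [h1]
    rw [integral_sub (hφi.mul_const _), integral_mul_const, hone]
    · ring
    · exact (by fun_prop : Continuous fun t =>
        φ.normed volume t * a.linear t).integrable_of_hasCompactSupport
          φ.hasCompactSupport_normed.mul_right

/-- Soft thresholding. -/
noncomputable def shrink (ε t : ℝ) : ℝ := t - max (-ε) (min t ε)

lemma shrink_of_abs_le {ε t : ℝ} (h : |t| ≤ ε) : shrink ε t = 0 := by
  obtain ⟨h1, h2⟩ := abs_le.1 h
  rw [shrink, min_eq_left h2, max_eq_right h1, sub_self]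

lemma shrink_of_le {ε t : ℝ} (hε : 0 ≤ ε) (h : ε ≤ t) : shrink ε t = t - ε := by
  rw [shrink, min_eq_right h, max_eq_right (by linarith)]

lemma shrink_of_le_neg {ε t : ℝ} (hε : 0 ≤ ε) (h : t ≤ -ε) : shrink ε t = t + ε := by
  rw [shrink, min_eq_left (by linarith), max_eq_left h, sub_neg_eq_add]

lemma abs_shrink_sub_le {ε : ℝ} (hε : 0 ≤ ε) (t : ℝ) : |shrink ε t - t| ≤ ε := by
  rw [shrink, sub_sub_cancel_left, abs_neg, abs_le]
  exact ⟨le_max_left _ _, max_le (by linarith) (min_le_right _ _)⟩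

lemma lipschitzWith_shrink {g : Euc d → ℝ} {L : ℝ≥0} (hg : LipschitzWith L g) (ε : ℝ) :
    LipschitzWith (L + L) fun x => shrink ε (g x) :=
  hg.sub ((hg.min_const ε).const_max (-ε))

lemma IsTestFunction.eq_zero {Ω : Set (Euc d)} {φ : Euc d → ℝ} (hφ : IsTestFunction Ω φ) {x : Euc d} (hx : x ∉ Ω) :
    φ x = 0 := image_eq_zero_of_notMem_tsupport fun h => hx (hφ.2.2 h)

lemma IsTestFunction.exists_lipschitzWith {Ω : Set (Euc d)} {φ : Euc d → ℝ} (hφ : IsTestFunction Ω φ) :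
    ∃ C, LipschitzWith C φ :=
  hφ.1.lipschitzWith_of_hasCompactSupport hφ.2.1 (by simp)

lemma integrable_smul_of_memLp {μ : Measure (Euc d)} {f : Euc d → ℝ} {g : Euc d → Euc d}
    (hf : MemLp f 2 μ) (hg : MemLp g 2 μ) : Integrable (fun x => f x • g x) μ :=
  memLp_one_iff_integrable.1 (hg.smul (r := 1) hf)

end Mollification

/-! ### Discrete functions belong to H¹₀. -/

namespace Triangulation

variable {d : ℕ} {Ω : Set (Euc d)} {T : Triangulation Ω} {K K' : Finset (Euc d)}

lemma volume_affine_eq_zero {a : Euc d →ᵃ[ℝ] ℝ} {x : Euc d} (h : a x ≠ 0) :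
    volume {y | a y = 0} = 0 := by
  have : {y | a y = 0} = ((AffineSubspace.mk' (0 : ℝ) ⊥).comap a : Set (Euc d)) := by
    ext y
    simp
  rw [this]
  refine Measure.addHaar_affineSubspace _ _ fun htop => h ?_
  have hx : x ∈ (AffineSubspace.mk' (0 : ℝ) ⊥).comap a := by rw [htop]; trivial
  simpa using hx

/-- Almost everywhere, a piecewise affine function is locally affine, and nonzero or locally zero. -/
lemma IsPiecewiseAffine.ae_locally {v : Euc d → ℝ} (hv : T.IsPiecewiseAffine v) :
    ∀ᵐ x : Euc d, x ∈ Ω → ∃ a : Euc d →ᵃ[ℝ] ℝ, v =ᶠ[𝓝 x] a ∧ (v x ≠ 0 ∨ ∀ y, a y = 0) := by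
  choose! a ha using hv.2
  have h0 : ∀ᵐ x : Euc d, ∀ K ∈ T.elements, a K x = 0 → ∀ y, a K y = 0 := by
    refine (eventually_all_finset T.elements).2 fun K _ => ?_
    by_cases h : ∀ y, a K y = 0
    · exact Eventually.of_forall fun _ _ => h
    · push Not at h
      obtain ⟨y, hy⟩ := h
      filter_upwards [measure_eq_zero_iff_ae_notMem.1 (volume_affine_eq_zero hy)] with x hx hx0
      exact absurd hx0 hx
  filter_upwards [h0, T.ae_exists_interior] with x hx hx' hxΩ
  obtain ⟨K, hK, hxK⟩ := hx' hxΩ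
  refine ⟨a K, eventuallyEq_affine_of_mem_interior (ha K hK) hxK, ?_⟩
  by_cases hv0 : v x = 0
  · exact Or.inr (hx K hK (by rw [← ha K hK (interior_subset hxK), hv0]))
  · exact Or.inl hv0

/-- Near a point with v x ≠ 0, thresholding below |v x| / 2 is a shift by ±ε; where `v` is locally
zero it does nothing. Either way the gradient is unchanged. -/
lemma exists_affine_shrink {v : Euc d → ℝ} (hvc : Continuous v) {x : Euc d} {a : Euc d →ᵃ[ℝ] ℝ}
    (ha : v =ᶠ[𝓝 x] a) (h0 : v x ≠ 0 ∨ ∀ y, a y = 0) :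
    ∃ ρ > 0, ∃ ε₀ > 0, ∀ ε ∈ Ioo 0 ε₀, ∃ k : ℝ, ∀ y ∈ Metric.ball x ρ,
      shrink ε (v y) = (a + AffineMap.const ℝ (Euc d) k) y := by
  rcases h0 with h0 | h0
  · rcases h0.lt_or_gt with hneg | hpos
    · have hev : ∀ᶠ y in 𝓝 x, v y < v x / 2 :=
        (hvc.tendsto x).eventually (gt_mem_nhds (by linarith))
      obtain ⟨ρ, hρ, hball⟩ := Metric.eventually_nhds_iff_ball.1 (ha.and hev)
      refine ⟨ρ, hρ, -(v x / 2), by linarith, fun ε hε => ⟨ε, fun y hy => ?_⟩⟩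
      obtain ⟨h1, h2⟩ := hball y hy
      rw [shrink_of_le_neg hε.1.le (by linarith [hε.2]), h1]
      rfl
    · have hev : ∀ᶠ y in 𝓝 x, v x / 2 < v y :=
        (hvc.tendsto x).eventually (lt_mem_nhds (by linarith))
      obtain ⟨ρ, hρ, hball⟩ := Metric.eventually_nhds_iff_ball.1 (ha.and hev)
      refine ⟨ρ, hρ, v x / 2, by linarith, fun ε hε => ⟨-ε, fun y hy => ?_⟩⟩
      obtain ⟨h1, h2⟩ := hball y hy
      rw [shrink_of_le hε.1.le (by linarith [hε.2]), h1]
      rfl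
  · obtain ⟨ρ, hρ, hball⟩ := Metric.eventually_nhds_iff_ball.1 ha
    refine ⟨ρ, hρ, 1, one_pos, fun ε hε => ⟨0, fun y hy => ?_⟩⟩
    have h1 : v y = a y := hball y hy
    rw [h1, h0 y, shrink_of_abs_le (by simpa using hε.1.le)]
    simp [h0 y]

/-- The set where |v| ≥ ε is a compact subset of `Ω`, because `v` vanishes outside. Thresholding
cuts the support down to it, which leaves room to mollify inside `Ω`. -/
lemma exists_testFunction_shrink (hΩ : IsOpen Ω) (hΩc : IsCompact (closure Ω)) {v : Euc d → ℝ} {L : ℝ≥0}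
    (hL : LipschitzWith L v) (h0 : ∀ x ∉ Ω, v x = 0) {ε : ℝ} (hε : 0 < ε) :
    ∃ δ ∈ Ioc 0 ε, ∃ ψ : Euc d → ℝ, IsTestFunction Ω ψ ∧ LipschitzWith (L + L) ψ ∧
      (∀ x, |ψ x - v x| ≤ (L + L) * ε + ε) ∧
      ∀ (x : Euc d) (ρ : ℝ) (a : Euc d →ᵃ[ℝ] ℝ), δ < ρ →
        (∀ y ∈ Metric.ball x ρ, shrink ε (v y) = a y) → ∃ k : ℝ, ψ =ᶠ[𝓝 x] fun y => a y + k := by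
  set S := {x | ε ≤ |v x|} with hS
  have hScl : IsClosed S := isClosed_le continuous_const hL.continuous.abs
  have hSΩ : S ⊆ Ω := fun x hx => by
    by_contra hn
    have h1 : ε ≤ |v x| := hx
    rw [h0 x hn, abs_zero] at h1
    linarith
  have hSc : IsCompact S := hΩc.of_isClosed_subset hScl (hSΩ.trans subset_closure)
  obtain ⟨δ₀, hδ₀, hthick⟩ := hSc.exists_cthickening_subset_open hΩ hSΩ
  obtain ⟨ψ, hψs, hψL, hψ0, hψv, hψa⟩ :=
    exists_mollification (lipschitzWith_shrink hL ε) (lt_min hδ₀ hε)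
  refine ⟨min δ₀ ε, ⟨lt_min hδ₀ hε, min_le_right _ _⟩, ψ, ?_, hψL, fun x => ?_, hψa⟩
  · have hsupp : tsupport ψ ⊆ Metric.cthickening δ₀ S := by
      refine closure_minimal (fun x hx => ?_) Metric.isClosed_cthickening
      have h1 : ¬ ∀ y ∈ Metric.ball x (min δ₀ ε), shrink ε (v y) = 0 := fun h => hx (hψ0 x h)
      push Not at h1
      obtain ⟨y, hy, hyv⟩ := h1
      have hyS : y ∈ S := by
        by_contra hn
        exact hyv (shrink_of_abs_le (not_le.1 hn).le)
      refine Metric.thickening_subset_cthickening _ _ (Metric.mem_thickening_iff.2 ⟨y, hyS, ?_⟩)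
      rw [dist_comm]
      exact (Metric.mem_ball.1 hy).trans_le (min_le_left _ _)
    have hsΩ := hsupp.trans hthick
    exact ⟨hψs, hΩc.of_isClosed_subset (isClosed_tsupport ψ) (hsΩ.trans subset_closure), hsΩ⟩
  · calc |ψ x - v x| = |(ψ x - shrink ε (v x)) + (shrink ε (v x) - v x)| := by ring_nf
      _ ≤ |ψ x - shrink ε (v x)| + |shrink ε (v x) - v x| := abs_add_le _ _
      _ ≤ (L + L) * min δ₀ ε + ε := by
        have := hψv x
        push_cast at this
        exact add_le_add this (abs_shrink_sub_le hε.le _)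
      _ ≤ (L + L) * ε + ε := by gcongr; exact min_le_right _ _

/-- The functions of `V_h⁰`, extended by zero, belong to `H¹₀(Ω)`. -/
lemma IsPiecewiseAffine.memH10 (hΩ : IsOpen Ω) {v : Euc d → ℝ} (hv : T.IsPiecewiseAffine v) :
    MemH10 Ω v (∇ v) := by
  obtain ⟨L, hL⟩ := hv.exists_lipschitzWith hΩ
  have hfin := T.isFiniteMeasure_restrict
  refine ⟨⟨T.memLp_of_lipschitz hΩ hL, T.memLp_gradient_of_lipschitz hL, fun φ hφ => ?_⟩, ?_⟩
  · obtain ⟨C, hC⟩ := hφ.exists_lipschitzWith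
    have hvL := T.memLp_of_lipschitz hΩ hL
    have hφL := T.memLp_of_lipschitz hΩ hC
    have hvG := T.memLp_gradient_of_lipschitz hL
    have hφG := T.memLp_gradient_of_lipschitz hC
    refine ext_inner_left ℝ fun e => ?_
    rw [inner_neg_right, ← integral_inner (integrable_smul_of_memLp hvL hφG),
      ← integral_inner (integrable_smul_of_memLp hφL hvG)]
    simp only [real_inner_comm _ e, real_inner_smul_left, inner_gradient]
    rw [setIntegral_mul_fderiv_eq_neg hΩ (hv.mem_P1Space0 hΩ).1 hC
      (fun x hx => hφ.eq_zero hx) e]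
    simp only [mul_comm]
  · have hpos : ∀ n : ℕ, (0 : ℝ) < 1 / ((n : ℝ) + 1) := fun n => by positivity
    choose δ hδ ψ hψ hψL hψv hψa using fun n => exists_testFunction_shrink hΩ T.isCompact_closure hL hv.1 (hpos n)
    have hε : Tendsto (fun n : ℕ => 1 / ((n : ℝ) + 1)) atTop (𝓝 0) :=
      tendsto_one_div_add_atTop_nhds_zero_nat
    refine ⟨ψ, hψ, ?_, ?_⟩
    · refine tendsto_eLpNorm_sub_of_bounded (B := (L + L) * 1 + 1)
        (fun n => (hψ n).1.continuous.aestronglyMeasurable)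
        hL.continuous.aestronglyMeasurable (fun n => Eventually.of_forall fun x => ?_)
        (Eventually.of_forall fun x => ?_)
      · refine (hψv n x).trans ?_
        have : 1 / ((n : ℝ) + 1) ≤ 1 := by
          rw [div_le_one (by positivity)]; linarith [(Nat.cast_nonneg n : (0 : ℝ) ≤ n)]
        gcongr
      · rw [tendsto_iff_dist_tendsto_zero]
        refine squeeze_zero (fun _ => dist_nonneg) (fun n => hψv n x) ?_
        simpa using (hε.const_mul ((L : ℝ) + L)).add hε
    -- At almost every point the gradients of `ψ n` are eventually equal to that of `v`, and they
    -- are uniformly bounded, so dominated convergence applies.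
    · refine tendsto_eLpNorm_sub_of_bounded (B := (L + L) + L)
        (fun n => (measurable_gradient _).aestronglyMeasurable)
        (measurable_gradient _).aestronglyMeasurable (fun n => Eventually.of_forall fun x => ?_) ?_
      · refine (norm_sub_le _ _).trans ?_
        rw [norm_gradient, norm_gradient]
        exact add_le_add (norm_fderiv_le_of_lipschitz ℝ (hψL n)) (norm_fderiv_le_of_lipschitz ℝ hL)
      · filter_upwards [ae_restrict_mem hΩ.measurableSet, ae_restrict_of_ae hv.ae_locally]
          with x hxΩ hx
        obtain ⟨a, ha, h0⟩ := hx hxΩ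
        obtain ⟨ρ, hρ, ε₀, hε₀, hk⟩ := exists_affine_shrink hL.continuous ha h0
        refine tendsto_const_nhds.congr' ?_
        filter_upwards [hε.eventually (gt_mem_nhds hρ), hε.eventually (gt_mem_nhds hε₀)]
          with n hn1 hn2
        obtain ⟨k, hk⟩ := hk _ ⟨hpos n, hn2⟩
        obtain ⟨k', hk'⟩ := hψa n x ρ _ ((hδ n).2.trans_lt hn1) hk
        have h1 := (hasFDerivAt_affine a x).congr_of_eventuallyEq ha
        have h2 : HasFDerivAt (ψ n) (LinearMap.toContinuousLinearMap a.linear) x := by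
          refine (((hasFDerivAt_affine a x).add_const k).add_const k').congr_of_eventuallyEq ?_
          filter_upwards [hk'] with y hy
          rw [hy]; rfl
        rw [gradient, gradient, h1.fderiv, h2.fderiv]

end Triangulation

/-! ### Limits of L² inner products and norms. -/

section L2

variable {α E : Type*} [MeasurableSpace α] {μ : Measure α} [NormedAddCommGroup E]

lemma tendsto_toLp_of_eLpNorm {F : ℕ → α → E} {f : α → E} (hF : ∀ n, MemLp (F n) 2 μ)
    (hf : MemLp f 2 μ) (h : Tendsto (fun n => eLpNorm (fun x => F n x - f x) 2 μ) atTop (𝓝 0)) :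
    Tendsto (fun n => (hF n).toLp (F n)) atTop (𝓝 (hf.toLp f)) :=
  (Lp.tendsto_Lp_iff_tendsto_eLpNorm'' F hF f hf).2 h

lemma tendsto_eLpNorm_sub_sub {F H : ℕ → α → E} {f h : α → E} (hF : ∀ n, MemLp (F n) 2 μ)
    (hH : ∀ n, MemLp (H n) 2 μ) (hf : MemLp f 2 μ) (hh : MemLp h 2 μ)
    (h1 : Tendsto (fun n => eLpNorm (fun x => F n x - f x) 2 μ) atTop (𝓝 0))
    (h2 : Tendsto (fun n => eLpNorm (fun x => H n x - h x) 2 μ) atTop (𝓝 0)) :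
    Tendsto (fun n => eLpNorm (fun x => (F n x - H n x) - (f x - h x)) 2 μ) atTop (𝓝 0) := by
  refine tendsto_of_tendsto_of_tendsto_of_le_of_le tendsto_const_nhds
    (by simpa using h1.add h2) (fun _ => zero_le) fun n => ?_
  have e : (fun x => (F n x - H n x) - (f x - h x)) =
      (fun x => F n x - f x) - fun x => H n x - h x := by
    funext x; simp only [Pi.sub_apply]; abel
  simp only [e]
  exact eLpNorm_sub_le ((hF n).sub hf).1 ((hH n).sub hh).1 (by norm_num)

variable [InnerProductSpace ℝ E]

lemma integrable_inner_of_memLp {f g : α → E} (hf : MemLp f 2 μ) (hg : MemLp g 2 μ) :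
    Integrable (fun x => (inner ℝ (f x) (g x) : ℝ)) μ := by
  refine (L2.integrable_inner (𝕜 := ℝ) (hf.toLp f) (hg.toLp g)).congr ?_
  filter_upwards [hf.coeFn_toLp, hg.coeFn_toLp] with x h1 h2
  rw [h1, h2]

lemma inner_toLp_eq_integral {f g : α → E} (hf : MemLp f 2 μ) (hg : MemLp g 2 μ) :
    (inner ℝ (hf.toLp f) (hg.toLp g) : ℝ) = ∫ x, inner ℝ (f x) (g x) ∂μ := by
  rw [L2.inner_def]
  refine integral_congr_ae ?_
  filter_upwards [hf.coeFn_toLp, hg.coeFn_toLp] with x h1 h2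
  rw [h1, h2]

lemma tendsto_integral_inner {F : ℕ → α → E} {f g : α → E} (hF : ∀ n, MemLp (F n) 2 μ)
    (hf : MemLp f 2 μ) (hg : MemLp g 2 μ)
    (h : Tendsto (fun n => eLpNorm (fun x => F n x - f x) 2 μ) atTop (𝓝 0)) :
    Tendsto (fun n => ∫ x, (inner ℝ (g x) (F n x) : ℝ) ∂μ) atTop
      (𝓝 (∫ x, inner ℝ (g x) (f x) ∂μ)) := by
  simp_rw [← inner_toLp_eq_integral hg hf, ← inner_toLp_eq_integral hg (hF _)]
  exact tendsto_const_nhds.inner (tendsto_toLp_of_eLpNorm hF hf h)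

lemma tendsto_integral_sq_norm {F : ℕ → α → E} {f : α → E} (hF : ∀ n, MemLp (F n) 2 μ)
    (hf : MemLp f 2 μ)
    (h : Tendsto (fun n => eLpNorm (fun x => F n x - f x) 2 μ) atTop (𝓝 0)) :
    Tendsto (fun n => ∫ x, ‖F n x‖ ^ 2 ∂μ) atTop (𝓝 (∫ x, ‖f x‖ ^ 2 ∂μ)) := by
  simp_rw [← real_inner_self_eq_norm_sq, ← inner_toLp_eq_integral hf hf,
    ← inner_toLp_eq_integral (hF _) (hF _)]
  exact (tendsto_toLp_of_eLpNorm hF hf h).inner (tendsto_toLp_of_eLpNorm hF hf h)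

lemma integrable_sq_norm_of_memLp {f : α → E} (hf : MemLp f 2 μ) :
    Integrable (fun x => ‖f x‖ ^ 2) μ := by
  simpa only [real_inner_self_eq_norm_sq] using integrable_inner_of_memLp hf hf

end L2

lemma IsTestFunction.sub {d : ℕ} {Ω : Set (Euc d)} {φ ψ : Euc d → ℝ} (hφ : IsTestFunction Ω φ)
    (hψ : IsTestFunction Ω ψ) : IsTestFunction Ω fun x => φ x - ψ x := by
  have hs : tsupport (fun x => φ x - ψ x) ⊆ tsupport φ ∪ tsupport ψ := by
    rw [tsupport, tsupport, tsupport, ← closure_union]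
    exact closure_mono (Function.support_sub φ ψ)
  exact ⟨hφ.1.sub hψ.1, (hφ.2.1.union hψ.2.1).of_isClosed_subset (isClosed_tsupport _) hs,
    hs.trans (union_subset hφ.2.2 hψ.2.2)⟩

/-! ### The residual bound and the error estimate. -/

namespace Triangulation

variable {d : ℕ} {Ω : Set (Euc d)} {T : Triangulation Ω}

/-- Writing a b = (h a)(b / h) puts the weights where the estimator and `localError` have them. -/
lemma local_young {a b x y h lam : ℝ} (hh : 0 < h) (hl : 0 < lam) :
    a * b + x * y ≤ lam / 2 * (x ^ 2 + h ^ 2 * a ^ 2) +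
      1 / (2 * lam) * (b ^ 2 / h ^ 2 + y ^ 2) := by
  have key : ∀ p q : ℝ, p * q ≤ lam / 2 * p ^ 2 + 1 / (2 * lam) * q ^ 2 := by
    intro p q
    have : lam / 2 * p ^ 2 + 1 / (2 * lam) * q ^ 2 - p * q = (lam * p - q) ^ 2 / (2 * lam) := by
      field_simp
      ring
    have h2 : 0 ≤ (lam * p - q) ^ 2 / (2 * lam) := by positivity
    linarith
  have h1 := key (h * a) (b / h)
  have h2 := key x y
  have e1 : h * a * (b / h) = a * b := by field_simp
  rw [e1, mul_pow, div_pow] at h1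
  linarith

/-- The contribution of one element to the residual is bounded by the estimator. -/
lemma setIntegral_body_le {f : Euc d → ℝ} {uh w : Euc d → ℝ} {σ : Euc d → Euc d}
    {K : Finset (Euc d)} (h0 : 0 < elementDiam K) {lam : ℝ} (hl : 0 < lam)
    (hf : MemLp (fun x => f x + divergence σ x) 2 (volume.restrict (body K)))
    (hσ : MemLp (fun x => σ x - ∇ uh x) 2 (volume.restrict (body K)))
    (hw : MemLp w 2 (volume.restrict (body K))) (hDw : MemLp (∇ w) 2 (volume.restrict (body K))) :
    ∫ x in body K, ((f x + divergence σ x) * w x + inner ℝ (σ x - ∇ uh x) (∇ w x)) ≤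
      lam / 2 * estimatorSq f uh σ K + 1 / (2 * lam) * localError w K := by
  have i1 : Integrable (fun x => (f x + divergence σ x) ^ 2) (volume.restrict (body K)) :=
    hf.integrable_sq
  have i2 := integrable_sq_norm_of_memLp hσ
  have i3 : Integrable (fun x => w x ^ 2) (volume.restrict (body K)) := hw.integrable_sq
  have i4 := integrable_sq_norm_of_memLp hDw
  have e : lam / 2 * estimatorSq f uh σ K + 1 / (2 * lam) * localError w K =
      ∫ x in body K, (lam / 2 * (‖σ x - ∇ uh x‖ ^ 2 + elementDiam K ^ 2 *
        (f x + divergence σ x) ^ 2) +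
        1 / (2 * lam) * (w x ^ 2 / elementDiam K ^ 2 + ‖∇ w x‖ ^ 2)) := by
    rw [integral_add, integral_const_mul, integral_const_mul, integral_add i2 (i1.const_mul _),
      integral_add (i3.div_const _) i4, integral_const_mul, integral_div, estimatorSq, localError,
      deviation, energy]
    · simp only [sub_zero, norm_gradient]
    · exact (i2.add (i1.const_mul _)).const_mul _
    · exact ((i3.div_const _).add i4).const_mul _
  rw [e]
  refine integral_mono ((integrable_mul_of_memLp hf hw).add (integrable_inner_of_memLp hσ hDw))
    (((i2.add (i1.const_mul _)).const_mul _).add (((i3.div_const _).add i4).const_mul _))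
    fun x => ?_
  refine le_trans ?_ (local_young h0 hl)
  have := real_inner_le_norm (σ x - ∇ uh x) (∇ w x)
  simp only
  linarith

/-- The residual of the discrete solution, applied to a test function. -/
lemma residual_le (hΩ : IsOpen Ω) (hd : 2 ≤ d) {c : ℝ} (hc : 0 < c)
    (hT : T.HasInballs c) {f : Euc d → ℝ} (hf : MemLp f 2 (volume.restrict Ω)) {uh : Euc d → ℝ}
    (huh : IsDiscreteSolution T f uh) {σ : Euc d → Euc d} (hσ : σ ∈ RecoverySpace T)
    {e : Euc d → ℝ} (he : IsTestFunction Ω e) {lam : ℝ} (hl : 0 < lam) :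
    (∫ x in Ω, f x * e x) - ∫ x in Ω, inner ℝ (∇ uh x) (∇ e x) ≤
      lam / 2 * ∑ K ∈ T.elements, estimatorSq f uh σ K +
        1 / (2 * lam) * (interpConst d c * ∫ x in Ω, ‖∇ e x‖ ^ 2) := by
  obtain ⟨v, hv, hverr⟩ := exists_quasiInterpolant hΩ hd hc hT
    (he.1.of_le (by exact_mod_cast le_top)) (fun x hx => he.eq_zero hx)
  obtain ⟨Ce, hCe⟩ := he.exists_lipschitzWith
  obtain ⟨Cv, hCv⟩ := hv.exists_lipschitzWith hΩ
  have horth := huh.2 v (hv.mem_P1Space0 hΩ)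
  set w : Euc d → ℝ := fun x => e x - v x with hw
  have hCw : LipschitzWith (Ce + Cv) w := hCe.sub hCv
  have hw0 : ∀ x ∉ Ω, w x = 0 := fun x hx => by
    simp only [hw, he.eq_zero hx, hv.1 x hx, sub_zero]
  have hgreen := setIntegral_inner_gradient_eq_neg hΩ hσ hCw hw0
  have mσ := memLp_of_mem_recoverySpace hΩ hσ
  have mdiv := memLp_divergence hΩ hσ
  have mDu := memLp_gradient_of_mem_P1Space hΩ huh.1.1
  have me := T.memLp_of_lipschitz hΩ hCe
  have mv := T.memLp_of_lipschitz hΩ hCv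
  have mw := T.memLp_of_lipschitz hΩ hCw
  have mDe := T.memLp_gradient_of_lipschitz hCe
  have mDv := T.memLp_gradient_of_lipschitz hCv
  have mDw := T.memLp_gradient_of_lipschitz hCw
  have hgrad : ∀ᵐ x ∂(volume.restrict Ω), ∇ w x = ∇ e x - ∇ v x := by
    filter_upwards [ae_restrict_of_ae hCe.ae_differentiableAt,
      ae_restrict_of_ae hCv.ae_differentiableAt] with x h1 h2
    rw [gradient, gradient, gradient, ← map_sub, hw, fderiv_fun_sub h1 h2]
  have e1 : ∫ x in Ω, f x * w x = (∫ x in Ω, f x * e x) - ∫ x in Ω, f x * v x := by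
    simp only [hw, mul_sub]
    exact integral_sub (integrable_mul_of_memLp hf me) (integrable_mul_of_memLp hf mv)
  have e2 : ∫ x in Ω, inner ℝ (∇ uh x) (∇ w x) =
      (∫ x in Ω, inner ℝ (∇ uh x) (∇ e x)) - ∫ x in Ω, inner ℝ (∇ uh x) (∇ v x) := by
    rw [← integral_sub (integrable_inner_of_memLp mDu mDe) (integrable_inner_of_memLp mDu mDv)]
    refine integral_congr_ae ?_
    filter_upwards [hgrad] with x hx
    rw [hx, inner_sub_right]
  -- Galerkin orthogonality replaces `e` by `w`; Green's formula allows the insertion of div σ · w +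
  -- σ · ∇w, whose integral is zero.
  have e3 : (∫ x in Ω, f x * e x) - ∫ x in Ω, inner ℝ (∇ uh x) (∇ e x) =
      ∫ x in Ω, ((f x + divergence σ x) * w x + inner ℝ (σ x - ∇ uh x) (∇ w x)) := by
    have : ∀ x, (f x + divergence σ x) * w x + inner ℝ (σ x - ∇ uh x) (∇ w x) =
        (f x * w x + divergence σ x * w x) +
          (inner ℝ (σ x) (∇ w x) - inner ℝ (∇ uh x) (∇ w x)) := fun x => by
      rw [inner_sub_left]; ring
    simp_rw [this]
    rw [integral_add ((integrable_mul_of_memLp hf mw).fun_add (integrable_mul_of_memLp mdiv mw))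
      ((integrable_inner_of_memLp mσ mDw).sub' (integrable_inner_of_memLp mDu mDw)),
      integral_add (integrable_mul_of_memLp hf mw) (integrable_mul_of_memLp mdiv mw),
      integral_sub (integrable_inner_of_memLp mσ mDw) (integrable_inner_of_memLp mDu mDw)]
    linarith
  have mfd : MemLp (fun x => f x + divergence σ x) 2 (volume.restrict Ω) := hf.add mdiv
  have msd : MemLp (fun x => σ x - ∇ uh x) 2 (volume.restrict Ω) := mσ.sub mDu
  rw [e3, T.integral_eq_sum hΩ ((integrable_mul_of_memLp mfd mw).fun_add
    (integrable_inner_of_memLp msd mDw))]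
  have hE : ∫ x in Ω, ‖∇ e x‖ ^ 2 = ∑ K ∈ T.elements, energy e K := by
    rw [T.integral_eq_sum hΩ (integrable_sq_norm_of_memLp mDe)]
    simp only [norm_gradient, energy]
  rw [hE]
  calc _ ≤ ∑ K ∈ T.elements,
        (lam / 2 * estimatorSq f uh σ K + 1 / (2 * lam) * localError w K) := by
        refine Finset.sum_le_sum fun K hK => ?_
        have hle := restrict_body_le (T := T) hΩ hK
        exact setIntegral_body_le ((isSimplex hK).elementDiam_pos (by omega)) hl
          (mfd.mono_measure hle) (msd.mono_measure hle) (mw.mono_measure hle)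
          (mDw.mono_measure hle)
    _ = lam / 2 * ∑ K ∈ T.elements, estimatorSq f uh σ K +
        1 / (2 * lam) * ∑ K ∈ T.elements, localError w K := by
        rw [Finset.sum_add_distrib, Finset.mul_sum, Finset.mul_sum]
    _ ≤ _ := by gcongr

/-- The a posteriori error estimate with explicit constant. -/
lemma error_le (hΩ : IsOpen Ω) (hd : 2 ≤ d) {c : ℝ} (hc : 0 < c)
    (hT : T.HasInballs c) {f : Euc d → ℝ} (hf : MemLp f 2 (volume.restrict Ω))
    {u : Euc d → ℝ} {Du : Euc d → Euc d} (hu : IsWeakSolution Ω f u Du) {uh : Euc d → ℝ}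
    (huh : IsDiscreteSolution T f uh) {σ : Euc d → Euc d} (hσ : σ ∈ RecoverySpace T) :
    ∫ x in Ω, ‖Du x - ∇ uh x‖ ^ 2 ≤
      (|interpConst d c| + 1) * ∑ K ∈ T.elements, estimatorSq f uh σ K := by
  -- Only the values of `uh` on `Ω` are constrained, so the extension by zero serves as its
  -- representative in H¹₀.
  have hP := isPiecewiseAffine_indicator hΩ huh.1
  have hH := hP.memH10 hΩ
  set v := Ω.indicator uh with hv
  have hvuh : ∀ x ∈ Ω, v x = uh x := fun x hx => indicator_of_mem hx uh
  have hDv : ∀ x ∈ Ω, ∇ v x = ∇ uh x := fun x hx => by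
    have : v =ᶠ[𝓝 x] uh := by
      filter_upwards [hΩ.mem_nhds hx] with y hy
      exact hvuh y hy
    rw [gradient, gradient, this.fderiv_eq]
  obtain ⟨φ, hφ, hφ1, hφ2⟩ := hu.1.2
  obtain ⟨ψ, hψ, hψ1, hψ2⟩ := hH.2
  have mu := hu.1.1.1
  have mDu := hu.1.1.2.1
  have mv := hH.1.1
  have mDv := hH.1.2.1
  have mT : ∀ g, IsTestFunction Ω g →
      MemLp g 2 (volume.restrict Ω) ∧ MemLp (∇ g) 2 (volume.restrict Ω) := fun g hg => by
    obtain ⟨C, hC⟩ := hg.exists_lipschitzWith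
    exact ⟨T.memLp_of_lipschitz hΩ hC, T.memLp_gradient_of_lipschitz hC⟩
  -- Test functions converging to u - u_h. The interpolants of `e n` need not converge: only the
  -- resulting inequality passes to the limit.
  set e : ℕ → Euc d → ℝ := fun n x => φ n x - ψ n x with he
  have hgrad : ∀ n x, ∇ (e n) x = ∇ (φ n) x - ∇ (ψ n) x := fun n x => by
    rw [gradient, gradient, gradient, ← map_sub, he, fderiv_fun_sub
      ((hφ n).1.differentiable (by simp) x) ((hψ n).1.differentiable (by simp) x)]
  have me : ∀ n, MemLp (e n) 2 (volume.restrict Ω) := fun n => (mT _ ((hφ n).sub (hψ n))).1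
  have mDe : ∀ n, MemLp (∇ (e n)) 2 (volume.restrict Ω) := fun n =>
    (mT _ ((hφ n).sub (hψ n))).2
  have lim1 := tendsto_eLpNorm_sub_sub (fun n => (mT _ (hφ n)).1) (fun n => (mT _ (hψ n)).1) mu mv
    hφ1 hψ1
  have lim2 := tendsto_eLpNorm_sub_sub (fun n => (mT _ (hφ n)).2) (fun n => (mT _ (hψ n)).2) mDu mDv
    hφ2 hψ2
  simp only [← hgrad] at lim2
  have muv : MemLp (fun x => u x - v x) 2 (volume.restrict Ω) := mu.sub mv
  have mDuv : MemLp (fun x => Du x - ∇ v x) 2 (volume.restrict Ω) := mDu.sub mDv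
  have hmul : ∀ a b : ℝ, (inner ℝ a b : ℝ) = a * b := fun a b => by simp [mul_comm]
  have t1 := tendsto_integral_inner me muv hf lim1
  have t2 := tendsto_integral_inner mDe mDuv mDv lim2
  have t3 := tendsto_integral_sq_norm mDe mDuv lim2
  simp only [hmul] at t1
  -- With Young parameter `C`, positive and at least `interpConst d c`, the gradient term is at most
  -- half the squared error and is absorbed.
  set C := |interpConst d c| + 1 with hC
  have hCpos : 0 < C := by positivity
  have hDvInt : ∀ n, ∫ x in Ω, inner ℝ (∇ v x) (∇ (e n) x) =
      ∫ x in Ω, inner ℝ (∇ uh x) (∇ (e n) x) := fun n =>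
    setIntegral_congr_fun hΩ.measurableSet fun x hx => by simp only [hDv x hx]
  have hres := fun n => residual_le hΩ hd hc hT hf huh hσ ((hφ n).sub (hψ n)) hCpos
  have hlim := le_of_tendsto_of_tendsto' (t1.sub t2)
    (tendsto_const_nhds.add ((t3.const_mul (interpConst d c)).const_mul (1 / (2 * C)))) fun n => by
      rw [hDvInt n]; exact hres n
  have w1 := hu.2 u Du hu.1
  have w2 := hu.2 v (∇ v) hH
  have w3 : ∫ x in Ω, inner ℝ (∇ v x) (∇ v x) = ∫ x in Ω, f x * v x := by
    have h1 := huh.2 uh huh.1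
    have h2 : ∫ x in Ω, inner ℝ (∇ v x) (∇ v x) = ∫ x in Ω, inner ℝ (∇ uh x) (∇ uh x) :=
      setIntegral_congr_fun hΩ.measurableSet fun x hx => by simp only [hDv x hx]
    have h3 : ∫ x in Ω, f x * v x = ∫ x in Ω, f x * uh x :=
      setIntegral_congr_fun hΩ.measurableSet fun x hx => by simp only [hvuh x hx]
    rw [h2, h3, h1]
  have w2' : ∫ x in Ω, inner ℝ (∇ v x) (Du x) = ∫ x in Ω, f x * v x := by
    rw [← w2]; exact integral_congr_ae (Eventually.of_forall fun x => real_inner_comm _ _)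
  have a1 : ∫ x in Ω, f x * (u x - v x) = (∫ x in Ω, f x * u x) - ∫ x in Ω, f x * v x := by
    simp only [mul_sub]
    exact integral_sub (integrable_mul_of_memLp hf mu) (integrable_mul_of_memLp hf mv)
  -- Galerkin orthogonality tested with the discrete solution itself.
  have a2 : ∫ x in Ω, inner ℝ (∇ v x) (Du x - ∇ v x) = 0 := by
    simp only [inner_sub_right]
    rw [integral_sub (integrable_inner_of_memLp mDv mDu) (integrable_inner_of_memLp mDv mDv),
      w2', w3, sub_self]
  have a3 : ∫ x in Ω, ‖Du x - ∇ v x‖ ^ 2 = (∫ x in Ω, f x * u x) - ∫ x in Ω, f x * v x := by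
    have : ∀ x, ‖Du x - ∇ v x‖ ^ 2 = (inner ℝ (Du x) (Du x) - inner ℝ (Du x) (∇ v x)) -
        inner ℝ (∇ v x) (Du x - ∇ v x) := fun x => by
      rw [← real_inner_self_eq_norm_sq, inner_sub_left, inner_sub_right (Du x)]
    simp_rw [this]
    rw [integral_sub ((integrable_inner_of_memLp mDu mDu).sub' (integrable_inner_of_memLp mDu mDv))
      (integrable_inner_of_memLp mDv mDuv), integral_sub (integrable_inner_of_memLp mDu mDu)
      (integrable_inner_of_memLp mDu mDv), a2, w1, w2, sub_zero]
  have a4 : ∫ x in Ω, ‖Du x - ∇ v x‖ ^ 2 = ∫ x in Ω, ‖Du x - ∇ uh x‖ ^ 2 :=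
    setIntegral_congr_fun hΩ.measurableSet fun x hx => by simp only [hDv x hx]
  rw [a1, a2, ← a3, a4, sub_zero] at hlim
  set E := ∫ x in Ω, ‖Du x - ∇ uh x‖ ^ 2 with hE
  have hE0 : 0 ≤ E := integral_nonneg fun _ => sq_nonneg _
  have hle : 1 / (2 * C) * (interpConst d c * E) ≤ E / 2 := by
    rw [div_mul_eq_mul_div, one_mul, div_le_div_iff₀ (by positivity) two_pos]
    have : interpConst d c ≤ C := (le_abs_self _).trans (by linarith)
    nlinarith [mul_le_mul_of_nonneg_right this hE0]
  linarith

end Triangulation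

end FEM

theorem theorem3p1 (d : ℕ) (hd : d = 2 ∨ d = 3) (κ : ℝ) :
    ∃ Cr : ℝ, 0 < Cr ∧
      ∀ (Ω : Set (EuclideanSpace ℝ (Fin d))), IsOpen Ω →
      ∀ (T : FEM.Triangulation Ω), T.IsRegular κ →
      ∀ (f : EuclideanSpace ℝ (Fin d) → ℝ), MemLp f 2 (volume.restrict Ω) →
      ∀ (u : EuclideanSpace ℝ (Fin d) → ℝ)
        (Du : EuclideanSpace ℝ (Fin d) → EuclideanSpace ℝ (Fin d)),
        FEM.IsWeakSolution Ω f u Du →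
      ∀ (uh : FEM.P1Space T), FEM.IsDiscreteSolution T f uh →
      ∀ (G : FEM.P1Space T → FEM.RecoverySpace T),
        ∫ x in Ω, ‖Du x - ∇ (uh : EuclideanSpace ℝ (Fin d) → ℝ) x‖ ^ 2 ≤
          Cr * ∑ K ∈ T.elements, FEM.estimatorSq f uh (G uh) K := by
  have hd2 : 2 ≤ d := by omega
  -- No sign is imposed on `κ`; regularity persists when the constant is enlarged.
  have hκ : 0 < max κ 1 := lt_max_of_lt_right one_pos
  refine ⟨|FEM.Triangulation.interpConst d (4 * max κ 1)| + 1, by positivity, ?_⟩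
  intro Ω hΩ T hT f hf u Du hu uh huh G
  exact FEM.Triangulation.error_le hΩ hd2 (by positivity)
    ((hT.mono (le_max_left κ 1)).hasInballs hκ (by omega)) hf hu huh (G uh).2
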